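/- Let $d,n\ge 1$ and $q\geq 0$ be integers, $T>0$, $\Delta=T/n$, $t_k=k\Delta$, $x_0\in\mathbb R^d$. Let $|\cdot|$ be the Euclidean norm, $\|A\|=\sqrt{\mathrm{Tr}(AA^\star)}$ for matrices, and $\|X\|_r=(\mathbb E|X|^r)^{1/r}$ for random vectors. Let $b:[0,T]\times\mathbb R^d\to\mathbb R^d$ and $\sigma:[0,T]\times\mathbb R^d\to\mathbb R^{d\times q}$ satisfy, for all $t\in[0,T]$ and $x,y\in\mathbb R^d$, $$|b(t,x)-b(t,y)|\le [b]_{\rm Lip}|x-y|,\quad \|\sigma(t,x)-\sigma(t,y)\|\le[\sigma]_{\rm Lip}|x-y|,\quad |b(t,x)|\vee\|\sigma(t,x)\|\le L(1+|x|),$$ with $L>0$. Let $Z_1,\dots,Z_n$ be i.i.d. $\mathcal N(0;I_q)$, put $\mathcal E_k(x,z)=x+\Delta\, b(t_k,x)+\sqrt\Delta\,\sigma(t_k,x)z$, and let $\bar X_0=x_0$, $\bar X_{k+1}=\mathcal E_k(\bar X_k,Z_{k+1})$ be the Euler scheme. Its Markovian product quantization $(\hat X_k)_{0\le k\le n}$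 is defined recursively by $$\tilde X_0=x_0,\qquad \hat X_k=\big(\mathrm{Proj}_{\Gamma_k^1}(\tilde X_k^1),\dots,\mathrm{Proj}_{\Gamma_k^d}(\tilde X_k^d)\big),\qquad \tilde X_{k+1}=\mathcal E_k(\hat X_k,Z_{k+1}),$$ where $\mathrm{Proj}_\Gamma$ is a Borel nearest-neighbour projection onto $\Gamma$ and, for every $k\le n$ and $\ell\le d$, $\Gamma_k^\ell\subset\mathbb R$ is a quadratic optimal quantizer of $\tilde X_k^\ell$ at level $N_k^\ell$, i.e. it minimises $\mathbb E[\mathrm{dist}(\tilde X_k^\ell,\Gamma)^2]$ over nonempty $\Gamma\subset \mathbb R$ with $|\Gamma|\le N_k^\ell$. Let $N_k\ge1$ be integers with $N_k\le (N_k^\ell)^d$ for all $\ell$ (for instance $N_k=N_k^1\times\cdots\times N_k^d$, the size of the product grid, when $N_k^1=\dots=N_k^d$). For $\eta\in(0,1]$, call $K$ a Pierce constant if, for every real random variable $X$ and every integer $N\ge1$, $$\inf_{|\Gamma|\le N}\|\mathrm{dist}(X,\Gamma)\|_2\le K\,\inf_{\zeta\in\mathbb R}\|X-\zeta\|_{2+\eta}\,N^{-1}.$$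 Then a Pierce constant exists, and for every Pierce constant $K_{2,\eta}$ and every $k=0,\dots,n$, $$\|\bar X_k-\hat X_k\|_2\le K_{2,\eta}\sum_{k'=1}^k e^{(k-k')\Delta C_{b,\sigma}}\,a_{k'}(b,\sigma,d,k,\Delta,x_0,L,2+\eta)\,N_{k'}^{-1/d},$$ where $C_{b,\sigma}=[b]_{\rm Lip}+\frac12[\sigma]_{\rm Lip}^2$ and, for $p\in(2,3]$, $$a_{k'}(b,\sigma,d,k,\Delta,x_0,L,p)=e^{\Delta C_{b,\sigma}\frac{k-k'}{p}}\Big[e^{(\kappa_p+K_p)t_{k'}}|x_0|^p+\frac{d^{k(\frac p2-1)}e^{\kappa_p\Delta}L+K_p}{d^{\frac p2-1}(\kappa_p+K_p)}\big(e^{(\kappa_p+K_p)t_{k'}}-1\big)\Big]^{1/p},$$ $$\kappa_p=\frac{(p+1)(p-2)}2+2pL,\qquad K_p=2^{p-1}L^p\Big(1+p+\frac{p(p-1)}2\Delta^{\frac p2-1}\Big)\mathbb E|Z|^p,\quad Z\sim\mathcal N(0;I_d).$$ -/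

import Mathlib

open MeasureTheory ProbabilityTheory
open scoped ENNReal

namespace MarkovQuant

noncomputable section

/-! ### Scalar quadratic quantization -/

/-- Quadratic distortion `∫ dist(x, Γ)² dμ(x)` of the grid `Γ` for the law `μ`; its square root is the
quantization error `‖X - X̂^Γ‖₂` of a random variable `X` with law `μ`. -/
def distortion (μ : Measure ℝ) (Γ : Finset ℝ) : ℝ≥0∞ :=
  ∫⁻ x, (Metric.infEDist x (Γ : Set ℝ)) ^ 2 ∂μ

/-- `Γ` is a quadratic optimal quantizer at level `N` of the law `μ`: it minimises the distortion
among all grids with at most `N` points. -/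
structure IsOptimalQuantizer (μ : Measure ℝ) (N : ℕ) (Γ : Finset ℝ) : Prop where
  nonempty : Γ.Nonempty
  card_le : Γ.card ≤ N
  optimal : ∀ Γ' : Finset ℝ, Γ'.Nonempty → Γ'.card ≤ N → distortion μ Γ ≤ distortion μ Γ'

/-- `proj` is a Borel nearest neighbour projection onto the grid `Γ` (that is, it is the projection
attached to some Borel Voronoi partition of `Γ`). -/
structure IsNearestProj (Γ : Finset ℝ) (proj : ℝ → ℝ) : Prop where
  measurable : Measurable proj
  mem : ∀ x, proj x ∈ Γ
  nearest : ∀ x, ∀ y ∈ Γ, |x - proj x| ≤ |x - y|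

/-- `K` is an admissible value of the universal constant `K_{2,1,η}` of Pierce's inequality in
dimension one:
`inf_{|Γ| ≤ N} ‖X - X̂^Γ‖₂ ≤ K · (inf_ζ ‖X - ζ‖_{2+η}) · N⁻¹`
for every real random variable `X` (of law `μ`) and every `N ≥ 1`. -/
def IsPierceConstant (η K : ℝ) : Prop :=
  ∀ (μ : Measure ℝ) [IsProbabilityMeasure μ] (N : ℕ), 1 ≤ N →
    (⨅ Γ : {Γ : Finset ℝ // Γ.Nonempty ∧ Γ.card ≤ N}, (distortion μ Γ.1) ^ (1 / 2 : ℝ)) ≤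
      ENNReal.ofReal K * (⨅ ζ : ℝ, eLpNorm (fun x : ℝ => x - ζ) (ENNReal.ofReal (2 + η)) μ) *
        (N : ℝ≥0∞)⁻¹

/-! ### The Euler scheme and its Markovian product quantization -/

/-- The matrix norm `‖A‖ = √Tr(A Aᵀ) = (∑ aᵢⱼ²)^{1/2}`. -/
def frobNorm {d q : ℕ} (A : Matrix (Fin d) (Fin q) ℝ) : ℝ :=
  Real.sqrt (∑ i, ∑ j, A i j ^ 2)

/-- The Euler operator `𝓔ₖ(x, z) = x + Δ b(tₖ, x) + √Δ σ(tₖ, x) z`, with `tₖ = k Δ`. -/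
def eulerOp {d q : ℕ} (b : ℝ → EuclideanSpace ℝ (Fin d) → EuclideanSpace ℝ (Fin d))
    (σ : ℝ → EuclideanSpace ℝ (Fin d) → Matrix (Fin d) (Fin q) ℝ) (Δ : ℝ) (k : ℕ)
    (x : EuclideanSpace ℝ (Fin d)) (z : EuclideanSpace ℝ (Fin q)) : EuclideanSpace ℝ (Fin d) :=
  x + Δ • b (k * Δ) x + Real.sqrt Δ • WithLp.toLp 2 (Matrix.mulVec (σ (k * Δ) x) z.ofLp)

/-- The Euler scheme `X̄₀ = x₀`, `X̄ₖ₊₁ = 𝓔ₖ(X̄ₖ, Zₖ₊₁)`. -/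
def euler {d q : ℕ} {Ω : Type*} (b : ℝ → EuclideanSpace ℝ (Fin d) → EuclideanSpace ℝ (Fin d))
    (σ : ℝ → EuclideanSpace ℝ (Fin d) → Matrix (Fin d) (Fin q) ℝ) (Δ : ℝ)
    (x₀ : EuclideanSpace ℝ (Fin d)) (Z : ℕ → Ω → EuclideanSpace ℝ (Fin q)) :
    ℕ → Ω → EuclideanSpace ℝ (Fin d)
  | 0, _ => x₀
  | k + 1, ω => eulerOp b σ Δ k (euler b σ Δ x₀ Z k ω) (Z (k + 1) ω)

/-- Componentwise application of scalar maps; for nearest neighbour projections onto the grids `Γ^ℓ`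
this is the projection onto the product grid `⨂ Γ^ℓ`. -/
def prodProj {d : ℕ} (proj : Fin d → ℝ → ℝ) (x : EuclideanSpace ℝ (Fin d)) :
    EuclideanSpace ℝ (Fin d) :=
  WithLp.toLp 2 (fun l => proj l (x l))

/-- The process `X̃₀ = x₀`, `X̃ₖ₊₁ = 𝓔ₖ(X̂ₖ, Zₖ₊₁)`, where `X̂ₖ = (Proj_{Γₖ^ℓ}(X̃ₖ^ℓ))_ℓ`. -/
def tildeX {d q : ℕ} {Ω : Type*} (b : ℝ → EuclideanSpace ℝ (Fin d) → EuclideanSpace ℝ (Fin d))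
    (σ : ℝ → EuclideanSpace ℝ (Fin d) → Matrix (Fin d) (Fin q) ℝ) (Δ : ℝ)
    (x₀ : EuclideanSpace ℝ (Fin d)) (Z : ℕ → Ω → EuclideanSpace ℝ (Fin q))
    (proj : ℕ → Fin d → ℝ → ℝ) : ℕ → Ω → EuclideanSpace ℝ (Fin d)
  | 0, _ => x₀
  | k + 1, ω => eulerOp b σ Δ k (prodProj (proj k) (tildeX b σ Δ x₀ Z proj k ω)) (Z (k + 1) ω)

/-- The Markovian product quantization `X̂ₖ = (Proj_{Γₖ^ℓ}(X̃ₖ^ℓ))_ℓ`. -/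
def hatX {d q : ℕ} {Ω : Type*} (b : ℝ → EuclideanSpace ℝ (Fin d) → EuclideanSpace ℝ (Fin d))
    (σ : ℝ → EuclideanSpace ℝ (Fin d) → Matrix (Fin d) (Fin q) ℝ) (Δ : ℝ)
    (x₀ : EuclideanSpace ℝ (Fin d)) (Z : ℕ → Ω → EuclideanSpace ℝ (Fin q))
    (proj : ℕ → Fin d → ℝ → ℝ) (k : ℕ) (ω : Ω) : EuclideanSpace ℝ (Fin d) :=
  prodProj (proj k) (tildeX b σ Δ x₀ Z proj k ω)

/-! ### The constants -/

/-- `κ_p = (p+1)(p-2)/2 + 2 p L`. -/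
def kappa (L p : ℝ) : ℝ := (p + 1) * (p - 2) / 2 + 2 * p * L

/-- `K_p = 2^{p-1} L^p (1 + p + p(p-1)/2 · Δ^{p/2-1}) E|Z|^p`, with `Z ∼ 𝓝(0; I_d)`. -/
def bigK (d : ℕ) (Δ L p : ℝ) : ℝ :=
  2 ^ (p - 1) * L ^ p * (1 + p + p * (p - 1) / 2 * Δ ^ (p / 2 - 1)) *
    ∫ z, ‖z‖ ^ p ∂(stdGaussian (EuclideanSpace ℝ (Fin d)))

/-- The coefficient `a_{k'}(b, σ, d, k, Δ, x₀, L, p)`; it depends on `b, σ` through `L` and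
`C = C_{b,σ}`, and on `x₀` through `r = |x₀|`. -/
def coeffA (d k k' : ℕ) (C Δ r L p : ℝ) : ℝ :=
  Real.exp (Δ * C * (((k : ℝ) - k') / p)) *
    (Real.exp ((kappa L p + bigK d Δ L p) * (k' * Δ)) * r ^ p +
      ((d : ℝ) ^ ((k : ℝ) * (p / 2 - 1)) * Real.exp (kappa L p * Δ) * L + bigK d Δ L p) /
        ((d : ℝ) ^ (p / 2 - 1) * (kappa L p + bigK d Δ L p)) *
        (Real.exp ((kappa L p + bigK d Δ L p) * (k' * Δ)) - 1)) ^ (1 / p)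

end

end MarkovQuant

/-!
The error is decomposed along the scheme. Since `X̃_{k+1} = 𝓔_k(X̂_k, Z_{k+1})` and the Euler
operator is Lipschitz in `L²` with constant `exp (Δ C)` (`eLpNorm_eulerOp_sub_le`),
`‖X̄_k - X̂_k‖₂ ≤ ∑_{j ≤ k} exp ((k - j) Δ C) ‖X̃_j - X̂_j‖₂` (`eLpNorm_euler_sub_hatX_le`). The
term `j = 0` vanishes because an optimal quantizer of the Dirac mass at `x₀` contains its atom.

The local error `X̃_j - X̂_j` is bounded componentwise by the definition of a Pierce constant, with
the infimum over `ζ` estimated by the value at a fixed centre (`eLpNorm_sub_prodProj_le`). That a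
Pierce constant exists is shown with an explicit grid whose spacing grows like a power of the
distance to `ζ` (`exists_isPierceConstant`).

What remains is a bound for the `p`-th moments of `X̃_j`, with `p = 2 + η`, that does not exceed
the `p`-th power of `coeffA`. These are measured by `phi`, the `p`-th power of an `ℓ^p` distance to
a centre, rescaled by `d ^ (p / 2 - 1)` so as to dominate the Euclidean one. Two properties make
the recursion close.

* Quantization does not increase it. An optimal quadratic quantizer is stationary,
  `E[X | X̂] = X̂`, so that Jensen's inequality applies in each component, about every centre
  (`lintegral_abs_proj_sub_rpow_le`, `lintegral_phi_prodProj_le`).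
* One Euler step multiplies it by at most `exp ((κ_p + K_p) Δ)`, up to an additive constant of the
  size present in `coeffA` (`lintegral_phi_eulerOp_le`). The Gaussian noise is averaged with a
  symmetrized second-order bound for `|·| ^ p` in each component; the drift is handled by
  Minkowski's inequality in `ℓ^p`, where the rescaling costs a factor `d ^ (1 / 2 - 1 / p)`.
  Three-term AM-GM absorbs this factor into `κ_p` and the part `2 ^ (p - 1) L ^ p d ^ (p / 2)` of
  `K_p` (`drift_rate_le`); the rest of `K_p` dominates the diffusion (`diffusion_const_of_two_le`,
  `diffusion_const_one`).

The centre is `x₀` for `d ≥ 2`, so that the rescaling does not touch the initial value, and `0` for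
`d = 1`, where rescaling is void and the smaller constant of the convexity inequality for two terms
is needed.

Iterating gives the moment bound with a single power of `d` in front of `L`; the power in `coeffA`
is larger (`momentBound_rpow_le_coeffA`).
-/

/-! ### The drift constants -/

/-- Three-term weighted AM-GM, with the terms written as exponentials. -/
theorem exp_weighted_amgm {a b c x y z : ℝ} (ha : 0 ≤ a) (hb : 0 ≤ b) (hc : 0 ≤ c)
    (h : a + b + c = 1) :
    Real.exp (a * x + b * y + c * z) ≤ a * Real.exp x + b * Real.exp y + c * Real.exp z := by
  have := Real.geom_mean_le_arith_mean3_weighted ha hb hc (Real.exp_pos x).le (Real.exp_pos y).le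
    (Real.exp_pos z).le h
  rw [← Real.exp_mul, ← Real.exp_mul, ← Real.exp_mul, ← Real.exp_add, ← Real.exp_add] at this
  refine le_trans (le_of_eq ?_) this
  congr 1; ring

/-- The dimension factor `d ^ (1 / 2 - 1 / p)` is the price of measuring the drift in the rescaled
`ℓ^p` distance. AM-GM pays for it out of `2 ^ (p - 1) L ^ p d ^ (p / 2)`, a part of `K_p`, and
out of constants of `κ_p`: the left-hand side is `p` times the weighted geometric mean of
`2 ^ (p - 1) L ^ p d ^ (p / 2)`, `L` and `1 / 2`, with weights `(p - 2) / p ^ 2`, `2 / p` and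
`(p - 1) (p - 2) / p ^ 2`. -/
theorem dim_drift_le {p L d : ℝ} (hp : 2 < p) (hL : 0 < L) (hd : 0 < d) :
    p * (d ^ (1 / 2 - 1 / p) * L) ≤ (p - 2) / p * (2 ^ (p - 1) * (L ^ p * d ^ (p / 2))) + 2 * L +
      (p - 1) * (p - 2) / (2 * p) := by
  have hp0 : p ≠ 0 := by linarith
  have key := exp_weighted_amgm (a := (p - 2) / p ^ 2) (b := 2 / p) (c := (p - 1) * (p - 2) / p ^ 2)
    (x := Real.log 2 * (p - 1) + (Real.log L * p + Real.log d * (p / 2))) (y := Real.log L)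
    (z := -Real.log 2)
    (div_nonneg (by linarith) (by positivity)) (by positivity)
    (div_nonneg (mul_nonneg (by linarith) (by linarith)) (by positivity)) (by field_simp; ring)
  have e : d ^ (1 / 2 - 1 / p) * L = Real.exp ((p - 2) / p ^ 2 *
      (Real.log 2 * (p - 1) + (Real.log L * p + Real.log d * (p / 2))) + 2 / p * Real.log L +
      (p - 1) * (p - 2) / p ^ 2 * -Real.log 2) := by
    rw [Real.rpow_def_of_pos hd]
    nth_rewrite 1 [← Real.exp_log hL]
    rw [← Real.exp_add]
    congr 1
    field_simp
    ring
  rw [e]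
  refine (mul_le_mul_of_nonneg_left key (by linarith)).trans (le_of_eq ?_)
  rw [Real.exp_neg, Real.exp_add, Real.exp_add, Real.exp_log hL, Real.exp_log two_pos,
    ← Real.rpow_def_of_pos two_pos, ← Real.rpow_def_of_pos hL, ← Real.rpow_def_of_pos hd]
  field_simp

/-- The companion of `dim_drift_le` for the factor `(d ^ (1 / 2 - 1 / p)) ^ (p / (p - 1))`, with
weights `(p - 2) / (p (p - 1))`, `1 / (p - 1)` and `(p - 2) / p`. -/
theorem dim_drift_le' {p L d : ℝ} (hp : 2 < p) (hL : 0 < L) (hd : 0 < d) :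
    (p - 1) * ((d ^ (1 / 2 - 1 / p)) ^ (p / (p - 1)) * L) ≤
      (p - 2) / p * (2 ^ (p - 1) * (L ^ p * d ^ (p / 2))) + L +
      (p - 1) * (p - 2) / (2 * p) := by
  have hp0 : p ≠ 0 := by linarith
  have hp1 : p - 1 ≠ 0 := by linarith
  have hp1' : 0 < p - 1 := by linarith
  have key := exp_weighted_amgm (a := (p - 2) / (p * (p - 1))) (b := 1 / (p - 1)) (c := (p - 2) / p)
    (x := Real.log 2 * (p - 1) + (Real.log L * p + Real.log d * (p / 2))) (y := Real.log L)
    (z := -Real.log 2)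
    (div_nonneg (by linarith) (by positivity)) (by positivity)
    (div_nonneg (by linarith) (by positivity)) (by field_simp; ring)
  have e : (d ^ (1 / 2 - 1 / p)) ^ (p / (p - 1)) * L = Real.exp ((p - 2) / (p * (p - 1)) *
      (Real.log 2 * (p - 1) + (Real.log L * p + Real.log d * (p / 2))) + 1 / (p - 1) * Real.log L +
      (p - 2) / p * -Real.log 2) := by
    rw [← Real.rpow_mul hd.le, Real.rpow_def_of_pos hd]
    nth_rewrite 1 [← Real.exp_log hL]
    rw [← Real.exp_add]
    congr 1
    field_simp
    ring
  rw [e]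
  refine (mul_le_mul_of_nonneg_left key (by linarith)).trans (le_of_eq ?_)
  rw [Real.exp_neg, Real.exp_add, Real.exp_add, Real.exp_log hL, Real.exp_log two_pos,
    ← Real.rpow_def_of_pos two_pos, ← Real.rpow_def_of_pos hL, ← Real.rpow_def_of_pos hd]
  field_simp

/-- The growth rate produced by the drift in `drift_step_le` fits into `κ_p` and the first part of
`K_p`. -/
theorem drift_rate_le {p L d : ℝ} (hp : 2 < p) (hp3 : p ≤ 3) (hL : 0 < L) (hd : 0 < d) :
    (2 * p - 1) * (d ^ (1 / 2 - 1 / p) * L) +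
        (p - 1) * ((d ^ (1 / 2 - 1 / p)) ^ (p / (p - 1)) * L) ≤
      2 * p * L + (p - 2) + 2 ^ (p - 1) * (L ^ p * d ^ (p / 2)) := by
  have hp0 : 0 < p := by linarith
  have h1 := dim_drift_le hp hL hd
  have h2 := dim_drift_le' hp hL hd
  set x := d ^ (1 / 2 - 1 / p) * L
  set y := (p - 1) * ((d ^ (1 / 2 - 1 / p)) ^ (p / (p - 1)) * L)
  set T := 2 ^ (p - 1) * (L ^ p * d ^ (p / 2)) with hT
  have hT0 : 0 ≤ T := by positivity
  have h3 : (2 * p - 1) * x ≤ (2 * p - 1) / p * ((p - 2) / p * T + 2 * L +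
      (p - 1) * (p - 2) / (2 * p)) := by
    have : (2 * p - 1) * x = (2 * p - 1) / p * (p * x) := by field_simp
    rw [this]
    exact mul_le_mul_of_nonneg_left h1 (div_nonneg (by linarith) hp0.le)
  have e1 : (2 * p - 1) / p * ((p - 2) / p * T + 2 * L + (p - 1) * (p - 2) / (2 * p)) +
      ((p - 2) / p * T + L + (p - 1) * (p - 2) / (2 * p)) =
      (p - 2) * (3 * p - 1) / p ^ 2 * T + (5 - 2 / p) * L +
        (p - 1) * (3 * p - 1) / (2 * p ^ 2) * (p - 2) := by
    field_simp; ring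
  have c1 : (p - 2) * (3 * p - 1) / p ^ 2 ≤ 1 := by
    rw [div_le_one (by positivity)]; nlinarith
  have c2 : 5 - 2 / p ≤ 2 * p := by
    rw [sub_le_iff_le_add, ← sub_le_iff_le_add', le_div_iff₀ hp0]; nlinarith
  have c3 : (p - 1) * (3 * p - 1) / (2 * p ^ 2) ≤ 1 := by
    rw [div_le_one (by positivity)]; nlinarith
  have := mul_le_mul_of_nonneg_right c1 hT0
  have := mul_le_mul_of_nonneg_right c2 hL.le
  have := mul_le_mul_of_nonneg_right c3 (by linarith : (0:ℝ) ≤ p - 2)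
  linarith

/-- Convexity of `x ↦ x ^ p` for the weights `c₁`, `c₂`, `c₃ s` at the points `z₁`, `z₂`, `1 / s`.
The parameter `s` distributes the constant `c₃` between total mass and value. -/
theorem weighted_jensen_rpow {p c₁ c₂ c₃ s z₁ z₂ : ℝ} (hp : 1 ≤ p) (h₁ : 0 < c₁) (h₂ : 0 ≤ c₂)
    (h₃ : 0 ≤ c₃) (hs : 0 < s) (hz₁ : 0 ≤ z₁) (hz₂ : 0 ≤ z₂) :
    (c₁ * z₁ + c₂ * z₂ + c₃) ^ p ≤
      (c₁ + c₂ + c₃ * s) ^ (p - 1) * (c₁ * z₁ ^ p + c₂ * z₂ ^ p + c₃ * (s * (1 / s) ^ p)) := by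
  set S := c₁ + c₂ + c₃ * s with hS
  have hS0 : 0 < S := by positivity
  have := Real.rpow_arith_mean_le_arith_mean_rpow (Finset.univ : Finset (Fin 3))
    ![c₁ / S, c₂ / S, c₃ * s / S] ![z₁, z₂, 1 / s] (by
      intro i _; fin_cases i <;> simp <;> positivity) (by
      simp [Fin.sum_univ_three]; field_simp; rw [hS]) (by
      intro i _; fin_cases i <;> simp <;> positivity) hp
  simp only [Fin.sum_univ_three, Matrix.cons_val_zero, Matrix.cons_val_one, Matrix.cons_val] at this
  have e : c₁ * z₁ + c₂ * z₂ + c₃ = S * (c₁ / S * z₁ + c₂ / S * z₂ + c₃ * s / S * (1 / s)) := by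
    field_simp
  rw [e, Real.mul_rpow hS0.le (by positivity)]
  refine (mul_le_mul_of_nonneg_left this (by positivity)).trans (le_of_eq ?_)
  rw [Real.rpow_sub_one hS0.ne']
  field_simp

/-- One step of the drift. Here `v ^ p` is the moment before the step, `r` the norm of the centre
and `d ^ (1 / 2 - 1 / p)` the loss in passing from the Euclidean to the rescaled `ℓ^p` norm. -/
theorem drift_step_le {p L d Δ r v a : ℝ} (hp : 2 < p) (hp3 : p ≤ 3) (hL : 0 < L) (hd : 0 < d)
    (hΔ : 0 < Δ) (hr : 0 ≤ r) (hv : 0 ≤ v)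
    (ha : a = MarkovQuant.kappa L p + 2 ^ (p - 1) * (L ^ p * d ^ (p / 2))) :
    (1 + Δ * ((p - 1) * (p - 2) / 2)) *
        (v + Δ * (d ^ (1 / 2 - 1 / p) * L) * (1 + r + v)) ^ p ≤
      Real.exp (a * Δ) * v ^ p + (Real.exp (a * Δ) - 1) * r ^ p + Real.exp (a * Δ) * (L * Δ) := by
  have hrate := drift_rate_le hp hp3 hL hd
  set δ := d ^ (1 / 2 - 1 / p) with hδ
  have hδ0 : 0 < δ := by positivity
  -- With this `s` the constant term comes out as `L * Δ`, free of the dimension factor `δ`.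
  set s := δ ^ (1 / (p - 1)) with hs
  have hs0 : 0 < s := by positivity
  have hp1 : p - 1 ≠ 0 := by linarith
  have hp1' : 0 < p - 1 := by linarith
  have hδs : δ ^ (p / (p - 1)) = δ * s := by
    rw [hs]
    nth_rewrite 2 [← Real.rpow_one δ]
    rw [← Real.rpow_add hδ0]; congr 1; field_simp; ring
  have hsp : s * (1 / s) ^ p = 1 / δ := by
    have : s ^ (p - 1) = δ := by
      rw [hs, ← Real.rpow_mul hδ0.le, one_div_mul_cancel hp1, Real.rpow_one]
    rw [Real.div_rpow zero_le_one hs0.le, Real.one_rpow, ← this, Real.rpow_sub_one hs0.ne']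
    field_simp
  set x := Δ * (δ * L) with hx
  have hx0 : 0 < x := by positivity
  have hj := weighted_jensen_rpow (p := p) (c₁ := 1 + x) (c₂ := x) (c₃ := x) (s := s) (z₁ := v)
    (z₂ := r) (by linarith) (by positivity) hx0.le hx0.le hs0 hv hr
  have e1 : v + x * (1 + r + v) = (1 + x) * v + x * r + x := by ring
  have e2 : x * (1 / δ) = L * Δ := by rw [hx]; field_simp
  rw [hsp, e2] at hj
  rw [e1]
  set y := Δ * ((p - 1) * (p - 2) / 2) + (p - 1) * (2 * x + x * s) with hy
  have hq : 0 ≤ (p - 1) * (p - 2) / 2 := by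
    have := mul_nonneg hp1'.le (by linarith : 0 ≤ p - 2); linarith
  have hy0 : 0 ≤ y := by rw [hy]; positivity
  have hya : y + x ≤ a * Δ := by
    have := mul_le_mul_of_nonneg_left hrate hΔ.le
    rw [hδs] at this
    rw [ha, MarkovQuant.kappa, hy, hx]
    linarith
  -- Both prefactors of the weighted Jensen bound go into the exponential.
  have hpre : (1 + Δ * ((p - 1) * (p - 2) / 2)) * (1 + x + x + x * s) ^ (p - 1) ≤ Real.exp y := by
    rw [hy, Real.exp_add]
    gcongr
    · linarith [Real.add_one_le_exp (Δ * ((p - 1) * (p - 2) / 2))]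
    · rw [mul_comm (p - 1), Real.exp_mul]
      apply Real.rpow_le_rpow (by positivity) _ hp1'.le
      linarith [Real.add_one_le_exp (2 * x + x * s)]
  have hvp : 0 ≤ v ^ p := by positivity
  have hrp : 0 ≤ r ^ p := by positivity
  have hE0 := Real.exp_pos y
  have hEx : Real.exp y * (1 + x) ≤ Real.exp (a * Δ) := by
    refine le_trans ?_ (Real.exp_le_exp.2 hya)
    rw [Real.exp_add y x]
    exact mul_le_mul_of_nonneg_left (by linarith [Real.add_one_le_exp x]) hE0.le
  have hEy : 1 ≤ Real.exp y := Real.one_le_exp hy0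
  have hE1 : Real.exp y ≤ Real.exp (a * Δ) := Real.exp_le_exp.2 (by linarith)
  calc _ ≤ (1 + Δ * ((p - 1) * (p - 2) / 2)) * ((1 + x + x + x * s) ^ (p - 1) *
        ((1 + x) * v ^ p + x * r ^ p + L * Δ)) := by gcongr
    _ ≤ Real.exp y * ((1 + x) * v ^ p + x * r ^ p + L * Δ) := by
        rw [← mul_assoc]; exact mul_le_mul_of_nonneg_right hpre (by positivity)
    _ = (Real.exp y * (1 + x)) * v ^ p + (Real.exp y * (1 + x) - Real.exp y) * r ^ p +
        Real.exp y * (L * Δ) := by ring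
    _ ≤ _ := by
        have h1 := mul_le_mul_of_nonneg_right hEx hvp
        have h2 := mul_le_mul_of_nonneg_right (sub_le_sub hEx hEy) hrp
        have h3 := mul_le_mul_of_nonneg_right hE1 (mul_pos hL hΔ).le
        linarith

/-! ### The diffusion constants -/

theorem exp_add_le_exp_add {x y : ℝ} (hx : 0 ≤ x) (hy : 0 ≤ y) :
    Real.exp x + y ≤ Real.exp (x + y) := by
  rw [Real.exp_add]
  nlinarith [Real.add_one_le_exp y, Real.one_le_exp hx]

/-- This is `z / 2 ≤ sinh (z / 2)`. The gain of `exp (z / 2)` over the bound `z ≤ exp z - 1` is what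
lets a part of `K_p` act inside the exponential in `drift_add_diffusion_le`. -/
theorem mul_exp_half_le_exp_sub_one {z : ℝ} (hz : 0 ≤ z) :
    z * Real.exp (z / 2) ≤ Real.exp z - 1 := by
  have h := Real.self_le_sinh_iff.2 (by linarith : 0 ≤ z / 2)
  rw [Real.sinh_eq] at h
  have e1 : Real.exp (z / 2) * Real.exp (z / 2) = Real.exp z := by
    rw [← Real.exp_add]; congr 1; ring
  have e2 : Real.exp (z / 2) * Real.exp (-(z / 2)) = 1 := by
    rw [← Real.exp_add]; simp
  nlinarith [mul_le_mul_of_nonneg_left h (Real.exp_pos (z / 2)).le]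

/-- Drift and diffusion together. The constant `K` is split into the part `K₁`, already spent on the
drift, and the diffusion constant `q`; what is left of the additive term is bounded by
`(exp κΔ L + g) / (κ + K)`, where `g` stands for `K / d ^ (p / 2 - 1)`. -/
theorem drift_add_diffusion_le {κ K K₁ q g L Δ rp vp : ℝ} (hκ : 0 ≤ κ) (hK₁ : 0 ≤ K₁) (hq : 0 ≤ q)
    (hL : 0 ≤ L) (hΔ : 0 < Δ) (hrp : 0 ≤ rp) (hvp : 0 ≤ vp) (hΛ : 0 < κ + K)
    (h₁ : K₁ + q ≤ K) (h₂ : q ≤ g) (h₃ : K₁ ≤ K / 2) :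
    Real.exp ((κ + K₁) * Δ) * vp + (Real.exp ((κ + K₁) * Δ) - 1) * rp +
        Real.exp ((κ + K₁) * Δ) * (L * Δ) + Δ * q * (1 + rp + vp) ≤
      Real.exp ((κ + K) * Δ) * vp +
        (Real.exp ((κ + K) * Δ) - 1) * (rp + (Real.exp (κ * Δ) * L + g) / (κ + K)) := by
  have e1 : Real.exp ((κ + K₁) * Δ) + Δ * q ≤ Real.exp ((κ + K) * Δ) := by
    refine (exp_add_le_exp_add (by positivity) (by positivity)).trans (Real.exp_le_exp.2 ?_)
    nlinarith
  set F := (Real.exp ((κ + K) * Δ) - 1) / (κ + K) with hF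
  have e2 : Δ * Real.exp ((κ + K) * Δ / 2) ≤ F := by
    rw [hF, le_div_iff₀ hΛ]
    linarith [mul_exp_half_le_exp_sub_one (by positivity : 0 ≤ (κ + K) * Δ)]
  have e3 : Real.exp (K₁ * Δ) ≤ Real.exp ((κ + K) * Δ / 2) := by
    apply Real.exp_le_exp.2; nlinarith
  have e4 : 1 ≤ Real.exp ((κ + K) * Δ / 2) := Real.one_le_exp (by positivity)
  have e5 : Real.exp ((κ + K₁) * Δ) * (L * Δ) ≤ Real.exp (κ * Δ) * L * F := by
    rw [add_mul, Real.exp_add]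
    have : Real.exp (K₁ * Δ) * Δ ≤ F := by nlinarith
    have h := mul_le_mul_of_nonneg_left this (mul_nonneg (Real.exp_pos (κ * Δ)).le hL)
    linarith
  have e6 : Δ * q ≤ g * F := by
    have : Δ ≤ F := by nlinarith
    calc Δ * q ≤ F * g := mul_le_mul this h₂ hq (hΔ.le.trans this)
      _ = _ := mul_comm _ _
  have e7 : (Real.exp ((κ + K) * Δ) - 1) * (rp + (Real.exp (κ * Δ) * L + g) / (κ + K)) =
      (Real.exp ((κ + K) * Δ) - 1) * rp + (Real.exp (κ * Δ) * L * F + g * F) := by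
    rw [hF]; ring
  rw [e7]
  have := mul_le_mul_of_nonneg_right e1 hrp
  have := mul_le_mul_of_nonneg_right e1 hvp
  linarith

/-- Together with `three_halves_const_le'` this compares the factor `3 ^ (p - 1)` of the convexity
inequality for three terms with the factor `2 ^ (p - 1)` in `K_p`, using
`d ^ (p - 2) ≤ 2 ^ (p / 2 - 2) d ^ (p / 2)` for `2 ≤ d`. -/
theorem three_halves_const_le {p : ℝ} (hp : 2 < p) (hp3 : p ≤ 3) :
    (3 / 2 : ℝ) ^ (p - 1) * 2 ^ (p / 2 - 2) * (p - 1) ≤ p + 1 := by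
  have h1 : (3 / 2 : ℝ) ^ (p - 1) ≤ 9 / 4 := by
    calc (3 / 2 : ℝ) ^ (p - 1) ≤ (3 / 2 : ℝ) ^ (2 : ℝ) :=
          Real.rpow_le_rpow_of_exponent_le (by norm_num) (by linarith)
      _ = 9 / 4 := by norm_num
  have h2 : (2 : ℝ) ^ (p / 2 - 2) ≤ 32 / 45 := by
    calc (2 : ℝ) ^ (p / 2 - 2) ≤ (2 : ℝ) ^ (-(1 / 2) : ℝ) :=
          Real.rpow_le_rpow_of_exponent_le (by norm_num) (by linarith)
      _ = 1 / √2 := by rw [Real.rpow_neg (by norm_num), Real.sqrt_eq_rpow, one_div, one_div]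
      _ ≤ 32 / 45 := by
          rw [div_le_iff₀ (by positivity)]
          have : 45 / 32 ≤ √2 := Real.le_sqrt_of_sq_le (by norm_num)
          linarith
  have h3 : (3 / 2 : ℝ) ^ (p - 1) * 2 ^ (p / 2 - 2) ≤ 9 / 4 * (32 / 45) := by gcongr
  nlinarith

theorem three_halves_const_le' {p : ℝ} (hp : 2 < p) (hp3 : p ≤ 3) :
    (3 / 2 : ℝ) ^ (p - 1) * 2 ^ (p / 2 - 2) * 3 ^ (p / 2 - 1) ≤ p * (p - 1) / 2 := by
  have h6 : √6 ≤ 2.45 := Real.sqrt_le_iff.2 ⟨by norm_num, by norm_num⟩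
  have h60 : 1 ≤ √6 := Real.le_sqrt_of_sq_le (by norm_num)
  have e : (3 / 2 : ℝ) ^ (p - 1) * 2 ^ (p / 2 - 2) * 3 ^ (p / 2 - 1) =
      3 / 4 * (3 / 2 * √6) ^ (p - 2) := by
    rw [Real.mul_rpow (by norm_num) (by positivity), Real.sqrt_eq_rpow, ← Real.rpow_mul (by norm_num),
      show (p - 1) = (p - 2) + 1 by ring, Real.rpow_add_one (by norm_num),
      show p / 2 - 2 = (p / 2 - 1) - 1 by ring, Real.rpow_sub_one (by norm_num),
      show (1 / 2 * (p - 2)) = p / 2 - 1 by ring, show (6 : ℝ) = 2 * 3 by norm_num,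
      Real.mul_rpow (x := 2) (y := 3) (by norm_num) (by norm_num)]
    ring
  rw [e]
  have h := rpow_one_add_le_one_add_mul_self (s := 3 / 2 * √6 - 1) (by linarith)
    (by linarith : 0 ≤ p - 2) (by linarith)
  rw [add_sub_cancel] at h
  have h2 : (p - 2) * (3 / 2 * √6 - 1) ≤ (p - 2) * 2.675 :=
    mul_le_mul_of_nonneg_left (by linarith) (by linarith)
  nlinarith [sq_nonneg (p - 2 - 1 / 2)]

/-- The two conditions on the diffusion constant required by `drift_add_diffusion_le`, for `2 ≤ d`.
Here `τ = Δ ^ (p / 2 - 1)`, `c` is the `p`-th absolute moment of `𝓝(0; 1)` and `m` that of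
`𝓝(0; I_d)`. -/
theorem diffusion_const_of_two_le {p d L τ c m : ℝ} (hp : 2 < p) (hp3 : p ≤ 3) (hd : 2 ≤ d)
    (hL : 0 < L) (hτ : 0 ≤ τ) (hc0 : 0 ≤ c) (hc : c ≤ 3 ^ (p / 2 - 1))
    (hm : d ^ (p / 2) ≤ m) :
    2 ^ (p - 1) * (L ^ p * d ^ (p / 2)) +
        3 ^ (p - 1) * (d ^ (p / 2 - 1) * L ^ p * (p - 1 + τ * c)) ≤
      2 ^ (p - 1) * L ^ p * (1 + p + p * (p - 1) / 2 * τ) * m ∧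
    3 ^ (p - 1) * (d ^ (p / 2 - 1) * L ^ p * (p - 1 + τ * c)) ≤
      2 ^ (p - 1) * L ^ p * (1 + p + p * (p - 1) / 2 * τ) * m / d ^ (p / 2 - 1) := by
  have hd0 : 0 < d := by linarith
  have hP : 0 ≤ p * (p - 1) / 2 := by nlinarith
  set β := (3 / 2 : ℝ) ^ (p - 1) * 2 ^ (p / 2 - 2) with hβ
  have hβ0 : 0 < β := by positivity
  have b1 := three_halves_const_le hp hp3
  have b2 := three_halves_const_le' hp hp3
  rw [← hβ] at b1 b2
  have e3 : (3 : ℝ) ^ (p - 1) = 2 ^ (p - 1) * (3 / 2) ^ (p - 1) := by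
    rw [← Real.mul_rpow (by norm_num) (by norm_num)]; norm_num
  set A := (2 : ℝ) ^ (p - 1) * L ^ p with hA
  have hA0 : 0 < A := by positivity
  have hbt : β * (p - 1 + τ * c) ≤ 1 + p + p * (p - 1) / 2 * τ := by
    have : β * c ≤ p * (p - 1) / 2 := (mul_le_mul_of_nonneg_left hc hβ0.le).trans b2
    nlinarith [mul_le_mul_of_nonneg_left this hτ]
  have hR : 0 ≤ 1 + p + p * (p - 1) / 2 * τ := by positivity
  constructor
  · have h94 : (3 / 2 : ℝ) ^ (p - 1) ≤ 9 / 4 := by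
      calc (3 / 2 : ℝ) ^ (p - 1) ≤ (3 / 2 : ℝ) ^ (2 : ℝ) :=
            Real.rpow_le_rpow_of_exponent_le (by norm_num) (by linarith)
        _ = 9 / 4 := by norm_num
    have hβ' : (3 / 2 : ℝ) ^ (p - 1) / 2 ≤ β := by
      rw [hβ, div_eq_mul_inv]
      gcongr
      calc (2 : ℝ)⁻¹ = 2 ^ (-1 : ℝ) := by rw [Real.rpow_neg_one]
        _ ≤ _ := Real.rpow_le_rpow_of_exponent_le (by norm_num) (by linarith)
    have hb0 : 0 < (3 / 2 : ℝ) ^ (p - 1) := by positivity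
    have h3 : 0 ≤ (3 : ℝ) ^ (p / 2 - 1) := by positivity
    have key : 1 + (3 / 2 : ℝ) ^ (p - 1) / 2 * (p - 1 + τ * 3 ^ (p / 2 - 1)) ≤
        1 + p + p * (p - 1) / 2 * τ := by
      have : (3 / 2 : ℝ) ^ (p - 1) / 2 * 3 ^ (p / 2 - 1) ≤ p * (p - 1) / 2 :=
        (mul_le_mul_of_nonneg_right hβ' h3).trans b2
      nlinarith [mul_le_mul_of_nonneg_left this hτ]
    have hdd : d ^ (p / 2 - 1) ≤ d ^ (p / 2) / 2 := by
      rw [Real.rpow_sub_one hd0.ne']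
      gcongr
    calc 2 ^ (p - 1) * (L ^ p * d ^ (p / 2)) +
          3 ^ (p - 1) * (d ^ (p / 2 - 1) * L ^ p * (p - 1 + τ * c))
        ≤ 2 ^ (p - 1) * (L ^ p * d ^ (p / 2)) +
          3 ^ (p - 1) * (d ^ (p / 2) / 2 * L ^ p * (p - 1 + τ * 3 ^ (p / 2 - 1))) := by
          have : p - 1 + τ * c ≤ p - 1 + τ * 3 ^ (p / 2 - 1) := by gcongr
          have h0 : 0 ≤ p - 1 + τ * c := by
            have := mul_nonneg hτ hc0; linarith
          gcongr
      _ = A * (1 + (3 / 2 : ℝ) ^ (p - 1) / 2 * (p - 1 + τ * 3 ^ (p / 2 - 1))) * d ^ (p / 2) := by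
          rw [e3, hA]; ring
      _ ≤ A * (1 + p + p * (p - 1) / 2 * τ) * m := by gcongr
  · rw [le_div_iff₀ (Real.rpow_pos_of_pos hd0 _)]
    have hDD : d ^ (p / 2 - 1) * d ^ (p / 2 - 1) ≤ 2 ^ (p / 2 - 2) * d ^ (p / 2) := by
      rw [← Real.rpow_add hd0, show p / 2 - 1 + (p / 2 - 1) = (p / 2 - 2) + p / 2 by ring,
        Real.rpow_add hd0]
      refine mul_le_mul_of_nonneg_right ?_ (Real.rpow_nonneg hd0.le _)
      exact Real.rpow_le_rpow_of_nonpos two_pos hd (by linarith)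
    have h0 : 0 ≤ p - 1 + τ * c := by
      have := mul_nonneg hτ hc0; linarith
    calc 3 ^ (p - 1) * (d ^ (p / 2 - 1) * L ^ p * (p - 1 + τ * c)) * d ^ (p / 2 - 1)
        = A * (3 / 2) ^ (p - 1) * (p - 1 + τ * c) * (d ^ (p / 2 - 1) * d ^ (p / 2 - 1)) := by
          rw [e3, hA]; ring
      _ ≤ A * (3 / 2) ^ (p - 1) * (p - 1 + τ * c) * (2 ^ (p / 2 - 2) * d ^ (p / 2)) := by
          gcongr
      _ = A * (β * (p - 1 + τ * c)) * d ^ (p / 2) := by rw [hβ]; ring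
      _ ≤ _ := by gcongr

/-- The diffusion constant for `d = 1` and the centre `0`, where only two terms enter the convexity
inequality and `c` is at the same time the moment of `𝓝(0; I_d)`. -/
theorem diffusion_const_one {p L τ c : ℝ} (hp : 2 < p) (hL : 0 < L) (hτ : 0 ≤ τ) (hc : 1 ≤ c) :
    2 ^ (p - 1) * L ^ p + 2 ^ (p - 1) * (L ^ p * (p - 1 + τ * c)) ≤
      2 ^ (p - 1) * L ^ p * (1 + p + p * (p - 1) / 2 * τ) * c := by
  have hA0 : 0 < (2 : ℝ) ^ (p - 1) * L ^ p := by positivity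
  have : 1 + (p - 1 + τ * c) ≤ (1 + p + p * (p - 1) / 2 * τ) * c := by
    have h1 : (1 : ℝ) ≤ p * (p - 1) / 2 := by nlinarith
    have h2 := mul_le_mul_of_nonneg_right h1 (mul_nonneg hτ (by linarith : 0 ≤ c))
    nlinarith
  nlinarith [mul_le_mul_of_nonneg_left this hA0.le]

/-! ### Inequalities for powers -/

theorem one_add_rpow_one_add_le {q x : ℝ} (hq : 0 < q) (hq1 : q ≤ 1) (hx : 0 ≤ x) :
    (1 + x) ^ q * (1 + x) ≤ 1 + (q + 1) * x + x ^ q * x := by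
  rcases le_total x 1 with h | h
  · have h1 := rpow_one_add_le_one_add_mul_self (s := x) (by linarith) hq.le hq1
    have h2 : x ≤ x ^ q := by
      simpa using Real.rpow_le_rpow_of_exponent_ge' hx h hq.le hq1
    nlinarith [mul_le_mul_of_nonneg_right h1 (by linarith : 0 ≤ 1 + x),
      mul_le_mul_of_nonneg_right h2 hx]
  · have hx0 : 0 < x := by linarith
    have h1 := rpow_one_add_le_one_add_mul_self (s := 1 / x) (by
      have := one_div_pos.2 hx0; linarith) hq.le hq1
    have e : 1 + x = x * (1 + 1 / x) := by field_simp; ring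
    have h2 : x ^ q ≤ x := by
      simpa using Real.rpow_le_rpow_of_exponent_le h hq1
    have h0 : 0 ≤ x ^ q := by positivity
    have h3 : (1 + x) ^ q ≤ x ^ q * (1 + q * (1 / x)) := by
      rw [e, Real.mul_rpow hx (by positivity)]
      exact mul_le_mul_of_nonneg_left h1 h0
    have h4 : x ^ q * (1 / x) ≤ 1 := by
      rw [mul_one_div]; exact div_le_one_of_le₀ h2 hx
    have h5 : (1 + x) ^ q * (1 + x) ≤ x ^ q * (1 + q * (1 / x)) * (1 + x) :=
      mul_le_mul_of_nonneg_right h3 (by linarith)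
    have e6 : x ^ q * (1 + q * (1 / x)) * (1 + x) =
        x ^ q * x + (1 + q) * x ^ q + q * (x ^ q * (1 / x)) := by field_simp; ring
    nlinarith

/-- First-order expansion of `a ↦ |a| ^ q a`, whose derivative `(q + 1) |a| ^ q` is only `q`-Hölder:
the remainder is at most `h ^ q h`. -/
theorem signed_rpow_add_le {q a h : ℝ} (hq : 0 < q) (hq1 : q ≤ 1) (hh : 0 ≤ h) :
    |a + h| ^ q * (a + h) ≤ |a| ^ q * a + (q + 1) * |a| ^ q * h + h ^ q * h := by
  rcases lt_trichotomy a 0 with ha | rfl | ha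
  · obtain ⟨b, rfl⟩ : ∃ b, a = -b := ⟨-a, by ring⟩
    have hb : 0 < b := by linarith
    rw [abs_neg, abs_of_pos hb]
    have hbq : 0 < b ^ q := by positivity
    rcases le_total b h with hbh | hbh
    · rw [abs_of_nonneg (by linarith)]
      have h1 : (-b + h) ^ q * (-b + h) ≤ h ^ q * h := by
        have : -b + h ≤ h := by linarith
        have h0 : 0 ≤ -b + h := by linarith
        exact mul_le_mul (Real.rpow_le_rpow h0 this hq.le) this h0 (by positivity)
      nlinarith [mul_le_mul_of_nonneg_left hbh hbq.le, mul_nonneg (mul_pos hq hbq).le hh]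
    · rw [abs_of_nonpos (by linarith)]
      have hx : 0 ≤ h / b := by positivity
      have hx1 : h / b ≤ 1 := (div_le_one hb).2 hbh
      have h1 := one_add_mul_self_le_rpow_one_add (s := -(h / b)) (by linarith)
        (p := q + 1) (by linarith)
      have e : -(-b + h) = b * (1 + -(h / b)) := by field_simp; ring
      have e2 : -b + h = -(b * (1 + -(h / b))) := by field_simp; ring
      rw [e]
      rw [e2]
      rw [Real.mul_rpow hb.le (by linarith)]
      have e3 : (1 + -(h / b)) ^ (q + 1) = (1 + -(h / b)) ^ q * (1 + -(h / b)) := by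
        rw [Real.rpow_add' (by linarith) (by linarith), Real.rpow_one]
      rw [e3] at h1
      have h2 := mul_le_mul_of_nonneg_left h1 (by positivity : 0 ≤ b ^ q * b)
      have e4 : b ^ q * b * (1 + (q + 1) * -(h / b)) = b ^ q * b - (q + 1) * b ^ q * h := by
        field_simp; ring
      have : 0 ≤ h ^ q * h := by positivity
      rw [e4] at h2
      nlinarith
  · simp [abs_of_nonneg hh, hq.ne']
  · rw [abs_of_pos ha, abs_of_nonneg (by linarith)]
    have hx : 0 ≤ h / a := by positivity
    have h1 := one_add_rpow_one_add_le hq hq1 hx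
    have h2 := mul_le_mul_of_nonneg_left h1 (by positivity : 0 ≤ a ^ q * a)
    have e : a + h = a * (1 + h / a) := by field_simp
    have e1 : a ^ q * a * ((1 + h / a) ^ q * (1 + h / a)) = (a + h) ^ q * (a + h) := by
      rw [e, Real.mul_rpow ha.le (by positivity)]; ring
    have e2 : a ^ q * a * (1 + (q + 1) * (h / a) + (h / a) ^ q * (h / a)) =
        a ^ q * a + (q + 1) * a ^ q * h + h ^ q * h := by
      rw [Real.div_rpow hh ha.le]
      field_simp
    rwa [e1, e2] at h2

/-- Taylor bound of order two for `|·| ^ p`, `p ∈ (2, 3]`, with remainder `h ^ p` of constant one: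
the difference of the two sides is monotone in `h` by `signed_rpow_add_le`. -/
theorem abs_add_rpow_le {p a h : ℝ} (hp : 2 < p) (hp3 : p ≤ 3) (hh : 0 ≤ h) :
    |a + h| ^ p ≤ |a| ^ p + p * (|a| ^ (p - 2) * a) * h +
      p * (p - 1) / 2 * |a| ^ (p - 2) * h ^ 2 + h ^ p := by
  let F : ℝ → ℝ := fun t => p * (|a| ^ (p - 2) * a) * t +
      p * (p - 1) / 2 * |a| ^ (p - 2) * t ^ 2 + t ^ p - |a + t| ^ p
  let F' : ℝ → ℝ := fun t => p * (|a| ^ (p - 2) * a) +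
      p * (p - 1) / 2 * |a| ^ (p - 2) * (2 * t) + p * t ^ (p - 1) - p * |a + t| ^ (p - 2) * (a + t)
  have hd : ∀ t, HasDerivAt F (F' t) t := by
    intro t
    have h1 : HasDerivAt (fun t : ℝ => p * (|a| ^ (p - 2) * a) * t) (p * (|a| ^ (p - 2) * a)) t := by
      simpa using (hasDerivAt_id t).const_mul (p * (|a| ^ (p - 2) * a))
    have h2 : HasDerivAt (fun t : ℝ => p * (p - 1) / 2 * |a| ^ (p - 2) * t ^ 2)
        (p * (p - 1) / 2 * |a| ^ (p - 2) * (2 * t)) t := by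
      simpa using (hasDerivAt_pow 2 t).const_mul (p * (p - 1) / 2 * |a| ^ (p - 2))
    have h3 : HasDerivAt (fun t : ℝ => t ^ p) (p * t ^ (p - 1)) t :=
      Real.hasDerivAt_rpow_const (Or.inr (by linarith))
    have h4 : HasDerivAt (fun t : ℝ => |a + t| ^ p) (p * |a + t| ^ (p - 2) * (a + t)) t := by
      have := (hasDerivAt_abs_rpow (a + t) (p := p) (by linarith)).comp_const_add a t
      exact this
    exact ((h1.add h2).add h3).sub h4
  have hmono : MonotoneOn F (Set.Ici 0) := by
    apply monotoneOn_of_deriv_nonneg (convex_Ici 0)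
    · exact fun t _ => (hd t).continuousAt.continuousWithinAt
    · exact fun t _ => (hd t).differentiableAt.differentiableWithinAt
    · intro t ht
      rw [interior_Ici, Set.mem_Ioi] at ht
      rw [(hd t).deriv]
      have h1 := signed_rpow_add_le (q := p - 2) (a := a) (by linarith) (by linarith) ht.le
      have e : t ^ (p - 1) = t ^ (p - 2) * t := by
        rw [show p - 1 = p - 2 + 1 by ring, Real.rpow_add_one ht.ne']
      simp only [F', e]
      have h2 := mul_le_mul_of_nonneg_left h1 (by linarith : 0 ≤ p)
      nlinarith
  have h0 := hmono Set.self_mem_Ici hh hh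
  have hp0 : p ≠ 0 := by linarith
  simp only [F, add_zero, mul_zero, Real.zero_rpow hp0] at h0
  simp only [ne_eq, OfNat.ofNat_ne_zero, not_false_eq_true, zero_pow, mul_zero] at h0
  linarith

/-- The first-order term cancels on symmetrization. -/
theorem abs_add_rpow_add_abs_sub_rpow_le {p : ℝ} (a h : ℝ) (hp : 2 < p) (hp3 : p ≤ 3) :
    |a + h| ^ p + |a - h| ^ p ≤
      2 * (|a| ^ p + p * (p - 1) / 2 * |a| ^ (p - 2) * h ^ 2 + |h| ^ p) := by
  wlog hh : 0 ≤ h generalizing h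
  · have := this (-h) (by linarith)
    rw [abs_neg, neg_sq, sub_neg_eq_add, ← sub_eq_add_neg] at this
    linarith
  have h1 := abs_add_rpow_le (a := a) hp hp3 hh
  have h2 := abs_add_rpow_le (a := -a) hp hp3 hh
  rw [abs_neg, show -a + h = -(a - h) by ring, abs_neg] at h2
  rw [abs_of_nonneg hh]
  linarith

/-- The graph of `|·| ^ p` lies above its tangent at `a`. -/
theorem rpow_tangent_le {p : ℝ} (x a : ℝ) (hp : 2 < p) :
    |a| ^ p + p * (|a| ^ (p - 2) * a) * (x - a) ≤ |x| ^ p := by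
  have hp0 : p ≠ 0 := by linarith
  have hp1 : p - 1 ≠ 0 := by linarith
  have hc : p.HolderConjugate (p / (p - 1)) := Real.HolderConjugate.conjExponent (by linarith)
  have h := Real.young_inequality_of_nonneg (abs_nonneg x)
    (Real.rpow_nonneg (abs_nonneg a) (p - 1)) hc
  rw [← Real.rpow_mul (abs_nonneg a), mul_div_cancel₀ _ hp1] at h
  have e1 : |a| ^ (p - 2) * a * a = |a| ^ p := by
    rw [mul_assoc, ← abs_mul_abs_self a, ← mul_assoc, ← Real.rpow_add_one' (abs_nonneg a) (by linarith),
      ← Real.rpow_add_one' (abs_nonneg a) (by linarith)]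
    congr 1; ring
  have e2 : |a| ^ (p - 2) * a * x ≤ |x| * |a| ^ (p - 1) := by
    have : |a| ^ (p - 1) = |a| ^ (p - 2) * |a| := by
      rw [← Real.rpow_add_one' (abs_nonneg a) (by linarith)]; congr 1; ring
    rw [this]
    have h1 : a * x ≤ |a| * |x| := by rw [← abs_mul]; exact le_abs_self _
    nlinarith [mul_le_mul_of_nonneg_left h1 (Real.rpow_nonneg (abs_nonneg a) (p - 2))]
  have h3 : p * (|x| * |a| ^ (p - 1)) ≤ |x| ^ p + (p - 1) * |a| ^ p := by
    calc _ ≤ p * (|x| ^ p / p + |a| ^ p / (p / (p - 1))) :=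
          mul_le_mul_of_nonneg_left h (by linarith)
      _ = _ := by field_simp
  have h4 := mul_le_mul_of_nonneg_left e2 (by linarith : 0 ≤ p)
  calc |a| ^ p + p * (|a| ^ (p - 2) * a) * (x - a)
      = |a| ^ p + p * (|a| ^ (p - 2) * a * x) - p * (|a| ^ (p - 2) * a * a) := by ring
    _ ≤ |x| ^ p := by rw [e1]; linarith

/-- Young's inequality with exponents `p / (p - 2)` and `p / 2`, which splits the Itô correction
`p (p - 1) / 2 |a| ^ (p - 2) s ^ 2`. -/
theorem young_diffusion {p A s : ℝ} (hp : 2 < p) (hA : 0 ≤ A) (hs : 0 ≤ s) :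
    p * (p - 1) / 2 * A ^ (p - 2) * s ^ 2 ≤ (p - 1) * (p - 2) / 2 * A ^ p + (p - 1) * s ^ p := by
  have hp0 : p ≠ 0 := by linarith
  have h := Real.geom_mean_le_arith_mean2_weighted (w₁ := (p - 2) / p) (w₂ := 2 / p)
    (p₁ := A ^ p) (p₂ := s ^ p) (div_nonneg (by linarith) (by linarith)) (by positivity)
    (by positivity) (by positivity) (by field_simp; ring)
  rw [← Real.rpow_mul hA, ← Real.rpow_mul hs, mul_div_cancel₀ _ hp0, mul_div_cancel₀ _ hp0,
    Real.rpow_two] at h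
  calc p * (p - 1) / 2 * A ^ (p - 2) * s ^ 2 = p * (p - 1) / 2 * (A ^ (p - 2) * s ^ 2) := by ring
    _ ≤ p * (p - 1) / 2 * ((p - 2) / p * A ^ p + 2 / p * s ^ p) :=
        mul_le_mul_of_nonneg_left h (by nlinarith)
    _ = _ := by field_simp

theorem sum_rpow_le_rpow_sum {ι : Type*} (s : Finset ι) (f : ι → ℝ) (hf : ∀ i, 0 ≤ f i) {r : ℝ}
    (hr : 1 ≤ r) : ∑ i ∈ s, f i ^ r ≤ (∑ i ∈ s, f i) ^ r := by
  classical
  induction s using Finset.induction_on with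
  | empty => simp [Real.zero_rpow (by linarith : r ≠ 0)]
  | insert a s ha ih =>
    rw [Finset.sum_insert ha, Finset.sum_insert ha]
    exact (add_le_add_right ih _).trans
      (Real.add_rpow_le_rpow_add (hf a) (Finset.sum_nonneg fun i _ => hf i) hr)

theorem sum_abs_rpow_le {d : ℕ} {p : ℝ} (hp : 2 ≤ p) (x : EuclideanSpace ℝ (Fin d)) :
    ∑ l, |x l| ^ p ≤ ‖x‖ ^ p := by
  have h := sum_rpow_le_rpow_sum Finset.univ (fun l => |x l| ^ 2) (fun _ => by positivity)
    (by linarith : 1 ≤ p / 2)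
  have e : ∀ y : ℝ, 0 ≤ y → (y ^ 2) ^ (p / 2) = y ^ p := by
    intro y hy
    rw [← Real.rpow_natCast, ← Real.rpow_mul hy]; congr 1; push_cast; ring
  rw [EuclideanSpace.norm_eq, ← e _ (Real.sqrt_nonneg _), Real.sq_sqrt (by positivity)]
  simp only [e _ (abs_nonneg _)] at h
  simpa only [Real.norm_eq_abs, Finset.card_univ, Fintype.card_fin] using h

theorem norm_rpow_le_sum {d : ℕ} {p : ℝ} (hp : 2 ≤ p) (x : EuclideanSpace ℝ (Fin d)) :
    ‖x‖ ^ p ≤ (d : ℝ) ^ (p / 2 - 1) * ∑ l, |x l| ^ p := by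
  have h := Real.rpow_sum_le_const_mul_sum_rpow_of_nonneg (s := Finset.univ)
    (f := fun l => |x l| ^ 2) (by linarith : 1 ≤ p / 2) (fun _ _ => by positivity)
  have e : ∀ y : ℝ, 0 ≤ y → (y ^ 2) ^ (p / 2) = y ^ p := by
    intro y hy
    rw [← Real.rpow_natCast, ← Real.rpow_mul hy]; congr 1; push_cast; ring
  rw [EuclideanSpace.norm_eq, ← e _ (Real.sqrt_nonneg _), Real.sq_sqrt (by positivity)]
  simp only [e _ (abs_nonneg _)] at h
  simpa only [Real.norm_eq_abs, Finset.card_univ, Fintype.card_fin] using h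

/-- Mean value bound for `x ↦ x ^ α`, by convexity. -/
theorem rpow_sub_rpow_le {α s t : ℝ} (hα : 1 ≤ α) (hs : 0 < s) (ht : 0 ≤ t) :
    s ^ α - t ^ α ≤ α * s ^ (α - 1) * (s - t) := by
  have h := one_add_mul_self_le_rpow_one_add (s := t / s - 1) (by
    have : 0 ≤ t / s := by positivity
    linarith) hα
  rw [add_sub_cancel, Real.div_rpow ht hs.le, le_div_iff₀ (by positivity)] at h
  rw [Real.rpow_sub_one hs.ne']
  have e : α * (s ^ α / s) * (s - t) = -(α * (t / s - 1) * s ^ α) := by field_simp; ring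
  rw [e]; linarith

theorem one_add_add_rpow_le {p r v : ℝ} (hp : 1 ≤ p) (hr : 0 ≤ r) (hv : 0 ≤ v) :
    (1 + r + v) ^ p ≤ 3 ^ (p - 1) * (1 + r ^ p + v ^ p) := by
  have := weighted_jensen_rpow (c₁ := 1) (c₂ := 1) (c₃ := 1) (s := 1) hp one_pos zero_le_one
    zero_le_one one_pos hr hv
  norm_num at this
  rwa [add_comm (r + v), add_comm (r ^ p + v ^ p), ← add_assoc, ← add_assoc] at this

theorem one_add_rpow_le {p v : ℝ} (hp : 1 ≤ p) (hv : 0 ≤ v) :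
    (1 + v) ^ p ≤ 2 ^ (p - 1) * (1 + v ^ p) := by
  have := weighted_jensen_rpow (c₁ := 1) (c₂ := 0) (c₃ := 1) (s := 1) hp one_pos le_rfl
    zero_le_one one_pos hv le_rfl
  norm_num at this
  rwa [add_comm v, add_comm (v ^ p)] at this

/-! ### Pierce's inequality in dimension one -/

theorem eLpNorm_ofReal_eq_lintegral {α : Type*} [MeasurableSpace α] {μ : Measure α} {p : ℝ}
    (hp : 0 < p) (f : α → ℝ) :
    eLpNorm f (ENNReal.ofReal p) μ = (∫⁻ x, ENNReal.ofReal (|f x| ^ p) ∂μ) ^ (1 / p) := by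
  rw [eLpNorm_eq_lintegral_rpow_enorm_toReal (by simpa using hp) ENNReal.ofReal_ne_top,
    ENNReal.toReal_ofReal hp.le]
  congr 1
  refine lintegral_congr fun x => ?_
  rw [Real.enorm_eq_ofReal_abs, ENNReal.ofReal_rpow_of_nonneg (abs_nonneg _) hp.le]

/-- The grid `ζ ± m ((M / j) ^ α - 1)`, `1 ≤ j ≤ M`; the index `j = M` is the point `ζ` itself. -/
noncomputable def pierceGrid (ζ m α : ℝ) (M : ℕ) : Finset ℝ :=
  insert ζ ((Finset.Ico 1 M).image (fun j : ℕ => ζ + m * (((M : ℝ) / j) ^ α - 1)) ∪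
    (Finset.Ico 1 M).image (fun j : ℕ => ζ - m * (((M : ℝ) / j) ^ α - 1)))

theorem card_pierceGrid_le {ζ m α : ℝ} {M : ℕ} (hM : 1 ≤ M) :
    (pierceGrid ζ m α M).card ≤ 2 * M - 1 := by
  refine (Finset.card_insert_le _ _).trans ?_
  have h1 := Finset.card_union_le
    ((Finset.Ico 1 M).image (fun j : ℕ => ζ + m * (((M : ℝ) / j) ^ α - 1)))
    ((Finset.Ico 1 M).image (fun j : ℕ => ζ - m * (((M : ℝ) / j) ^ α - 1)))
  have h2 : ((Finset.Ico 1 M).image (fun j : ℕ => ζ + m * (((M : ℝ) / j) ^ α - 1))).card ≤ M - 1 :=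
    Finset.card_image_le.trans (by simp)
  have h3 : ((Finset.Ico 1 M).image (fun j : ℕ => ζ - m * (((M : ℝ) / j) ^ α - 1))).card ≤ M - 1 :=
    Finset.card_image_le.trans (by simp)
  omega

/-- The grid point is found by writing `1 + |x - ζ| / m = s ^ α` and taking the largest ratio
`M / j ≤ s`. -/
theorem exists_mem_pierceGrid {ζ m α : ℝ} {M : ℕ} (hm : 0 < m) (hα : 1 ≤ α) (hM : 1 ≤ M) (x : ℝ) :
    ∃ g ∈ pierceGrid ζ m α M, |x - g| ≤ m * α / M * (1 + |x - ζ| / m) ^ (1 + 1 / α) := by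
  have hα0 : 0 < α := by linarith
  set y := |x - ζ| / m with hy
  have hy0 : 0 ≤ y := by positivity
  set s := (1 + y) ^ (1 / α) with hs
  have hs1 : 1 ≤ s := Real.one_le_rpow (by linarith) (by positivity)
  have hs0 : 0 < s := by linarith
  have hM0 : (0 : ℝ) < M := by exact_mod_cast hM
  have hsα : s ^ α = 1 + y := by
    rw [hs, ← Real.rpow_mul (by linarith), one_div_mul_cancel hα0.ne', Real.rpow_one]
  -- the smallest index whose grid point does not overshoot
  set j := ⌈(M : ℝ) / s⌉₊ with hj
  have hj1 : (M : ℝ) / s ≤ j := Nat.le_ceil _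
  have hj2 : (j : ℝ) < M / s + 1 := Nat.ceil_lt_add_one (by positivity)
  have hj0 : 1 ≤ j := Nat.ceil_pos.2 (by positivity)
  have hjM : j ≤ M := Nat.ceil_le.2 (div_le_self hM0.le hs1)
  have hj0' : (0 : ℝ) < j := by exact_mod_cast hj0
  set t := (M : ℝ) / j with ht
  have ht0 : 0 < t := by positivity
  have hMj : (M : ℝ) ≤ j * s := by rwa [div_le_iff₀ hs0] at hj1
  have hts : t ≤ s := by rw [ht, div_le_iff₀ hj0']; linarith
  have hst : s - t ≤ s * s / M := by
    have h1 : (j : ℝ) * s ≤ M + s := by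
      have := mul_lt_mul_of_pos_right hj2 hs0
      rw [add_mul, div_mul_cancel₀ _ hs0.ne'] at this
      linarith
    have e : s - t = (j * s - M) / j := by rw [ht]; field_simp
    rw [e, div_le_div_iff₀ hj0' hM0]
    nlinarith
  have hb : m * |(1 + y) - t ^ α| ≤ m * α / M * (1 + y) ^ (1 + 1 / α) := by
    rw [← hsα, abs_of_nonneg (sub_nonneg.2 (Real.rpow_le_rpow ht0.le hts hα0.le)),
      ← Real.rpow_mul hs0.le, show α * (1 + 1 / α) = (α - 1) + 2 by field_simp; ring,
      Real.rpow_add hs0, Real.rpow_two]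
    have h1 := rpow_sub_rpow_le hα hs0 ht0.le
    have h2 : α * s ^ (α - 1) * (s - t) ≤ α * s ^ (α - 1) * (s * s / M) := by gcongr
    calc m * (s ^ α - t ^ α) ≤ m * (α * s ^ (α - 1) * (s * s / M)) := by
          gcongr; exact h1.trans h2
      _ = _ := by ring
  have hmy : m * y = |x - ζ| := by rw [hy]; field_simp
  rcases le_total 0 (x - ζ) with hx | hx
  · refine ⟨ζ + m * (t ^ α - 1), ?_, ?_⟩
    · rcases hjM.eq_or_lt with h | h
      · have : t = 1 := by rw [ht, h]; exact div_self hM0.ne'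
        rw [this]; simp [pierceGrid]
      · refine Finset.mem_insert_of_mem (Finset.mem_union_left _ (Finset.mem_image.2 ⟨j, ?_, rfl⟩))
        exact Finset.mem_Ico.2 ⟨hj0, h⟩
    · refine le_trans (le_of_eq ?_) hb
      rw [abs_of_nonneg hx] at hmy
      rw [show x - (ζ + m * (t ^ α - 1)) = m * (1 + y - t ^ α) by linarith, abs_mul, abs_of_pos hm]
  · refine ⟨ζ - m * (t ^ α - 1), ?_, ?_⟩
    · rcases hjM.eq_or_lt with h | h
      · have : t = 1 := by rw [ht, h]; exact div_self hM0.ne'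
        rw [this]; simp [pierceGrid]
      · refine Finset.mem_insert_of_mem (Finset.mem_union_right _ (Finset.mem_image.2 ⟨j, ?_, rfl⟩))
        exact Finset.mem_Ico.2 ⟨hj0, h⟩
    · refine le_trans (le_of_eq ?_) hb
      rw [abs_of_nonpos hx] at hmy
      rw [show x - (ζ - m * (t ^ α - 1)) = -(m * (1 + y - t ^ α)) by linarith, abs_neg, abs_mul,
        abs_of_pos hm]

theorem distortion_pierceGrid_le {μ : Measure ℝ} [IsProbabilityMeasure μ] {ζ m α p : ℝ} {M : ℕ}
    (hm : 0 < m) (hα : 1 ≤ α) (hM : 1 ≤ M) (hp : p = 2 * (1 + 1 / α))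
    (h : ∫⁻ x, ENNReal.ofReal (|x - ζ| ^ p) ∂μ ≤ ENNReal.ofReal (m ^ p)) :
    MarkovQuant.distortion μ (pierceGrid ζ m α M) ≤
      ENNReal.ofReal ((m * α / M) ^ 2 * 2 ^ p) := by
  have hα0 : 0 < α := by linarith
  have hp1 : 1 ≤ p := by rw [hp]; have := one_div_pos.2 hα0; linarith
  have hM0 : (0 : ℝ) < M := by exact_mod_cast hM
  set A := (m * α / M) ^ 2 with hA
  have hA0 : 0 ≤ A := by positivity
  have hpt : ∀ x, (Metric.infEDist x (pierceGrid ζ m α M : Set ℝ)) ^ 2 ≤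
      ENNReal.ofReal (A * 2 ^ (p - 1)) * (1 + ENNReal.ofReal ((m ^ p)⁻¹) *
        ENNReal.ofReal (|x - ζ| ^ p)) := by
    intro x
    obtain ⟨g, hg, hxg⟩ := exists_mem_pierceGrid (ζ := ζ) hm hα hM x
    have h1 : Metric.infEDist x (pierceGrid ζ m α M : Set ℝ) ≤ ENNReal.ofReal |x - g| := by
      refine (Metric.infEDist_le_edist_of_mem (Finset.mem_coe.2 hg)).trans (le_of_eq ?_)
      rw [edist_dist, Real.dist_eq]
    calc _ ≤ (ENNReal.ofReal |x - g|) ^ 2 := by gcongr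
      _ = ENNReal.ofReal (|x - g| ^ 2) := (ENNReal.ofReal_pow (abs_nonneg _) 2).symm
      _ ≤ ENNReal.ofReal (A * 2 ^ (p - 1) * (1 + (m ^ p)⁻¹ * |x - ζ| ^ p)) := by
          apply ENNReal.ofReal_le_ofReal
          have h0 : 0 ≤ |x - ζ| / m := by positivity
          calc |x - g| ^ 2 ≤ (m * α / M * (1 + |x - ζ| / m) ^ (1 + 1 / α)) ^ 2 := by gcongr
            _ = A * (1 + |x - ζ| / m) ^ p := by
                rw [mul_pow, ← Real.rpow_natCast (_ ^ (_ : ℝ)) 2, ← Real.rpow_mul (by positivity), hp,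
                  hA]
                congr 2; push_cast; ring
            _ ≤ A * (2 ^ (p - 1) * (1 + (|x - ζ| / m) ^ p)) := by
                gcongr; exact one_add_rpow_le hp1 h0
            _ = _ := by rw [Real.div_rpow (abs_nonneg _) hm.le]; ring
      _ = _ := by
          rw [ENNReal.ofReal_mul (p := A * 2 ^ (p - 1)) (by positivity),
            ENNReal.ofReal_add zero_le_one (by positivity),
            ENNReal.ofReal_mul (p := (m ^ p)⁻¹) (by positivity), ENNReal.ofReal_one]
  calc MarkovQuant.distortion μ (pierceGrid ζ m α M)
      ≤ ∫⁻ x, ENNReal.ofReal (A * 2 ^ (p - 1)) * (1 + ENNReal.ofReal ((m ^ p)⁻¹) *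
        ENNReal.ofReal (|x - ζ| ^ p)) ∂μ := lintegral_mono hpt
    _ = ENNReal.ofReal (A * 2 ^ (p - 1)) * (1 + ENNReal.ofReal ((m ^ p)⁻¹) *
        ∫⁻ x, ENNReal.ofReal (|x - ζ| ^ p) ∂μ) := by
        rw [lintegral_const_mul _ (by fun_prop), lintegral_add_left measurable_const,
          lintegral_const_mul _ (by fun_prop)]
        simp
    _ ≤ ENNReal.ofReal (A * 2 ^ (p - 1)) * (1 + ENNReal.ofReal ((m ^ p)⁻¹) *
        ENNReal.ofReal (m ^ p)) := by gcongr
    _ = ENNReal.ofReal (A * 2 ^ p) := by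
        rw [← ENNReal.ofReal_mul (by positivity), inv_mul_cancel₀ (by positivity),
          ENNReal.ofReal_one, one_add_one_eq_two, ← ENNReal.ofReal_ofNat 2,
          ← ENNReal.ofReal_mul (by positivity), Real.rpow_sub_one two_ne_zero]
        congr 1; ring

/-- **Pierce's inequality** in dimension one. The grid `pierceGrid` with `α = 2 / η`, scaled by the
`L^(2 + η)` distance `m` of `X` to `ζ`, gives the constant `2 α 2 ^ ((2 + η) / 2)`. -/
theorem exists_isPierceConstant {η : ℝ} (hη : 0 < η) (hη1 : η ≤ 1) :
    ∃ K : ℝ, MarkovQuant.IsPierceConstant η K := by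
  set α := 2 / η with hα
  have hα1 : 1 ≤ α := by rw [hα, le_div_iff₀ hη]; linarith
  set p := 2 + η with hp
  have hpα : p = 2 * (1 + 1 / α) := by rw [hp, hα]; field_simp
  have hp0 : 0 < p := by linarith
  set K := 2 * α * 2 ^ (p / 2) with hK
  have hK0 : 0 < K := by positivity
  refine ⟨K, ?_⟩
  intro μ _ N hN
  have hN0 : (0 : ℝ) < N := by exact_mod_cast hN
  -- It suffices to bound the left-hand side for each `ζ`.
  rw [ENNReal.mul_iInf_of_ne (by simpa using hK0) ENNReal.ofReal_ne_top,
    ENNReal.iInf_mul_of_ne (by simp) (by simp; omega)]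
  refine le_iInf fun ζ => ?_
  set e := eLpNorm (fun x : ℝ => x - ζ) (ENNReal.ofReal p) μ with he
  rcases eq_or_ne e ⊤ with htop | htop
  · rw [htop, ENNReal.mul_top (by simpa using hK0), ENNReal.top_mul (by simp)]
    exact le_top
  have hint := eLpNorm_ofReal_eq_lintegral (μ := μ) hp0 (fun x : ℝ => x - ζ)
  rw [← he] at hint
  -- If `X = ζ` almost surely, there is no scale `m` and the grid `{ζ}` is exact.
  rcases eq_or_ne e 0 with h0 | h0
  · refine (iInf_le _ ⟨{ζ}, by simp, by simpa using hN⟩).trans ?_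
    have : MarkovQuant.distortion μ {ζ} = 0 := by
      rw [h0, eq_comm, ENNReal.rpow_eq_zero_iff_of_pos (by positivity),
        lintegral_eq_zero_iff (by fun_prop)] at hint
      rw [MarkovQuant.distortion]
      refine (lintegral_congr_ae ?_).trans lintegral_zero
      filter_upwards [hint] with x hx
      have hx' : |x - ζ| ^ p ≤ 0 := by simpa using hx
      have hx2 : |x - ζ| ^ p = 0 := le_antisymm hx' (by positivity)
      rw [Real.rpow_eq_zero (abs_nonneg _) hp0.ne', abs_eq_zero, sub_eq_zero] at hx2
      simp [hx2]
    simp [this]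
  · set m := e.toReal with hm
    have hm0 : 0 < m := ENNReal.toReal_pos h0 htop
    have hem : e = ENNReal.ofReal m := (ENNReal.ofReal_toReal htop).symm
    have hI : ∫⁻ x, ENNReal.ofReal (|x - ζ| ^ p) ∂μ = ENNReal.ofReal (m ^ p) := by
      rw [← ENNReal.ofReal_rpow_of_nonneg hm0.le hp0.le, ← hem, hint, ← ENNReal.rpow_mul,
        one_div_mul_cancel hp0.ne', ENNReal.rpow_one]
    -- The grid has at most `2 * M - 1 ≤ N` points.
    set M := (N + 1) / 2 with hM
    have hM1 : 1 ≤ M := by omega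
    have hM0 : (0 : ℝ) < M := by exact_mod_cast hM1
    have hMN : (N : ℝ) ≤ 2 * M := by exact_mod_cast (by omega : N ≤ 2 * M)
    refine (iInf_le _ ⟨pierceGrid ζ m α M, ⟨ζ, by simp [pierceGrid]⟩,
      (card_pierceGrid_le hM1).trans (by omega)⟩).trans ?_
    have hd := distortion_pierceGrid_le hm0 hα1 hM1 hpα hI.le
    calc _ ≤ (ENNReal.ofReal ((m * α / M) ^ 2 * 2 ^ p)) ^ (1 / 2 : ℝ) := by gcongr
      _ = ENNReal.ofReal (m * α / M * 2 ^ (p / 2)) := by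
          rw [ENNReal.ofReal_rpow_of_nonneg (by positivity) (by norm_num)]
          congr 1
          rw [Real.mul_rpow (by positivity) (by positivity), ← Real.rpow_natCast _ 2,
            ← Real.rpow_mul (by positivity), ← Real.rpow_mul (by positivity)]
          norm_num; left; congr 1; ring
      _ ≤ ENNReal.ofReal (K * m / N) := by
          apply ENNReal.ofReal_le_ofReal
          rw [hK, div_mul_eq_mul_div, div_le_div_iff₀ hM0 hN0]
          have : 0 ≤ m * α * 2 ^ (p / 2) := by positivity
          nlinarith
      _ = _ := by
          rw [hem, div_eq_mul_inv, ENNReal.ofReal_mul (by positivity),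
            ENNReal.ofReal_mul hK0.le, ENNReal.ofReal_inv_of_pos hN0, ENNReal.ofReal_natCast]

/-! ### Stationarity of optimal quantizers -/

theorem infEDist_eq_of_isNearestProj {Γ : Finset ℝ} {proj : ℝ → ℝ}
    (h : MarkovQuant.IsNearestProj Γ proj) (x : ℝ) :
    Metric.infEDist x (Γ : Set ℝ) = ENNReal.ofReal |x - proj x| := by
  apply le_antisymm
  · refine (Metric.infEDist_le_edist_of_mem (Finset.mem_coe.2 (h.mem x))).trans (le_of_eq ?_)
    rw [edist_dist, Real.dist_eq]
  · refine Metric.le_infEDist.2 fun y hy => ?_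
    rw [edist_dist, Real.dist_eq]
    exact ENNReal.ofReal_le_ofReal (h.nearest x y hy)

theorem distortion_eq_of_isNearestProj {μ : Measure ℝ} {Γ : Finset ℝ} {proj : ℝ → ℝ}
    (h : MarkovQuant.IsNearestProj Γ proj) :
    MarkovQuant.distortion μ Γ = ∫⁻ x, ENNReal.ofReal ((x - proj x) ^ 2) ∂μ := by
  refine lintegral_congr fun x => ?_
  rw [infEDist_eq_of_isNearestProj h, ← ENNReal.ofReal_pow (abs_nonneg _), sq_abs]

theorem memLp_comp_of_isNearestProj {μ : Measure ℝ} [IsProbabilityMeasure μ] {Γ : Finset ℝ}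
    {proj h : ℝ → ℝ} (hproj : MarkovQuant.IsNearestProj Γ proj) (hh : Measurable h) (p : ℝ≥0∞) :
    MemLp (fun x => h (proj x)) p μ := by
  obtain ⟨C, hC⟩ : ∃ C, ∀ a ∈ Γ, ‖h a‖ ≤ C := by
    obtain ⟨C, hC⟩ := (Γ.image (fun a => ‖h a‖)).bddAbove
    exact ⟨C, fun a ha => hC (by simpa using ⟨a, ha, rfl⟩)⟩
  exact MemLp.of_bound (hh.comp hproj.measurable).aestronglyMeasurable C
    (Filter.Eventually.of_forall fun x => hC _ (hproj.mem x))

/-- Optimal quadratic quantizers are stationary: `X - Proj_Γ X` is orthogonal to every function of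
`Proj_Γ X`. Moving each grid point `a` to `a + ε h a` yields a competitor with at most as many
points, so the first variation of the distortion vanishes. -/
theorem integral_comp_mul_sub_eq_zero {μ : Measure ℝ} [IsProbabilityMeasure μ] {N : ℕ}
    {Γ : Finset ℝ} {proj h : ℝ → ℝ} (hΓ : MarkovQuant.IsOptimalQuantizer μ N Γ)
    (hproj : MarkovQuant.IsNearestProj Γ proj) (hh : Measurable h)
    (hμ : MemLp (fun x : ℝ => x) 2 μ) :
    ∫ x, h (proj x) * (x - proj x) ∂μ = 0 := by
  have m1 : MemLp (fun x => x - proj x) 2 μ :=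
    hμ.sub (memLp_comp_of_isNearestProj hproj measurable_id 2)
  have m2 := memLp_comp_of_isNearestProj (μ := μ) hproj hh 2
  have i1 := m1.integrable_sq
  have i2 := m2.integrable_sq
  have i3 : Integrable (fun x => h (proj x) * (x - proj x)) μ := m2.integrable_mul m1
  set I := ∫ x, h (proj x) * (x - proj x) ∂μ with hI
  set H := ∫ x, (h (proj x)) ^ 2 ∂μ with hH
  have key : ∀ ε : ℝ, 0 ≤ -2 * ε * I + ε ^ 2 * H := by
    intro ε
    have i4 : Integrable (fun x => (x - (proj x + ε * h (proj x))) ^ 2) μ := by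
      have : (fun x => (x - (proj x + ε * h (proj x))) ^ 2) = fun x =>
          (x - proj x) ^ 2 + ((-2 * ε) * (h (proj x) * (x - proj x)) + ε ^ 2 * (h (proj x)) ^ 2) := by
        funext x; ring
      rw [this]
      exact i1.add ((i3.const_mul _).add (i2.const_mul _))
    have h1 := hΓ.optimal (Γ.image (fun a => a + ε * h a)) (hΓ.nonempty.image _)
      (Finset.card_image_le.trans hΓ.card_le)
    rw [distortion_eq_of_isNearestProj hproj] at h1
    have h2 : MarkovQuant.distortion μ (Γ.image (fun a => a + ε * h a)) ≤
        ∫⁻ x, ENNReal.ofReal ((x - (proj x + ε * h (proj x))) ^ 2) ∂μ := by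
      refine lintegral_mono fun x => ?_
      have hmem : proj x + ε * h (proj x) ∈
          ((Γ.image (fun a => a + ε * h a) : Finset ℝ) : Set ℝ) :=
        Finset.mem_coe.2 (Finset.mem_image.2 ⟨proj x, hproj.mem x, rfl⟩)
      rw [← sq_abs (x - _), ENNReal.ofReal_pow (abs_nonneg _), ← Real.dist_eq, ← edist_dist]
      gcongr
      exact Metric.infEDist_le_edist_of_mem hmem
    have h3 := h1.trans h2
    rw [← ofReal_integral_eq_lintegral_ofReal i1 (Filter.Eventually.of_forall fun _ => sq_nonneg _),
      ← ofReal_integral_eq_lintegral_ofReal i4 (Filter.Eventually.of_forall fun _ => sq_nonneg _),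
      ENNReal.ofReal_le_ofReal_iff (integral_nonneg fun _ => sq_nonneg _)] at h3
    have e : ∫ x, (x - (proj x + ε * h (proj x))) ^ 2 ∂μ =
        ∫ x, (x - proj x) ^ 2 ∂μ + ((-2 * ε) * I + ε ^ 2 * H) := by
      have i5 : Integrable (fun x => -2 * ε * (h (proj x) * (x - proj x)) +
          ε ^ 2 * (h (proj x)) ^ 2) μ := (i3.const_mul _).add (i2.const_mul _)
      rw [hI, hH, ← integral_const_mul, ← integral_const_mul,
        ← integral_add (i3.const_mul _) (i2.const_mul _), ← integral_add i1 i5]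
      refine integral_congr_ae (Filter.Eventually.of_forall fun x => ?_)
      simp only
      ring
    linarith
  have hH0 : 0 ≤ H := integral_nonneg fun _ => sq_nonneg _
  -- minimise the quadratic in `ε`
  have := key (I / (H + 1))
  have hpos : 0 < H + 1 := by linarith
  have e : -2 * (I / (H + 1)) * I + (I / (H + 1)) ^ 2 * H = -(I ^ 2 * (H + 2)) / (H + 1) ^ 2 := by
    field_simp; ring
  rw [e, div_nonneg_iff] at this
  rcases this with h | h
  · have : I ^ 2 * (H + 2) ≤ 0 := by linarith [h.1]
    have : I ^ 2 ≤ 0 := by nlinarith [sq_nonneg I]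
    exact pow_eq_zero_iff two_ne_zero |>.1 (le_antisymm this (sq_nonneg _))
  · have : 0 < (H + 1) ^ 2 := by positivity
    linarith [h.2]

/-- Optimal quantization does not increase `p`-th moments about any centre: this is Jensen's
inequality for the stationary quantizer, obtained by integrating the tangent inequality
`rpow_tangent_le`. -/
theorem lintegral_abs_proj_sub_rpow_le {μ : Measure ℝ} [IsProbabilityMeasure μ] {N : ℕ}
    {Γ : Finset ℝ} {proj : ℝ → ℝ} (hΓ : MarkovQuant.IsOptimalQuantizer μ N Γ)
    (hproj : MarkovQuant.IsNearestProj Γ proj) {p : ℝ} (hp : 2 < p) (c : ℝ) :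
    ∫⁻ x, ENNReal.ofReal (|proj x - c| ^ p) ∂μ ≤ ∫⁻ x, ENNReal.ofReal (|x - c| ^ p) ∂μ := by
  rcases eq_or_ne (∫⁻ x, ENNReal.ofReal (|x - c| ^ p) ∂μ) ⊤ with htop | htop
  · rw [htop]; exact le_top
  have hp0 : 0 < p := by linarith
  have i1 : Integrable (fun x => |x - c| ^ p) μ := by
    refine ⟨(by fun_prop : Measurable fun x : ℝ => |x - c| ^ p).aestronglyMeasurable, ?_⟩
    rw [hasFiniteIntegral_iff_ofReal (Filter.Eventually.of_forall fun _ => by positivity)]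
    exact lt_top_iff_ne_top.2 htop
  have hm : MemLp (fun x : ℝ => x - c) (ENNReal.ofReal p) μ := by
    refine ⟨by fun_prop, ?_⟩
    rw [eLpNorm_ofReal_eq_lintegral hp0]
    exact ENNReal.rpow_lt_top_of_nonneg (by positivity) htop
  have hm2 : MemLp (fun x : ℝ => x) 2 μ := by
    have := (hm.mono_exponent (p := 2) (by
      rw [← ENNReal.ofReal_ofNat 2]; exact ENNReal.ofReal_le_ofReal hp.le)).add
        (memLp_const c)
    have e : ((fun x : ℝ => x - c) + fun _ => c) = fun x => x := by
      funext x; exact sub_add_cancel x c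
    rwa [e] at this
  have hcont : Measurable (fun a : ℝ => p * (|a - c| ^ (p - 2) * (a - c))) := by fun_prop
  have h0 := integral_comp_mul_sub_eq_zero hΓ hproj hcont hm2
  have i2 : Integrable (fun x => |proj x - c| ^ p) μ :=
    (memLp_comp_of_isNearestProj (μ := μ) (h := fun a => |a - c| ^ p) hproj (by fun_prop) 1).integrable
      le_rfl
  have i3 : Integrable (fun x => p * (|proj x - c| ^ (p - 2) * (proj x - c)) * (x - proj x)) μ :=
    (memLp_comp_of_isNearestProj (μ := μ) hproj hcont 2).integrable_mul
      (hm2.sub (memLp_comp_of_isNearestProj hproj measurable_id 2))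
  rw [← ofReal_integral_eq_lintegral_ofReal i1 (Filter.Eventually.of_forall fun _ => by positivity),
    ← ofReal_integral_eq_lintegral_ofReal i2 (Filter.Eventually.of_forall fun _ => by positivity)]
  apply ENNReal.ofReal_le_ofReal
  calc ∫ x, |proj x - c| ^ p ∂μ
      = ∫ x, |proj x - c| ^ p + p * (|proj x - c| ^ (p - 2) * (proj x - c)) * (x - proj x) ∂μ := by
        rw [integral_add i2 i3, h0, add_zero]
    _ ≤ ∫ x, |x - c| ^ p ∂μ := by
        refine integral_mono (i2.add i3) i1 fun x => ?_
        have := rpow_tangent_le (x - c) (proj x - c) hp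
        rwa [sub_sub_sub_cancel_right] at this

/-- An optimal quantizer of a Dirac mass contains its atom. -/
theorem proj_eq_self_of_dirac {a : ℝ} {N : ℕ} {Γ : Finset ℝ} {proj : ℝ → ℝ}
    (hΓ : MarkovQuant.IsOptimalQuantizer (Measure.dirac a) N Γ)
    (hproj : MarkovQuant.IsNearestProj Γ proj) : proj a = a := by
  have hN : 1 ≤ N := hΓ.nonempty.card_pos.trans_le hΓ.card_le
  have h := hΓ.optimal {a} (by simp) (by simpa using hN)
  have h0 : MarkovQuant.distortion (Measure.dirac a) {a} = 0 := by
    simp [MarkovQuant.distortion]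
  rw [h0, distortion_eq_of_isNearestProj hproj, lintegral_dirac, nonpos_iff_eq_zero,
    ENNReal.ofReal_eq_zero] at h
  have : (a - proj a) ^ 2 = 0 := le_antisymm h (sq_nonneg _)
  linarith [pow_eq_zero_iff two_ne_zero |>.1 this]

/-! ### Gaussian moments -/

/-- A linear functional of a standard Gaussian vector is Gaussian. -/
theorem map_inner_stdGaussian {E : Type*} [NormedAddCommGroup E] [InnerProductSpace ℝ E]
    [FiniteDimensional ℝ E] [MeasurableSpace E] [BorelSpace E] (s : E) :
    (stdGaussian E).map (fun z => inner ℝ s z) = (gaussianReal 0 1).map (fun g => ‖s‖ * g) := by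
  have h := IsGaussian.map_eq_gaussianReal (μ := stdGaussian E) (innerSL ℝ s)
  rw [integral_strongDual_stdGaussian, variance_dual_stdGaussian, innerSL_apply_norm] at h
  rw [gaussianReal_map_const_mul, mul_zero, mul_one]
  refine Eq.trans h ?_
  congr 1
  exact NNReal.eq (by simp)

theorem lintegral_inner_stdGaussian {E : Type*} [NormedAddCommGroup E] [InnerProductSpace ℝ E]
    [FiniteDimensional ℝ E] [MeasurableSpace E] [BorelSpace E] (s : E) {f : ℝ → ℝ≥0∞}
    (hf : Measurable f) :
    ∫⁻ z, f (inner ℝ s z) ∂(stdGaussian E) = ∫⁻ g, f (‖s‖ * g) ∂(gaussianReal 0 1) := by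
  rw [← lintegral_map (f := f) hf (by fun_prop : Measurable fun z => inner ℝ s z),
    map_inner_stdGaussian, lintegral_map hf (by fun_prop)]

theorem memLp_id_gaussian (p : ℝ) : MemLp (fun x : ℝ => x) (ENNReal.ofReal p) (gaussianReal 0 1) :=
  IsGaussian.memLp_id (gaussianReal 0 1) _ ENNReal.ofReal_ne_top

theorem integrable_abs_rpow_gaussianReal {p : ℝ} (hp : 0 < p) :
    Integrable (fun x : ℝ => |x| ^ p) (gaussianReal 0 1) := by
  have := (memLp_id_gaussian p).integrable_norm_rpow (by simpa using hp) ENNReal.ofReal_ne_top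
  simpa [ENNReal.toReal_ofReal hp.le] using this

theorem integrable_pow_gaussianReal (n : ℕ) : Integrable (fun x : ℝ => x ^ n) (gaussianReal 0 1) := by
  have h : MemLp (fun x : ℝ => x) n (gaussianReal 0 1) :=
    IsGaussian.memLp_id (gaussianReal 0 1) _ (by simp)
  have h1 := h.integrable_norm_pow'
  refine (integrable_norm_iff (by fun_prop)).1 ?_
  simpa using h1

theorem integral_sq_gaussianReal : ∫ x : ℝ, x ^ 2 ∂(gaussianReal 0 1) = 1 := by
  have h := variance_fun_id_gaussianReal (μ := 0) (v := 1)
  rw [variance_of_integral_eq_zero (by fun_prop) (by simp)] at h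
  simpa using h

theorem integral_pow_four_gaussianReal : ∫ x : ℝ, x ^ 4 ∂(gaussianReal 0 1) = 3 := by
  rw [integral_gaussianReal_eq_integral_smul (by norm_num)]
  have e : (fun x : ℝ => gaussianPDFReal 0 1 x • x ^ 4) =
      fun x => (fun y : ℝ => (√(2 * Real.pi))⁻¹ * (y ^ (4 : ℝ) * Real.exp (-(1 / 2) * y ^ (2 : ℝ)))) |x| := by
    funext x
    simp only [gaussianPDFReal, NNReal.coe_one, mul_one, sub_zero, smul_eq_mul]
    rw [show (4 : ℝ) = ((4 : ℕ) : ℝ) by norm_num, Real.rpow_natCast, Real.rpow_two, sq_abs,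
      Even.pow_abs (by decide)]
    rw [show -x ^ 2 / 2 = -(1 / 2) * x ^ 2 by ring]
    ring
  rw [e, integral_comp_abs (f := fun y : ℝ =>
    (√(2 * Real.pi))⁻¹ * (y ^ (4 : ℝ) * Real.exp (-(1 / 2) * y ^ (2 : ℝ)))), integral_const_mul,
    integral_rpow_mul_exp_neg_mul_rpow (by norm_num) (by norm_num) (by norm_num)]
  have hG : Real.Gamma ((4 + 1) / 2) = 3 * √Real.pi / 4 := by
    have := Real.Gamma_nat_add_half 2
    norm_num [Nat.doubleFactorial] at this ⊢
    exact this
  have h2 : (1 / 2 : ℝ) ^ (-(4 + 1 : ℝ) / 2) = 4 * √2 := by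
    rw [one_div, Real.inv_rpow (by norm_num), ← Real.rpow_neg (by norm_num),
      show -(-(4 + 1 : ℝ) / 2) = 2 + 1 / 2 by norm_num, Real.rpow_add (by norm_num),
      ← Real.sqrt_eq_rpow]
    norm_num
  rw [hG, h2, Real.sqrt_mul (by norm_num)]
  have := Real.pi_pos
  field_simp

/-- Interpolation between the second moment `1` and the fourth moment `3`, made explicit by the
tangent of the concave function `u ↦ u ^ (p / 2 - 1)` at `u = 3`. -/
theorem integral_abs_rpow_gaussianReal_le {p : ℝ} (hp : 2 < p) (hp3 : p ≤ 4) :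
    ∫ x : ℝ, |x| ^ p ∂(gaussianReal 0 1) ≤ 3 ^ (p / 2 - 1) := by
  set θ := p / 2 - 1 with hθ
  have hθ0 : 0 ≤ θ := by linarith
  have hpt : ∀ x : ℝ, |x| ^ p ≤ 3 ^ θ * ((1 - θ) * x ^ 2 + θ / 3 * x ^ 4) := by
    intro x
    have h := rpow_one_add_le_one_add_mul_self (s := x ^ 2 / 3 - 1) (by
      have : 0 ≤ x ^ 2 / 3 := by positivity
      linarith) hθ0 (by linarith)
    rw [add_sub_cancel, Real.div_rpow (by positivity) (by norm_num),
      div_le_iff₀ (by positivity)] at h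
    have e : |x| ^ p = x ^ 2 * (x ^ 2) ^ θ := by
      rw [← sq_abs, ← Real.rpow_two, ← Real.rpow_mul (abs_nonneg x),
        ← Real.rpow_add' (abs_nonneg x) (by linarith)]
      congr 1; rw [hθ]; ring
    rw [e]
    refine (mul_le_mul_of_nonneg_left h (sq_nonneg x)).trans (le_of_eq ?_)
    ring
  have i2 := integrable_pow_gaussianReal 2
  have i4 := integrable_pow_gaussianReal 4
  calc ∫ x : ℝ, |x| ^ p ∂(gaussianReal 0 1)
      ≤ ∫ x : ℝ, 3 ^ θ * ((1 - θ) * x ^ 2 + θ / 3 * x ^ 4) ∂(gaussianReal 0 1) :=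
        integral_mono (integrable_abs_rpow_gaussianReal (by linarith))
          (((i2.const_mul _).add (i4.const_mul _)).const_mul _) hpt
    _ = 3 ^ θ := by
        rw [integral_const_mul, integral_add (i2.const_mul _) (i4.const_mul _),
          integral_const_mul, integral_const_mul, integral_sq_gaussianReal,
          integral_pow_four_gaussianReal]
        ring

theorem integral_coord_sq_stdGaussian {d : ℕ} (l : Fin d) :
    Integrable (fun z => z l ^ 2) (stdGaussian (EuclideanSpace ℝ (Fin d))) ∧
    ∫ z, z l ^ 2 ∂(stdGaussian (EuclideanSpace ℝ (Fin d))) = 1 := by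
  have h := map_inner_stdGaussian (EuclideanSpace.single l (1 : ℝ))
  have e : (fun z : EuclideanSpace ℝ (Fin d) => inner ℝ (EuclideanSpace.single l (1 : ℝ)) z) =
      fun z => z l := by
    funext z; simp [EuclideanSpace.inner_single_left]
  have e2 : (fun g : ℝ => ‖EuclideanSpace.single l (1 : ℝ)‖ * g) = id := by
    funext g; simp
  rw [e, e2, Measure.map_id] at h
  have hm : Measurable fun z : EuclideanSpace ℝ (Fin d) => z l := by fun_prop
  constructor
  · have h1 := integrable_pow_gaussianReal 2
    rw [← h, integrable_map_measure (by fun_prop) hm.aemeasurable] at h1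
    exact h1
  · have := integral_sq_gaussianReal
    rw [← h, integral_map hm.aemeasurable (by fun_prop)] at this
    exact this

/-- Jensen's inequality `(E|Z|²) ^ (p / 2) ≤ E|Z| ^ p`, with the tangent of `u ↦ u ^ (p / 2)` at
`u = d`. -/
theorem rpow_dim_le_integral_norm_rpow {d : ℕ} (hd : 0 < d) {p : ℝ} (hp : 2 < p) :
    (d : ℝ) ^ (p / 2) ≤ ∫ z, ‖z‖ ^ p ∂(stdGaussian (EuclideanSpace ℝ (Fin d))) := by
  set γ := stdGaussian (EuclideanSpace ℝ (Fin d))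
  have hd0 : (0 : ℝ) < d := by exact_mod_cast hd
  have hp0 : 0 < p := by linarith
  have e : (fun z : EuclideanSpace ℝ (Fin d) => ‖z‖ ^ 2) = fun z => ∑ l, z l ^ 2 := by
    funext z; rw [EuclideanSpace.norm_sq_eq]; simp
  have i2 : Integrable (fun z : EuclideanSpace ℝ (Fin d) => ‖z‖ ^ 2) γ := by
    rw [e]; exact integrable_finsetSum _ fun l _ => (integral_coord_sq_stdGaussian l).1
  have e2 : ∫ z, ‖z‖ ^ 2 ∂γ = d := by
    rw [e, integral_finsetSum _ fun l _ => (integral_coord_sq_stdGaussian l).1]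
    simp [(integral_coord_sq_stdGaussian _).2]
  have ip : Integrable (fun z : EuclideanSpace ℝ (Fin d) => ‖z‖ ^ p) γ := by
    have := (IsGaussian.memLp_id γ (ENNReal.ofReal p) ENNReal.ofReal_ne_top).integrable_norm_rpow
      (by simpa using hp0) ENNReal.ofReal_ne_top
    simpa [ENNReal.toReal_ofReal hp0.le] using this
  have hpt : ∀ z : EuclideanSpace ℝ (Fin d),
      (d : ℝ) ^ (p / 2) * (1 - p / 2 + p / 2 / d * ‖z‖ ^ 2) ≤ ‖z‖ ^ p := by
    intro z
    have h := one_add_mul_self_le_rpow_one_add (s := ‖z‖ ^ 2 / d - 1) (by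
      have : 0 ≤ ‖z‖ ^ 2 / d := by positivity
      linarith) (by linarith : 1 ≤ p / 2)
    rw [add_sub_cancel, Real.div_rpow (by positivity) hd0.le, le_div_iff₀ (by positivity),
      ← Real.rpow_two, ← Real.rpow_mul (norm_nonneg z), mul_div_cancel₀ _ two_ne_zero,
      Real.rpow_two] at h
    refine le_trans (le_of_eq ?_) h
    ring
  have i2' : Integrable (fun z : EuclideanSpace ℝ (Fin d) => p / 2 / d * ‖z‖ ^ 2) γ := i2.const_mul _
  calc (d : ℝ) ^ (p / 2)
      = ∫ z, (d : ℝ) ^ (p / 2) * (1 - p / 2 + p / 2 / d * ‖z‖ ^ 2) ∂γ := by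
        rw [integral_const_mul, integral_add (integrable_const _) i2', integral_const_mul, e2]
        simp [γ]
        field_simp
        simp
    _ ≤ _ := integral_mono (((integrable_const _).add i2').const_mul _) ip hpt

theorem integral_norm_rpow_stdGaussian_one {p : ℝ} :
    ∫ z, ‖z‖ ^ p ∂(stdGaussian (EuclideanSpace ℝ (Fin 1))) =
      ∫ x : ℝ, |x| ^ p ∂(gaussianReal 0 1) := by
  have h := map_inner_stdGaussian (EuclideanSpace.single (0 : Fin 1) (1 : ℝ))
  have e : (fun z : EuclideanSpace ℝ (Fin 1) => inner ℝ (EuclideanSpace.single 0 (1 : ℝ)) z) =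
      fun z => z 0 := by
    funext z; simp [EuclideanSpace.inner_single_left]
  have e2 : (fun g : ℝ => ‖EuclideanSpace.single (0 : Fin 1) (1 : ℝ)‖ * g) = id := by
    funext g; simp
  rw [e, e2, Measure.map_id] at h
  rw [← h, integral_map (by fun_prop)
    (by fun_prop : Measurable fun x : ℝ => |x| ^ p).aestronglyMeasurable]
  refine integral_congr_ae (Filter.Eventually.of_forall fun z => ?_)
  simp [EuclideanSpace.norm_eq, Real.sqrt_sq_eq_abs]

theorem lintegral_abs_add_rpow_gaussian_le {p : ℝ} (hp : 2 < p) (hp3 : p ≤ 3) (a t : ℝ) :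
    ∫⁻ g, ENNReal.ofReal (|a + t * g| ^ p) ∂(gaussianReal 0 1) ≤
      ENNReal.ofReal (|a| ^ p + p * (p - 1) / 2 * |a| ^ (p - 2) * t ^ 2 +
        (∫ x : ℝ, |x| ^ p ∂(gaussianReal 0 1)) * |t| ^ p) := by
  set γ := gaussianReal 0 1
  have hp0 : 0 < p := by linarith
  set c := ∫ x : ℝ, |x| ^ p ∂γ with hc
  -- The Gaussian law is symmetric, so the integrand may be symmetrized and the linear term drops out.
  have hsymm : ∫⁻ g, ENNReal.ofReal (|a - t * g| ^ p) ∂γ =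
      ∫⁻ g, ENNReal.ofReal (|a + t * g| ^ p) ∂γ := by
    have h : γ.map (fun x => -x) = γ := by simp [γ, gaussianReal_map_neg]
    nth_rewrite 1 [← h]
    rw [lintegral_map (by fun_prop) (by fun_prop)]
    simp
  set B := p * (p - 1) / 2 * |a| ^ (p - 2) with hB
  have hB0 : 0 ≤ B := by
    have : 0 ≤ p * (p - 1) := by nlinarith
    positivity
  have i2 : Integrable (fun g : ℝ => B * t ^ 2 * g ^ 2) γ :=
    (integrable_pow_gaussianReal 2).const_mul _
  have ip : Integrable (fun g : ℝ => |t| ^ p * |g| ^ p) γ :=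
    (integrable_abs_rpow_gaussianReal hp0).const_mul _
  have i3 : Integrable (fun g : ℝ => |a| ^ p + B * t ^ 2 * g ^ 2) γ :=
    (integrable_const _).add i2
  have i4 : Integrable (fun g : ℝ => |a| ^ p + B * t ^ 2 * g ^ 2 + |t| ^ p * |g| ^ p) γ := i3.add ip
  have key : 2 * ∫⁻ g, ENNReal.ofReal (|a + t * g| ^ p) ∂γ ≤
      2 * ENNReal.ofReal (|a| ^ p + B * t ^ 2 + c * |t| ^ p) := by
    calc 2 * ∫⁻ g, ENNReal.ofReal (|a + t * g| ^ p) ∂γ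
        = ∫⁻ g, (ENNReal.ofReal (|a + t * g| ^ p) + ENNReal.ofReal (|a - t * g| ^ p)) ∂γ := by
          rw [lintegral_add_left (by fun_prop), hsymm, two_mul]
      _ ≤ ∫⁻ g, 2 * ENNReal.ofReal (|a| ^ p + B * t ^ 2 * g ^ 2 + |t| ^ p * |g| ^ p) ∂γ := by
          refine lintegral_mono fun g => ?_
          rw [← ENNReal.ofReal_add (by positivity) (by positivity), ← ENNReal.ofReal_ofNat 2,
            ← ENNReal.ofReal_mul (by norm_num)]
          apply ENNReal.ofReal_le_ofReal
          refine (abs_add_rpow_add_abs_sub_rpow_le a (t * g) hp hp3).trans (le_of_eq ?_)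
          rw [abs_mul, Real.mul_rpow (abs_nonneg _) (abs_nonneg _), hB]
          ring
      _ = 2 * ENNReal.ofReal (|a| ^ p + B * t ^ 2 + c * |t| ^ p) := by
          rw [lintegral_const_mul _ (by fun_prop), ← ofReal_integral_eq_lintegral_ofReal
            i4 (Filter.Eventually.of_forall fun g => by positivity),
            integral_add i3 ip, integral_add (integrable_const _) i2, integral_const_mul,
            integral_const_mul, integral_sq_gaussianReal]
          congr 2
          simp [γ, hc]
          ring
  exact (ENNReal.mul_le_mul_iff_right two_ne_zero ENNReal.ofNat_ne_top).1 key

theorem lintegral_add_sq_gaussian (a t : ℝ) :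
    ∫⁻ g, ENNReal.ofReal ((a + t * g) ^ 2) ∂(gaussianReal 0 1) = ENNReal.ofReal (a ^ 2 + t ^ 2) := by
  have i1 : Integrable (fun g : ℝ => 2 * a * t * g) (gaussianReal 0 1) := by
    simpa using (integrable_pow_gaussianReal 1).const_mul (2 * a * t)
  have i2 : Integrable (fun g : ℝ => t ^ 2 * g ^ 2) (gaussianReal 0 1) :=
    (integrable_pow_gaussianReal 2).const_mul _
  have i3 : Integrable (fun g : ℝ => a ^ 2 + 2 * a * t * g) (gaussianReal 0 1) :=
    (integrable_const _).add i1
  have e : (fun g : ℝ => (a + t * g) ^ 2) = fun g => a ^ 2 + 2 * a * t * g + t ^ 2 * g ^ 2 := by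
    funext g; ring
  rw [← ofReal_integral_eq_lintegral_ofReal (by rw [e]; exact i3.add i2)
    (Filter.Eventually.of_forall fun _ => sq_nonneg _), e, integral_add i3 i2,
    integral_add (integrable_const _) i1, integral_const_mul, integral_const_mul,
    integral_sq_gaussianReal]
  simp

/-! ### One Euler step: moments -/

/-- The `p`-th power of the rescaled `ℓ^p` distance to the centre `c`. The factor `d ^ (p / 2 - 1)`
makes it dominate `‖y - c‖ ^ p`. -/
noncomputable def phi {d : ℕ} (p : ℝ) (c y : EuclideanSpace ℝ (Fin d)) : ℝ :=
  (d : ℝ) ^ (p / 2 - 1) * ∑ l, |y l - c l| ^ p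

theorem phi_nonneg {d : ℕ} (p : ℝ) (c y : EuclideanSpace ℝ (Fin d)) : 0 ≤ phi p c y := by
  unfold phi; positivity

theorem frobNorm_nonneg {d q : ℕ} (A : Matrix (Fin d) (Fin q) ℝ) : 0 ≤ MarkovQuant.frobNorm A :=
  Real.sqrt_nonneg _

/-- The squared norms of the rows of `A` sum to `‖A‖²`. -/
theorem sum_norm_row_sq {d q : ℕ} (A : Matrix (Fin d) (Fin q) ℝ) :
    ∑ l, ‖(WithLp.toLp 2 (A l) : EuclideanSpace ℝ (Fin q))‖ ^ 2 = MarkovQuant.frobNorm A ^ 2 := by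
  rw [MarkovQuant.frobNorm, Real.sq_sqrt (by positivity)]
  simp [EuclideanSpace.norm_sq_eq]

theorem sum_norm_row_rpow_le {d q : ℕ} {p : ℝ} (hp : 2 ≤ p) (A : Matrix (Fin d) (Fin q) ℝ) :
    ∑ l, ‖(WithLp.toLp 2 (A l) : EuclideanSpace ℝ (Fin q))‖ ^ p ≤ MarkovQuant.frobNorm A ^ p := by
  have h := sum_abs_rpow_le hp
    (WithLp.toLp 2 (fun l => ‖(WithLp.toLp 2 (A l) : EuclideanSpace ℝ (Fin q))‖) :
      EuclideanSpace ℝ (Fin d))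
  have e : ‖(WithLp.toLp 2 (fun l => ‖(WithLp.toLp 2 (A l) : EuclideanSpace ℝ (Fin q))‖) :
      EuclideanSpace ℝ (Fin d))‖ = MarkovQuant.frobNorm A := by
    rw [EuclideanSpace.norm_eq]
    simp only [norm_norm]
    rw [sum_norm_row_sq, Real.sqrt_sq (frobNorm_nonneg A)]
  rw [e] at h
  simpa using h

/-- In each component the noise enters through the inner product with a row of `√Δ σ`. -/
theorem eulerOp_apply {d q : ℕ} (b : ℝ → EuclideanSpace ℝ (Fin d) → EuclideanSpace ℝ (Fin d))
    (σ : ℝ → EuclideanSpace ℝ (Fin d) → Matrix (Fin d) (Fin q) ℝ) (Δ : ℝ) (k : ℕ)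
    (x : EuclideanSpace ℝ (Fin d)) (z : EuclideanSpace ℝ (Fin q)) (l : Fin d) :
    MarkovQuant.eulerOp b σ Δ k x z l = x l + Δ * b (k * Δ) x l +
      inner ℝ (√Δ • (WithLp.toLp 2 (σ (k * Δ) x l) : EuclideanSpace ℝ (Fin q))) z := by
  rw [real_inner_smul_left]
  simp [MarkovQuant.eulerOp, Matrix.mulVec, dotProduct, PiLp.inner_apply, mul_comm]

/-- One step in one component: the second-order bound for `|·| ^ p`, integrated over the noise. -/
theorem lintegral_eulerOp_coord_le {d q : ℕ}
    (b : ℝ → EuclideanSpace ℝ (Fin d) → EuclideanSpace ℝ (Fin d))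
    (σ : ℝ → EuclideanSpace ℝ (Fin d) → Matrix (Fin d) (Fin q) ℝ) {Δ p : ℝ} (hΔ : 0 < Δ)
    (hp : 2 < p) (hp3 : p ≤ 3) (k : ℕ) (x : EuclideanSpace ℝ (Fin d)) (l : Fin d) (c : ℝ) :
    ∫⁻ z, ENNReal.ofReal (|MarkovQuant.eulerOp b σ Δ k x z l - c| ^ p)
        ∂(stdGaussian (EuclideanSpace ℝ (Fin q))) ≤
      ENNReal.ofReal ((1 + Δ * ((p - 1) * (p - 2) / 2)) * |x l - c + Δ * b (k * Δ) x l| ^ p +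
        Δ * (p - 1 + Δ ^ (p / 2 - 1) * ∫ g : ℝ, |g| ^ p ∂(gaussianReal 0 1)) *
          ‖(WithLp.toLp 2 (σ (k * Δ) x l) : EuclideanSpace ℝ (Fin q))‖ ^ p) := by
  set w : EuclideanSpace ℝ (Fin q) := WithLp.toLp 2 (σ (k * Δ) x l) with hw
  set a := x l - c + Δ * b (k * Δ) x l with ha
  have e : ∀ z, ENNReal.ofReal (|MarkovQuant.eulerOp b σ Δ k x z l - c| ^ p) =
      (fun y : ℝ => ENNReal.ofReal (|a + y| ^ p)) (inner ℝ (√Δ • w) z) := by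
    intro z
    rw [eulerOp_apply]
    congr 3; rw [ha]; ring
  rw [lintegral_congr e, lintegral_inner_stdGaussian (√Δ • w)
    (f := fun y : ℝ => ENNReal.ofReal (|a + y| ^ p)) (by fun_prop)]
  refine (lintegral_abs_add_rpow_gaussian_le hp hp3 a ‖√Δ • w‖).trans (ENNReal.ofReal_le_ofReal ?_)
  rw [norm_smul, Real.norm_of_nonneg (Real.sqrt_nonneg _)]
  have hw0 := norm_nonneg w
  have e1 : |√Δ * ‖w‖| ^ p = Δ * Δ ^ (p / 2 - 1) * ‖w‖ ^ p := by
    rw [abs_of_nonneg (by positivity), Real.mul_rpow (Real.sqrt_nonneg _) hw0, Real.sqrt_eq_rpow,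
      ← Real.rpow_mul hΔ.le, Real.rpow_sub_one hΔ.ne', mul_div_cancel₀ _ hΔ.ne']
    congr 2; ring
  have e2 : (√Δ * ‖w‖) ^ 2 = Δ * ‖w‖ ^ 2 := by rw [mul_pow, Real.sq_sqrt hΔ.le]
  rw [e1, e2]
  have hy := young_diffusion hp (abs_nonneg a) hw0
  have := mul_le_mul_of_nonneg_left hy hΔ.le
  linarith

/-- Effect of the drift on `phi`, by Minkowski's inequality in `ℓ^p`. Comparing `ℓ^p` with `ℓ²`
costs nothing for the drift itself, but its rescaling leaves the factor `d ^ (1 / 2 - 1 / p)`. -/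
theorem rpow_sum_abs_add_le {d : ℕ} {p L r v Δ : ℝ} (hp : 2 < p) (hΔ : 0 ≤ Δ)
    {c y β : EuclideanSpace ℝ (Fin d)} (hv0 : 0 ≤ v) (hv : phi p c y = v ^ p)
    (hβ : ‖β‖ ≤ L * (1 + r + v)) :
    (d : ℝ) ^ (p / 2 - 1) * ∑ l, |y l - c l + Δ * β l| ^ p ≤
      (v + Δ * ((d : ℝ) ^ (1 / 2 - 1 / p) * L) * (1 + r + v)) ^ p := by
  have hp0 : 0 < p := by linarith
  set δ := (d : ℝ) ^ (1 / 2 - 1 / p) with hδ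
  have hδ0 : 0 ≤ δ := by positivity
  have hδp : (d : ℝ) ^ (p / 2 - 1) = δ ^ p := by
    rw [hδ, ← Real.rpow_mul (by positivity)]; congr 1; field_simp
  have hroot : ∀ {S : ℝ}, 0 ≤ S → (S ^ (1 / p)) ^ p = S := fun hS => by
    rw [← Real.rpow_mul hS, one_div_mul_cancel hp0.ne', Real.rpow_one]
  have hM := Real.Lp_add_le (s := Finset.univ) (f := fun l => y l - c l) (g := fun l => Δ * β l)
    (by linarith : 1 ≤ p)
  set S1 := ∑ l, |y l - c l| ^ p with hS1
  set S2 := ∑ l, |Δ * β l| ^ p with hS2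
  set S := ∑ l, |y l - c l + Δ * β l| ^ p with hS
  have hS0 : 0 ≤ S := by positivity
  have hS10 : 0 ≤ S1 := by positivity
  have hS20 : 0 ≤ S2 := by positivity
  have h1 : δ * S1 ^ (1 / p) = v := by
    rw [phi, hδp, ← hS1] at hv
    have : (δ * S1 ^ (1 / p)) ^ p = v ^ p := by
      rw [Real.mul_rpow hδ0 (by positivity), hroot hS10, hv]
    exact (Real.rpow_left_inj (by positivity) hv0 hp0.ne').1 this
  have h2 : S2 ^ (1 / p) ≤ Δ * ‖β‖ := by
    have hb := sum_abs_rpow_le hp.le (Δ • β)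
    simp only [PiLp.smul_apply, smul_eq_mul, norm_smul, Real.norm_of_nonneg hΔ] at hb
    rw [← Real.rpow_le_rpow_iff (by positivity) (by positivity) hp0, hroot hS20]
    exact hb
  rw [hδp, ← hroot hS0, ← Real.mul_rpow hδ0 (by positivity)]
  apply Real.rpow_le_rpow (by positivity) _ hp0.le
  calc δ * S ^ (1 / p) ≤ δ * (S1 ^ (1 / p) + S2 ^ (1 / p)) := by gcongr
    _ ≤ δ * (S1 ^ (1 / p) + Δ * (L * (1 + r + v))) := by
        gcongr; exact h2.trans (by gcongr)
    _ = _ := by rw [mul_add, h1]; ring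

theorem kappa_pos {L p : ℝ} (hL : 0 < L) (hp : 2 < p) : 0 < MarkovQuant.kappa L p := by
  unfold MarkovQuant.kappa
  have : 0 < p - 2 := by linarith
  positivity

theorem bigK_nonneg {d : ℕ} {Δ L p : ℝ} (hL : 0 < L) (hΔ : 0 < Δ) (hp : 2 < p) :
    0 ≤ MarkovQuant.bigK d Δ L p := by
  unfold MarkovQuant.bigK
  have h1 : 0 ≤ ∫ z, ‖z‖ ^ p ∂(stdGaussian (EuclideanSpace ℝ (Fin d))) :=
    integral_nonneg fun z => by positivity
  have : 0 < p - 1 := by linarith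
  positivity

/-- The additive constant of the moment recursion, for a centre of norm `r`. -/
noncomputable def stepConst (d : ℕ) (Δ L p r : ℝ) : ℝ :=
  (Real.exp ((MarkovQuant.kappa L p + MarkovQuant.bigK d Δ L p) * Δ) - 1) *
    (r ^ p + (Real.exp (MarkovQuant.kappa L p * Δ) * L +
      MarkovQuant.bigK d Δ L p / (d : ℝ) ^ (p / 2 - 1)) /
        (MarkovQuant.kappa L p + MarkovQuant.bigK d Δ L p))

theorem stepConst_nonneg {d : ℕ} {Δ L p r : ℝ} (hL : 0 < L) (hΔ : 0 < Δ) (hp : 2 < p)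
    (hr : 0 ≤ r) : 0 ≤ stepConst d Δ L p r := by
  have h1 := kappa_pos hL hp
  have h2 := bigK_nonneg (d := d) hL hΔ hp
  have h3 : 0 ≤ Real.exp ((MarkovQuant.kappa L p + MarkovQuant.bigK d Δ L p) * Δ) - 1 :=
    sub_nonneg.2 (Real.one_le_exp (by positivity))
  unfold stepConst
  positivity

/-- The numerical inequality behind one step of the moment recursion. The diffusion constant
obtained from convexity with three terms `1`, `r`, `v` is too large for `d = 1`, whereas with
two terms it fits: hence the centre `0` in that case. -/
theorem moment_step_real {d : ℕ} (hd : 0 < d) {Δ L p r v : ℝ} (hL : 0 < L) (hΔ : 0 < Δ)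
    (hp : 2 < p) (hp3 : p ≤ 3) (hr : 0 ≤ r) (hv : 0 ≤ v) (hcase : 2 ≤ d ∨ r = 0) :
    (1 + Δ * ((p - 1) * (p - 2) / 2)) *
        (v + Δ * ((d : ℝ) ^ (1 / 2 - 1 / p) * L) * (1 + r + v)) ^ p +
      Δ * (p - 1 + Δ ^ (p / 2 - 1) * ∫ g : ℝ, |g| ^ p ∂(gaussianReal 0 1)) *
        ((d : ℝ) ^ (p / 2 - 1) * (L * (1 + r + v)) ^ p) ≤
      Real.exp ((MarkovQuant.kappa L p + MarkovQuant.bigK d Δ L p) * Δ) * v ^ p +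
        stepConst d Δ L p r := by
  have hp0 : 0 < p := by linarith
  have hd0 : (0 : ℝ) < d := by exact_mod_cast hd
  have hκ := kappa_pos hL hp
  have hK := bigK_nonneg (d := d) hL hΔ hp
  have hdrift := drift_step_le (r := r) hp hp3 hL hd0 hΔ hr hv rfl
  have hm := rpow_dim_le_integral_norm_rpow hd hp
  have hc3 := integral_abs_rpow_gaussianReal_le hp (by linarith)
  have hc1 : 1 ≤ ∫ g : ℝ, |g| ^ p ∂(gaussianReal 0 1) := by
    have := rpow_dim_le_integral_norm_rpow one_pos hp
    rwa [Nat.cast_one, Real.one_rpow, integral_norm_rpow_stdGaussian_one] at this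
  have hm1 : d = 1 → ∫ z, ‖z‖ ^ p ∂(stdGaussian (EuclideanSpace ℝ (Fin d))) =
      ∫ g : ℝ, |g| ^ p ∂(gaussianReal 0 1) := by
    rintro rfl; exact integral_norm_rpow_stdGaussian_one
  set c := ∫ g : ℝ, |g| ^ p ∂(gaussianReal 0 1) with hc
  set τ := Δ ^ (p / 2 - 1) with hτ
  have hτ0 : 0 ≤ τ := by positivity
  have hQ : 0 ≤ p - 1 + τ * c := by nlinarith
  set K₁ := 2 ^ (p - 1) * (L ^ p * (d : ℝ) ^ (p / 2)) with hK₁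
  have hK₁0 : 0 ≤ K₁ := by positivity
  have hKeq : MarkovQuant.bigK d Δ L p = 2 ^ (p - 1) * L ^ p * (1 + p + p * (p - 1) / 2 * τ) *
      ∫ z, ‖z‖ ^ p ∂(stdGaussian (EuclideanSpace ℝ (Fin d))) := by
    rw [MarkovQuant.bigK]
  have hK₁2 : K₁ ≤ MarkovQuant.bigK d Δ L p / 2 := by
    rw [hKeq, hK₁, le_div_iff₀ two_pos]
    have : 0 ≤ p * (p - 1) / 2 * τ := mul_nonneg (by nlinarith) hτ0
    calc 2 ^ (p - 1) * (L ^ p * (d : ℝ) ^ (p / 2)) * 2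
        = 2 ^ (p - 1) * L ^ p * 2 * (d : ℝ) ^ (p / 2) := by ring
      _ ≤ _ := by gcongr; linarith
  -- the diffusion constant, split into the cases of the two centres
  obtain ⟨q, hq0, hqK, hqD, hqle⟩ : ∃ q, 0 ≤ q ∧ K₁ + q ≤ MarkovQuant.bigK d Δ L p ∧
      q ≤ MarkovQuant.bigK d Δ L p / (d : ℝ) ^ (p / 2 - 1) ∧
      (p - 1 + τ * c) * ((d : ℝ) ^ (p / 2 - 1) * (L * (1 + r + v)) ^ p) ≤
        q * (1 + r ^ p + v ^ p) := by
    by_cases hd2 : 2 ≤ d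
    · have h := diffusion_const_of_two_le (τ := τ) hp hp3 (by exact_mod_cast hd2 : (2 : ℝ) ≤ d) hL
        hτ0 (by linarith) hc3 hm
      refine ⟨3 ^ (p - 1) * ((d : ℝ) ^ (p / 2 - 1) * L ^ p * (p - 1 + τ * c)), by positivity, ?_, ?_, ?_⟩
      · rw [hKeq]; exact h.1
      · rw [hKeq]; exact h.2
      · rw [Real.mul_rpow hL.le (by positivity)]
        have := one_add_add_rpow_le (by linarith : 1 ≤ p) hr hv
        calc _ ≤ (p - 1 + τ * c) * ((d : ℝ) ^ (p / 2 - 1) *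
              (L ^ p * (3 ^ (p - 1) * (1 + r ^ p + v ^ p)))) := by gcongr
          _ = _ := by ring
    · have hd1 : d = 1 := by omega
      have hr0 : r = 0 := hcase.resolve_left hd2
      have h := diffusion_const_one (τ := τ) hp hL hτ0 hc1
      have hq0 : 0 ≤ 2 ^ (p - 1) * (L ^ p * (p - 1 + τ * c)) := by positivity
      have hA0 : (0 : ℝ) ≤ 2 ^ (p - 1) * L ^ p := by positivity
      refine ⟨2 ^ (p - 1) * (L ^ p * (p - 1 + τ * c)), hq0, ?_, ?_, ?_⟩
      · rw [hKeq, hm1 hd1, hK₁, hd1, Nat.cast_one, Real.one_rpow, mul_one]; exact h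
      · rw [hKeq, hm1 hd1, hd1, Nat.cast_one, Real.one_rpow, div_one]; linarith
      · rw [Real.mul_rpow hL.le (by positivity), hr0, Real.zero_rpow hp0.ne', add_zero, hd1,
          Nat.cast_one, Real.one_rpow, one_mul]
        have := one_add_rpow_le (by linarith : 1 ≤ p) hv
        calc _ ≤ (p - 1 + τ * c) * (L ^ p * (2 ^ (p - 1) * (1 + v ^ p))) := by gcongr
          _ = _ := by ring
  have hfin := drift_add_diffusion_le (rp := r ^ p) (vp := v ^ p) hκ.le hK₁0 hq0 hL.le hΔ
    (by positivity) (by positivity) (by linarith) hqK hqD hK₁2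
  have hdiff : Δ * (p - 1 + τ * c) * ((d : ℝ) ^ (p / 2 - 1) * (L * (1 + r + v)) ^ p) ≤
      Δ * q * (1 + r ^ p + v ^ p) := by
    rw [mul_assoc, mul_assoc Δ q]; exact mul_le_mul_of_nonneg_left hqle hΔ.le
  rw [stepConst]
  linarith

/-- One step of the moment recursion, for a deterministic initial point `y`. -/
theorem lintegral_phi_eulerOp_le {d q : ℕ} (hd : 0 < d)
    (b : ℝ → EuclideanSpace ℝ (Fin d) → EuclideanSpace ℝ (Fin d))
    (σ : ℝ → EuclideanSpace ℝ (Fin d) → Matrix (Fin d) (Fin q) ℝ) {Δ L p : ℝ} (hL : 0 < L)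
    (hΔ : 0 < Δ) (hp : 2 < p) (hp3 : p ≤ 3) (k : ℕ) (c y : EuclideanSpace ℝ (Fin d))
    (hcase : 2 ≤ d ∨ c = 0)
    (hb : ‖b (k * Δ) y‖ ≤ L * (1 + ‖y‖))
    (hσ : MarkovQuant.frobNorm (σ (k * Δ) y) ≤ L * (1 + ‖y‖)) :
    ∫⁻ z, ENNReal.ofReal (phi p c (MarkovQuant.eulerOp b σ Δ k y z))
        ∂(stdGaussian (EuclideanSpace ℝ (Fin q))) ≤
      ENNReal.ofReal (Real.exp ((MarkovQuant.kappa L p + MarkovQuant.bigK d Δ L p) * Δ) *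
        phi p c y + stepConst d Δ L p ‖c‖) := by
  have hp0 : 0 < p := by linarith
  set D := (d : ℝ) ^ (p / 2 - 1) with hD
  have hD0 : 0 ≤ D := by positivity
  set v := phi p c y ^ (1 / p) with hv
  have hv0 : 0 ≤ v := Real.rpow_nonneg (phi_nonneg _ _ _) _
  have hvp : phi p c y = v ^ p := by
    rw [hv, ← Real.rpow_mul (phi_nonneg _ _ _), one_div_mul_cancel hp0.ne', Real.rpow_one]
  have hyv : ‖y‖ ≤ ‖c‖ + v := by
    have h1 : ‖y - c‖ ≤ v := by
      rw [← Real.rpow_le_rpow_iff (norm_nonneg _) hv0 hp0, ← hvp]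
      exact norm_rpow_le_sum hp.le (y - c)
    have := norm_le_norm_add_norm_sub' y c
    linarith
  have hb' : ‖b (k * Δ) y‖ ≤ L * (1 + ‖c‖ + v) := hb.trans (mul_le_mul_of_nonneg_left (by linarith) hL.le)
  have hσ' : MarkovQuant.frobNorm (σ (k * Δ) y) ≤ L * (1 + ‖c‖ + v) :=
    hσ.trans (mul_le_mul_of_nonneg_left (by linarith) hL.le)
  have hcm : 0 ≤ ∫ g : ℝ, |g| ^ p ∂(gaussianReal 0 1) := integral_nonneg fun g => by positivity
  set cp := ∫ g : ℝ, |g| ^ p ∂(gaussianReal 0 1) with hcp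
  set Q := p - 1 + Δ ^ (p / 2 - 1) * cp with hQ
  have hQ0 : 0 ≤ Q := by
    have : 0 ≤ Δ ^ (p / 2 - 1) * cp := by positivity
    linarith
  have hY : 0 ≤ 1 + Δ * ((p - 1) * (p - 2) / 2) := by
    have : 0 ≤ (p - 1) * (p - 2) := mul_nonneg (by linarith) (by linarith)
    positivity
  have hmeas : ∀ l, Measurable fun z : EuclideanSpace ℝ (Fin q) =>
      ENNReal.ofReal (|MarkovQuant.eulerOp b σ Δ k y z l - c l| ^ p) := by
    intro l
    simp only [eulerOp_apply]
    fun_prop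
  have e1 : ∀ z, ENNReal.ofReal (phi p c (MarkovQuant.eulerOp b σ Δ k y z)) =
      ENNReal.ofReal D * ∑ l, ENNReal.ofReal (|MarkovQuant.eulerOp b σ Δ k y z l - c l| ^ p) := by
    intro z
    rw [phi, ENNReal.ofReal_mul hD0, ENNReal.ofReal_sum_of_nonneg fun l _ => by positivity]
  rw [lintegral_congr e1, lintegral_const_mul _ (Finset.measurable_sum _ fun l _ => hmeas l),
    lintegral_finsetSum _ fun l _ => hmeas l]
  calc _ ≤ ENNReal.ofReal D * ∑ l, ENNReal.ofReal ((1 + Δ * ((p - 1) * (p - 2) / 2)) *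
          |y l - c l + Δ * b (k * Δ) y l| ^ p + Δ * Q *
          ‖(WithLp.toLp 2 (σ (k * Δ) y l) : EuclideanSpace ℝ (Fin q))‖ ^ p) := by
        gcongr with l
        exact lintegral_eulerOp_coord_le b σ hΔ hp hp3 k y l (c l)
    _ = ENNReal.ofReal (D * ∑ l, ((1 + Δ * ((p - 1) * (p - 2) / 2)) *
          |y l - c l + Δ * b (k * Δ) y l| ^ p + Δ * Q *
          ‖(WithLp.toLp 2 (σ (k * Δ) y l) : EuclideanSpace ℝ (Fin q))‖ ^ p)) := by
        rw [ENNReal.ofReal_mul hD0, ENNReal.ofReal_sum_of_nonneg fun l _ => by positivity]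
    _ ≤ _ := by
        apply ENNReal.ofReal_le_ofReal
        rw [hvp]
        refine le_trans ?_ (moment_step_real hd hL hΔ hp hp3 (norm_nonneg c) hv0
          (hcase.imp_right fun h => by simp [h]))
        rw [Finset.sum_add_distrib, ← Finset.mul_sum, ← Finset.mul_sum]
        have h1 := rpow_sum_abs_add_le hp hΔ.le hv0 hvp hb'
        have h2 : ∑ l, ‖(WithLp.toLp 2 (σ (k * Δ) y l) : EuclideanSpace ℝ (Fin q))‖ ^ p ≤
            (L * (1 + ‖c‖ + v)) ^ p :=
          (sum_norm_row_rpow_le hp.le _).trans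
            (Real.rpow_le_rpow (frobNorm_nonneg _) hσ' hp0.le)
        have h3 := mul_le_mul_of_nonneg_left h1 hY
        have h4 := mul_le_mul_of_nonneg_left (mul_le_mul_of_nonneg_left h2 hD0)
          (mul_nonneg hΔ.le hQ0)
        linarith

/-! ### Measurability and independence -/

theorem measurable_eulerOp {d q : ℕ}
    {b : ℝ → EuclideanSpace ℝ (Fin d) → EuclideanSpace ℝ (Fin d)}
    {σ : ℝ → EuclideanSpace ℝ (Fin d) → Matrix (Fin d) (Fin q) ℝ} {Δ : ℝ} {k : ℕ}
    (hb : Measurable (b (k * Δ))) (hσ : ∀ i j, Measurable fun x => σ (k * Δ) x i j) :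
    Measurable fun w : EuclideanSpace ℝ (Fin d) × EuclideanSpace ℝ (Fin q) =>
      MarkovQuant.eulerOp b σ Δ k w.1 w.2 := by
  have h : Measurable fun w : EuclideanSpace ℝ (Fin d) × EuclideanSpace ℝ (Fin q) =>
      Matrix.mulVec (σ (k * Δ) w.1) w.2.ofLp := by
    refine measurable_pi_iff.2 fun i => ?_
    simp only [Matrix.mulVec, dotProduct]
    exact Finset.measurable_sum _ fun j _ => ((hσ i j).comp measurable_fst).mul (by fun_prop)
  have h' : Measurable fun w : EuclideanSpace ℝ (Fin d) × EuclideanSpace ℝ (Fin q) =>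
      (WithLp.toLp 2 (Matrix.mulVec (σ (k * Δ) w.1) w.2.ofLp) : EuclideanSpace ℝ (Fin d)) :=
    (PiLp.continuous_toLp 2 _).measurable.comp h
  unfold MarkovQuant.eulerOp
  exact (measurable_fst.add ((hb.comp measurable_fst).const_smul Δ)).add
    (h'.const_smul (√Δ))

theorem measurable_prodProj {d : ℕ} {proj : Fin d → ℝ → ℝ} (h : ∀ l, Measurable (proj l)) :
    Measurable (MarkovQuant.prodProj proj) := by
  unfold MarkovQuant.prodProj
  refine (PiLp.continuous_toLp 2 _).measurable.comp (measurable_pi_iff.2 fun l => ?_)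
  exact (h l).comp (by fun_prop)

/-- The `σ`-algebra generated by the innovations `Z₁, …, Z_k`. -/
@[reducible]
def pastSigma {q n : ℕ} {Ω : Type*} (Z : ℕ → Ω → EuclideanSpace ℝ (Fin q)) (k : ℕ) :
    MeasurableSpace Ω :=
  ⨆ i ∈ {i : Finset.Icc 1 n | (i : ℕ) ≤ k}, MeasurableSpace.comap (Z i) inferInstance

theorem pastSigma_mono {q n : ℕ} {Ω : Type*} (Z : ℕ → Ω → EuclideanSpace ℝ (Fin q)) {k m : ℕ}
    (h : k ≤ m) : pastSigma (n := n) Z k ≤ pastSigma (n := n) Z m :=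
  biSup_mono fun _ hi => le_trans hi h

theorem measurable_innovation {q n : ℕ} {Ω : Type*} (Z : ℕ → Ω → EuclideanSpace ℝ (Fin q)) {k : ℕ}
    (h1 : 1 ≤ k) (hk : k ≤ n) : Measurable[pastSigma (n := n) Z k] (Z k) := by
  rw [measurable_iff_comap_le]
  exact le_iSup₂_of_le (f := fun (i : Finset.Icc 1 n) (_ : i ∈ {i : Finset.Icc 1 n | (i : ℕ) ≤ k}) =>
    MeasurableSpace.comap (Z i) inferInstance) ⟨k, Finset.mem_Icc.2 ⟨h1, hk⟩⟩ (le_refl k) le_rfl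

theorem measurable_euler {d q n : ℕ} {Ω : Type*}
    {b : ℝ → EuclideanSpace ℝ (Fin d) → EuclideanSpace ℝ (Fin d)}
    {σ : ℝ → EuclideanSpace ℝ (Fin d) → Matrix (Fin d) (Fin q) ℝ} {Δ : ℝ}
    (hb : ∀ k < n, Measurable (b (k * Δ)))
    (hσ : ∀ k < n, ∀ i j, Measurable fun x => σ (k * Δ) x i j)
    (x₀ : EuclideanSpace ℝ (Fin d)) (Z : ℕ → Ω → EuclideanSpace ℝ (Fin q)) {k : ℕ} (hk : k ≤ n) :
    Measurable[pastSigma (n := n) Z k] (MarkovQuant.euler b σ Δ x₀ Z k) := by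
  induction k with
  | zero => exact measurable_const
  | succ k ih =>
    have h1 : Measurable[pastSigma (n := n) Z (k + 1)] (MarkovQuant.euler b σ Δ x₀ Z k) :=
      (ih (by omega)).mono (pastSigma_mono Z (by omega)) le_rfl
    exact (measurable_eulerOp (hb k (by omega)) (hσ k (by omega))).comp
      (h1.prodMk (measurable_innovation Z (by omega) hk))

theorem measurable_tildeX {d q n : ℕ} {Ω : Type*}
    {b : ℝ → EuclideanSpace ℝ (Fin d) → EuclideanSpace ℝ (Fin d)}
    {σ : ℝ → EuclideanSpace ℝ (Fin d) → Matrix (Fin d) (Fin q) ℝ} {Δ : ℝ}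
    (hb : ∀ k < n, Measurable (b (k * Δ)))
    (hσ : ∀ k < n, ∀ i j, Measurable fun x => σ (k * Δ) x i j)
    (x₀ : EuclideanSpace ℝ (Fin d)) (Z : ℕ → Ω → EuclideanSpace ℝ (Fin q))
    {proj : ℕ → Fin d → ℝ → ℝ} (hproj : ∀ k ≤ n, ∀ l, Measurable (proj k l)) {k : ℕ} (hk : k ≤ n) :
    Measurable[pastSigma (n := n) Z k] (MarkovQuant.tildeX b σ Δ x₀ Z proj k) := by
  induction k with
  | zero => exact measurable_const
  | succ k ih =>
    have h1 : Measurable[pastSigma (n := n) Z (k + 1)] (MarkovQuant.tildeX b σ Δ x₀ Z proj k) :=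
      (ih (by omega)).mono (pastSigma_mono Z (by omega)) le_rfl
    exact (measurable_eulerOp (hb k (by omega)) (hσ k (by omega))).comp
      (((measurable_prodProj (hproj k (by omega))).comp h1).prodMk
        (measurable_innovation Z (by omega) hk))

theorem pastSigma_le {q n : ℕ} {Ω : Type*} [mΩ : MeasurableSpace Ω]
    {Z : ℕ → Ω → EuclideanSpace ℝ (Fin q)} (hZ : ∀ k ∈ Finset.Icc 1 n, Measurable (Z k)) (k : ℕ) :
    pastSigma (n := n) Z k ≤ mΩ :=
  iSup₂_le fun i _ => (hZ i i.2).comap_le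

/-- What is built from `Z₁, …, Z_k` is independent of `Z_{k+1}`. -/
theorem indepFun_of_measurable_pastSigma {q n : ℕ} {Ω α : Type*} [MeasurableSpace Ω]
    [MeasurableSpace α] {P : Measure Ω} {Z : ℕ → Ω → EuclideanSpace ℝ (Fin q)}
    (hZ : ∀ k ∈ Finset.Icc 1 n, Measurable (Z k))
    (hind : iIndepFun (fun k : Finset.Icc 1 n => Z k) P) {k : ℕ} (hk : k < n) {X : Ω → α}
    (hX : Measurable[pastSigma (n := n) Z k] X) : IndepFun X (Z (k + 1)) P := by
  have h := indep_iSup_of_disjoint (fun i : Finset.Icc 1 n => (hZ i i.2).comap_le) hind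
    (S := {i : Finset.Icc 1 n | (i : ℕ) ≤ k})
    (T := {⟨k + 1, Finset.mem_Icc.2 ⟨by omega, hk⟩⟩}) (by
      rw [Set.disjoint_singleton_right, Set.mem_ofPred_eq]; simp)
  rw [iSup_singleton] at h
  exact indep_of_indep_of_le_left h hX.comap_le

/-- Freezing the past: integrate first over an independent innovation. -/
theorem lintegral_comp_pair {q : ℕ} {Ω α : Type*} [MeasurableSpace Ω] [MeasurableSpace α]
    {P : Measure Ω} [IsProbabilityMeasure P] {Z : Ω → EuclideanSpace ℝ (Fin q)} {X : Ω → α}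
    (hX : Measurable X) (hZ : Measurable Z)
    (hlaw : HasLaw Z (stdGaussian (EuclideanSpace ℝ (Fin q))) P) (hind : IndepFun X Z P)
    {f : α × EuclideanSpace ℝ (Fin q) → ℝ≥0∞} (hf : Measurable f) :
    ∫⁻ ω, f (X ω, Z ω) ∂P =
      ∫⁻ ω, ∫⁻ z, f (X ω, z) ∂(stdGaussian (EuclideanSpace ℝ (Fin q))) ∂P := by
  have h := (indepFun_iff_map_prod_eq_prod_map_map hX.aemeasurable hZ.aemeasurable).1 hind
  rw [hlaw.map_eq] at h
  rw [← lintegral_map hf (hX.prodMk hZ), h, lintegral_prod _ hf.aemeasurable,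
    lintegral_map hf.lintegral_prod_right' hX]

/-! ### One Euler step: Lipschitz continuity in the mean square -/

/-- The Euler operator is Lipschitz in `L²` with constant `exp (Δ (B + S² / 2))`, because
`(1 + Δ B)² + Δ S² ≤ exp (2 Δ B) exp (Δ S²)`. -/
theorem lintegral_sq_eulerOp_sub_le {d q : ℕ}
    {b : ℝ → EuclideanSpace ℝ (Fin d) → EuclideanSpace ℝ (Fin d)}
    {σ : ℝ → EuclideanSpace ℝ (Fin d) → Matrix (Fin d) (Fin q) ℝ} {Δ B S : ℝ} {k : ℕ}
    (hΔ : 0 ≤ Δ) (hB : 0 ≤ B) (x y : EuclideanSpace ℝ (Fin d))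
    (hb : ‖b (k * Δ) x - b (k * Δ) y‖ ≤ B * ‖x - y‖)
    (hσ : MarkovQuant.frobNorm (σ (k * Δ) x - σ (k * Δ) y) ≤ S * ‖x - y‖) :
    ∫⁻ z, ENNReal.ofReal (‖MarkovQuant.eulerOp b σ Δ k x z - MarkovQuant.eulerOp b σ Δ k y z‖ ^ 2)
        ∂(stdGaussian (EuclideanSpace ℝ (Fin q))) ≤
      ENNReal.ofReal (Real.exp (Δ * (B + S ^ 2 / 2)) ^ 2 * ‖x - y‖ ^ 2) := by
  set u := x - y + Δ • (b (k * Δ) x - b (k * Δ) y) with hu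
  set A := σ (k * Δ) x - σ (k * Δ) y with hA
  have hcoord : ∀ (z : EuclideanSpace ℝ (Fin q)) (l : Fin d),
      (MarkovQuant.eulerOp b σ Δ k x z - MarkovQuant.eulerOp b σ Δ k y z) l =
      u l + inner ℝ (√Δ • (WithLp.toLp 2 (A l) : EuclideanSpace ℝ (Fin q))) z := by
    intro z l
    have e : (WithLp.toLp 2 (A l) : EuclideanSpace ℝ (Fin q)) =
        WithLp.toLp 2 (σ (k * Δ) x l) - WithLp.toLp 2 (σ (k * Δ) y l) := by
      ext j; simp [hA]
    rw [PiLp.sub_apply, eulerOp_apply, eulerOp_apply, e, smul_sub, inner_sub_left, hu]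
    simp only [PiLp.add_apply, PiLp.sub_apply, PiLp.smul_apply, smul_eq_mul]
    ring
  have e1 : ∀ z, ENNReal.ofReal
      (‖MarkovQuant.eulerOp b σ Δ k x z - MarkovQuant.eulerOp b σ Δ k y z‖ ^ 2) =
      ∑ l, ENNReal.ofReal ((u l +
        inner ℝ (√Δ • (WithLp.toLp 2 (A l) : EuclideanSpace ℝ (Fin q))) z) ^ 2) := by
    intro z
    rw [EuclideanSpace.norm_sq_eq, ENNReal.ofReal_sum_of_nonneg fun l _ => by positivity]
    simp only [hcoord, Real.norm_eq_abs, sq_abs]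
  rw [lintegral_congr e1, lintegral_finsetSum _ fun l _ => by fun_prop]
  have e2 : ∀ l, ∫⁻ z, ENNReal.ofReal ((u l +
        inner ℝ (√Δ • (WithLp.toLp 2 (A l) : EuclideanSpace ℝ (Fin q))) z) ^ 2)
        ∂(stdGaussian (EuclideanSpace ℝ (Fin q))) =
      ENNReal.ofReal (u l ^ 2 + Δ * ‖(WithLp.toLp 2 (A l) : EuclideanSpace ℝ (Fin q))‖ ^ 2) := by
    intro l
    rw [lintegral_inner_stdGaussian (√Δ • (WithLp.toLp 2 (A l) : EuclideanSpace ℝ (Fin q)))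
      (f := fun g : ℝ => ENNReal.ofReal ((u l + g) ^ 2)) (by fun_prop), lintegral_add_sq_gaussian,
      norm_smul, mul_pow, Real.norm_of_nonneg (Real.sqrt_nonneg _), Real.sq_sqrt hΔ]
  rw [Finset.sum_congr rfl fun l _ => e2 l, ← ENNReal.ofReal_sum_of_nonneg fun l _ => by positivity,
    Finset.sum_add_distrib, ← Finset.mul_sum, sum_norm_row_sq]
  apply ENNReal.ofReal_le_ofReal
  have e3 : ∑ l, u l ^ 2 = ‖u‖ ^ 2 := by rw [EuclideanSpace.norm_sq_eq]; simp
  rw [e3]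
  set r := ‖x - y‖ with hr
  have hr0 : 0 ≤ r := norm_nonneg _
  have hu1 : ‖u‖ ≤ (1 + Δ * B) * r := by
    calc ‖u‖ ≤ ‖x - y‖ + ‖Δ • (b (k * Δ) x - b (k * Δ) y)‖ := norm_add_le _ _
      _ ≤ r + Δ * (B * r) := by
          rw [norm_smul, Real.norm_of_nonneg hΔ]; gcongr
      _ = _ := by ring
  have hu2 : ‖u‖ ^ 2 ≤ ((1 + Δ * B) * r) ^ 2 := by gcongr
  have hA2 : MarkovQuant.frobNorm A ^ 2 ≤ (S * r) ^ 2 :=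
    pow_le_pow_left₀ (frobNorm_nonneg _) hσ 2
  have e4 : Real.exp (Δ * (B + S ^ 2 / 2)) ^ 2 = Real.exp (Δ * B) ^ 2 * Real.exp (Δ * S ^ 2) := by
    rw [← Real.exp_nat_mul, ← Real.exp_nat_mul, ← Real.exp_add]; congr 1; push_cast; ring
  have h1 : 1 + Δ * B ≤ Real.exp (Δ * B) := by linarith [Real.add_one_le_exp (Δ * B)]
  have h2 : 1 + Δ * S ^ 2 ≤ Real.exp (Δ * S ^ 2) := by linarith [Real.add_one_le_exp (Δ * S ^ 2)]
  have hB1 : 1 ≤ (1 + Δ * B) ^ 2 := one_le_pow₀ (by nlinarith)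
  have hS0 : 0 ≤ Δ * S ^ 2 := by positivity
  calc ‖u‖ ^ 2 + Δ * MarkovQuant.frobNorm A ^ 2
      ≤ ((1 + Δ * B) * r) ^ 2 + Δ * (S * r) ^ 2 := by gcongr
    _ = ((1 + Δ * B) ^ 2 + Δ * S ^ 2) * r ^ 2 := by ring
    _ ≤ ((1 + Δ * B) ^ 2 * (1 + Δ * S ^ 2)) * r ^ 2 := by
        gcongr; nlinarith
    _ ≤ (Real.exp (Δ * B) ^ 2 * Real.exp (Δ * S ^ 2)) * r ^ 2 := by gcongr
    _ = _ := by rw [e4]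

theorem eLpNorm_two_eq_lintegral {Ω E : Type*} [MeasurableSpace Ω] [NormedAddCommGroup E]
    (P : Measure Ω) (f : Ω → E) :
    eLpNorm f 2 P = (∫⁻ ω, ENNReal.ofReal (‖f ω‖ ^ 2) ∂P) ^ (1 / 2 : ℝ) := by
  rw [eLpNorm_eq_lintegral_rpow_enorm_toReal two_ne_zero ENNReal.ofNat_ne_top]
  simp only [ENNReal.toReal_ofNat, ENNReal.rpow_ofNat, ← ofReal_norm]
  congr 1
  exact lintegral_congr fun ω => (ENNReal.ofReal_pow (norm_nonneg _) 2).symm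

theorem eLpNorm_eulerOp_sub_le {d q : ℕ} {Ω : Type*} [MeasurableSpace Ω] {P : Measure Ω}
    [IsProbabilityMeasure P]
    {b : ℝ → EuclideanSpace ℝ (Fin d) → EuclideanSpace ℝ (Fin d)}
    {σ : ℝ → EuclideanSpace ℝ (Fin d) → Matrix (Fin d) (Fin q) ℝ} {Δ B S : ℝ} {k : ℕ}
    (hΔ : 0 ≤ Δ) (hB : 0 ≤ B)
    (hb : ∀ x y, ‖b (k * Δ) x - b (k * Δ) y‖ ≤ B * ‖x - y‖)
    (hσ : ∀ x y, MarkovQuant.frobNorm (σ (k * Δ) x - σ (k * Δ) y) ≤ S * ‖x - y‖)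
    (hbm : Measurable (b (k * Δ))) (hσm : ∀ i j, Measurable fun x => σ (k * Δ) x i j)
    {X Y : Ω → EuclideanSpace ℝ (Fin d)} {Z : Ω → EuclideanSpace ℝ (Fin q)}
    (hX : Measurable X) (hY : Measurable Y) (hZ : Measurable Z)
    (hlaw : HasLaw Z (stdGaussian (EuclideanSpace ℝ (Fin q))) P)
    (hind : IndepFun (fun ω => (X ω, Y ω)) Z P) :
    eLpNorm (fun ω => MarkovQuant.eulerOp b σ Δ k (X ω) (Z ω) -
        MarkovQuant.eulerOp b σ Δ k (Y ω) (Z ω)) 2 P ≤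
      ENNReal.ofReal (Real.exp (Δ * (B + S ^ 2 / 2))) * eLpNorm (fun ω => X ω - Y ω) 2 P := by
  have hE := measurable_eulerOp hbm hσm
  have hf : Measurable fun w : (EuclideanSpace ℝ (Fin d) × EuclideanSpace ℝ (Fin d)) ×
      EuclideanSpace ℝ (Fin q) => ENNReal.ofReal (‖MarkovQuant.eulerOp b σ Δ k w.1.1 w.2 -
        MarkovQuant.eulerOp b σ Δ k w.1.2 w.2‖ ^ 2) := by
    have h1 := hE.comp ((measurable_fst.comp measurable_fst).prodMk measurable_snd :
      Measurable fun w : (EuclideanSpace ℝ (Fin d) × EuclideanSpace ℝ (Fin d)) ×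
      EuclideanSpace ℝ (Fin q) => (w.1.1, w.2))
    have h2 := hE.comp ((measurable_snd.comp measurable_fst).prodMk measurable_snd :
      Measurable fun w : (EuclideanSpace ℝ (Fin d) × EuclideanSpace ℝ (Fin d)) ×
      EuclideanSpace ℝ (Fin q) => (w.1.2, w.2))
    exact ((h1.sub h2).norm.pow_const 2).ennreal_ofReal
  rw [eLpNorm_two_eq_lintegral, eLpNorm_two_eq_lintegral,
    lintegral_comp_pair (hX.prodMk hY) hZ hlaw hind hf]
  set e := Real.exp (Δ * (B + S ^ 2 / 2)) with he
  have he0 : 0 ≤ e := (Real.exp_pos _).le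
  have h1 : ∫⁻ ω, ∫⁻ z, ENNReal.ofReal (‖MarkovQuant.eulerOp b σ Δ k (X ω) z -
        MarkovQuant.eulerOp b σ Δ k (Y ω) z‖ ^ 2) ∂(stdGaussian (EuclideanSpace ℝ (Fin q))) ∂P ≤
      ENNReal.ofReal (e ^ 2) * ∫⁻ ω, ENNReal.ofReal (‖X ω - Y ω‖ ^ 2) ∂P := by
    have hm : Measurable fun ω => ENNReal.ofReal (‖X ω - Y ω‖ ^ 2) :=
      ((hX.sub hY).norm.pow_const 2).ennreal_ofReal
    rw [← lintegral_const_mul _ hm]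
    refine lintegral_mono fun ω => ?_
    rw [← ENNReal.ofReal_mul (by positivity)]
    exact lintegral_sq_eulerOp_sub_le hΔ hB _ _ (hb _ _) (hσ _ _)
  refine (ENNReal.rpow_le_rpow h1 (by norm_num)).trans (le_of_eq ?_)
  rw [ENNReal.mul_rpow_of_nonneg _ _ (by norm_num), ENNReal.ofReal_rpow_of_nonneg (by positivity)
    (by norm_num), ← Real.sqrt_eq_rpow, Real.sqrt_sq he0]

/-! ### Product quantization -/

theorem lintegral_phi_eq {d : ℕ} {Ω : Type*} [MeasurableSpace Ω] {P : Measure Ω} (p : ℝ)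
    (c : EuclideanSpace ℝ (Fin d)) {X : Ω → EuclideanSpace ℝ (Fin d)} (hX : Measurable X) :
    ∫⁻ ω, ENNReal.ofReal (phi p c (X ω)) ∂P =
      ENNReal.ofReal ((d : ℝ) ^ (p / 2 - 1)) *
        ∑ l, ∫⁻ x : ℝ, ENNReal.ofReal (|x - c l| ^ p) ∂(P.map fun ω => X ω l) := by
  have hXl : ∀ l, Measurable fun ω => X ω l := fun l => by fun_prop
  have hm : ∀ l, Measurable fun x : ℝ => ENNReal.ofReal (|x - c l| ^ p) := fun l => by fun_prop
  have e1 : ∀ ω, ENNReal.ofReal (phi p c (X ω)) = ENNReal.ofReal ((d : ℝ) ^ (p / 2 - 1)) *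
      ∑ l, ENNReal.ofReal (|X ω l - c l| ^ p) := by
    intro ω
    rw [phi, ENNReal.ofReal_mul (by positivity), ENNReal.ofReal_sum_of_nonneg fun l _ => by positivity]
  have hml : ∀ l, Measurable fun ω => ENNReal.ofReal (|X ω l - c l| ^ p) :=
    fun l => (hm l).comp (hXl l)
  rw [lintegral_congr e1, lintegral_const_mul _ (Finset.measurable_sum _ fun l _ => hml l),
    lintegral_finsetSum _ fun l _ => hml l]
  congr 1
  exact Finset.sum_congr rfl fun l _ => (lintegral_map (hm l) (hXl l)).symm

/-- The product quantization does not increase the moment measured by `phi`, by componentwise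
stationarity. This works for the `ℓ^p` distance because it is a sum over the components. -/
theorem lintegral_phi_prodProj_le {d : ℕ} {Ω : Type*} [MeasurableSpace Ω] {P : Measure Ω}
    [IsProbabilityMeasure P] {p : ℝ} (hp : 2 < p) (c : EuclideanSpace ℝ (Fin d))
    {X : Ω → EuclideanSpace ℝ (Fin d)} (hX : Measurable X) {N : Fin d → ℕ} {Γ : Fin d → Finset ℝ}
    {proj : Fin d → ℝ → ℝ} (hproj : ∀ l, MarkovQuant.IsNearestProj (Γ l) (proj l))
    (hΓ : ∀ l, MarkovQuant.IsOptimalQuantizer (P.map fun ω => X ω l) (N l) (Γ l)) :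
    ∫⁻ ω, ENNReal.ofReal (phi p c (MarkovQuant.prodProj proj (X ω))) ∂P ≤
      ∫⁻ ω, ENNReal.ofReal (phi p c (X ω)) ∂P := by
  have hY : Measurable fun ω => MarkovQuant.prodProj proj (X ω) :=
    (measurable_prodProj fun l => (hproj l).measurable).comp hX
  rw [lintegral_phi_eq p c hY, lintegral_phi_eq p c hX]
  refine mul_le_mul' le_rfl (Finset.sum_le_sum fun l _ => ?_)
  have hXl : Measurable fun ω => X ω l := by fun_prop
  have : IsProbabilityMeasure (P.map fun ω => X ω l) :=
    Measure.isProbabilityMeasure_map hXl.aemeasurable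
  have h := lintegral_abs_proj_sub_rpow_le (hΓ l) (hproj l) hp (c l)
  refine le_trans (le_of_eq ?_) h
  have hm : Measurable fun x : ℝ => ENNReal.ofReal (|x - c l| ^ p) := by fun_prop
  have hpm := (hproj l).measurable
  have hmp : Measurable fun x : ℝ => ENNReal.ofReal (|proj l x - c l| ^ p) := hm.comp hpm
  rw [lintegral_map hm (by fun_prop), lintegral_map hmp hXl]
  rfl

/-- The error of the product quantization: Pierce's inequality in each component, recentred at the
components of `c`, and Hölder's inequality for the sum over the components. -/
theorem eLpNorm_sub_prodProj_le {d : ℕ} (hd : 0 < d) {Ω : Type*} [MeasurableSpace Ω]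
    {P : Measure Ω} [IsProbabilityMeasure P] {η K m : ℝ} (hη : 0 < η)
    (hK : MarkovQuant.IsPierceConstant η K) (c : EuclideanSpace ℝ (Fin d))
    {X : Ω → EuclideanSpace ℝ (Fin d)} (hX : Measurable X) {N : ℕ} (hN : 1 ≤ N) {Nc : Fin d → ℕ}
    (hNc : ∀ l, N ≤ Nc l ^ d) {Γ : Fin d → Finset ℝ} {proj : Fin d → ℝ → ℝ}
    (hproj : ∀ l, MarkovQuant.IsNearestProj (Γ l) (proj l))
    (hΓ : ∀ l, MarkovQuant.IsOptimalQuantizer (P.map fun ω => X ω l) (Nc l) (Γ l))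
    (hm0 : 0 ≤ m)
    (hm : ∫⁻ ω, ENNReal.ofReal (phi (2 + η) c (X ω)) ∂P ≤ ENNReal.ofReal m) :
    eLpNorm (fun ω => X ω - MarkovQuant.prodProj proj (X ω)) 2 P ≤
      ENNReal.ofReal K * (ENNReal.ofReal (m ^ (1 / (2 + η))) *
        ENNReal.ofReal ((N : ℝ) ^ (-(1 / (d : ℝ))))) := by
  set p := 2 + η with hp
  have hp0 : 0 < p := by linarith
  have hd0 : (0 : ℝ) < d := by exact_mod_cast hd
  rw [lintegral_phi_eq p c hX] at hm
  set W : Fin d → ℝ≥0∞ := fun l =>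
    ∫⁻ x : ℝ, ENNReal.ofReal (|x - c l| ^ p) ∂(P.map fun ω => X ω l) with hW
  set ν := ENNReal.ofReal ((N : ℝ) ^ (-(1 / (d : ℝ)))) with hν
  have hXl : ∀ l, Measurable fun ω => X ω l := fun l => by fun_prop
  have hprob : ∀ l, IsProbabilityMeasure (P.map fun ω => X ω l) :=
    fun l => Measure.isProbabilityMeasure_map (hXl l).aemeasurable
  -- Pierce's inequality for each component
  have hcomp : ∀ l, (MarkovQuant.distortion (P.map fun ω => X ω l) (Γ l)) ^ (1 / 2 : ℝ) ≤
      ENNReal.ofReal K * ν * (W l) ^ (1 / p) := by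
    intro l
    have hN1 : 1 ≤ Nc l := (hΓ l).nonempty.card_pos.trans_le (hΓ l).card_le
    have h1 : (MarkovQuant.distortion (P.map fun ω => X ω l) (Γ l)) ^ (1 / 2 : ℝ) ≤
        ⨅ G : {G : Finset ℝ // G.Nonempty ∧ G.card ≤ Nc l},
          (MarkovQuant.distortion (P.map fun ω => X ω l) G.1) ^ (1 / 2 : ℝ) :=
      le_iInf fun G => ENNReal.rpow_le_rpow ((hΓ l).optimal G.1 G.2.1 G.2.2) (by norm_num)
    have h2 := hK (P.map fun ω => X ω l) (Nc l) hN1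
    have h3 : (⨅ ζ : ℝ, eLpNorm (fun x : ℝ => x - ζ) (ENNReal.ofReal (2 + η))
        (P.map fun ω => X ω l)) ≤ (W l) ^ (1 / p) :=
      (iInf_le _ (c l)).trans (le_of_eq (eLpNorm_ofReal_eq_lintegral hp0 _))
    have h4 : ((Nc l : ℕ) : ℝ≥0∞)⁻¹ ≤ ν := by
      have hN0 : (0 : ℝ) < N := by exact_mod_cast hN
      have hNc0 : (0 : ℝ) < Nc l := by exact_mod_cast hN1
      rw [hν, ← ENNReal.ofReal_natCast, ← ENNReal.ofReal_inv_of_pos hNc0, Real.rpow_neg hN0.le]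
      apply ENNReal.ofReal_le_ofReal
      apply inv_anti₀ (by positivity)
      have : (N : ℝ) ≤ (Nc l : ℝ) ^ (d : ℝ) := by
        rw [Real.rpow_natCast]; exact_mod_cast hNc l
      calc (N : ℝ) ^ (1 / (d : ℝ)) ≤ ((Nc l : ℝ) ^ (d : ℝ)) ^ (1 / (d : ℝ)) := by gcongr
        _ = Nc l := by rw [← Real.rpow_mul hNc0.le, mul_one_div_cancel hd0.ne', Real.rpow_one]
    calc _ ≤ ENNReal.ofReal K * (W l) ^ (1 / p) * ν := (h1.trans h2).trans (by gcongr)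
      _ = _ := by ring
  have hdist : ∫⁻ ω, ENNReal.ofReal (‖X ω - MarkovQuant.prodProj proj (X ω)‖ ^ 2) ∂P =
      ∑ l, MarkovQuant.distortion (P.map fun ω => X ω l) (Γ l) := by
    have hms : ∀ l, Measurable fun x : ℝ => ENNReal.ofReal ((x - proj l x) ^ 2) := fun l => by
      have := (hproj l).measurable
      fun_prop
    have e1 : ∀ ω, ENNReal.ofReal (‖X ω - MarkovQuant.prodProj proj (X ω)‖ ^ 2) =
        ∑ l, ENNReal.ofReal ((X ω l - proj l (X ω l)) ^ 2) := by
      intro ω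
      rw [EuclideanSpace.norm_sq_eq, ENNReal.ofReal_sum_of_nonneg fun l _ => by positivity]
      simp [MarkovQuant.prodProj]
    have hml : ∀ l, Measurable fun ω => ENNReal.ofReal ((X ω l - proj l (X ω l)) ^ 2) :=
      fun l => (hms l).comp (hXl l)
    rw [lintegral_congr e1, lintegral_finsetSum _ fun l _ => hml l]
    refine Finset.sum_congr rfl fun l _ => ?_
    rw [distortion_eq_of_isNearestProj (hproj l), lintegral_map (hms l) (hXl l)]
  have hsq : ∀ l, MarkovQuant.distortion (P.map fun ω => X ω l) (Γ l) ≤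
      (ENNReal.ofReal K * ν) ^ 2 * (W l) ^ (2 / p) := by
    intro l
    have h := pow_le_pow_left' (hcomp l) 2
    rw [mul_pow, ← ENNReal.rpow_natCast, ← ENNReal.rpow_mul, ← ENNReal.rpow_natCast (_ ^ (1 / p)),
      ← ENNReal.rpow_mul] at h
    norm_num at h
    rwa [show p⁻¹ * 2 = 2 / p by ring] at h
  -- `ℓ²(L^p)` is controlled by the rescaled `ℓ^p(L^p)`
  have hpow : (∑ l, (W l) ^ (2 / p)) ^ (p / 2) ≤ ENNReal.ofReal m := by
    have h := ENNReal.rpow_sum_le_const_mul_sum_rpow (s := Finset.univ) (f := fun l => (W l) ^ (2 / p))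
      (by linarith : 1 ≤ p / 2)
    have e : ∀ l, ((W l) ^ (2 / p)) ^ (p / 2) = W l := fun l => by
      rw [← ENNReal.rpow_mul, div_mul_div_cancel₀ hp0.ne', div_self two_ne_zero, ENNReal.rpow_one]
    simp only [e, Finset.card_univ, Fintype.card_fin] at h
    refine h.trans (le_trans (le_of_eq ?_) hm)
    rw [← ENNReal.ofReal_rpow_of_nonneg hd0.le (by linarith), ENNReal.ofReal_natCast]
  have hroot : (∑ l, (W l) ^ (2 / p)) ^ (1 / 2 : ℝ) ≤ ENNReal.ofReal (m ^ (1 / p)) := by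
    have h := ENNReal.rpow_le_rpow hpow (by positivity : 0 ≤ 1 / p)
    rw [← ENNReal.rpow_mul, ENNReal.ofReal_rpow_of_nonneg hm0 (by positivity)] at h
    rwa [show p / 2 * (1 / p) = 1 / 2 by field_simp] at h
  rw [eLpNorm_two_eq_lintegral, hdist]
  calc (∑ l, MarkovQuant.distortion (P.map fun ω => X ω l) (Γ l)) ^ (1 / 2 : ℝ)
      ≤ (∑ l, (ENNReal.ofReal K * ν) ^ 2 * (W l) ^ (2 / p)) ^ (1 / 2 : ℝ) := by
        gcongr with l; exact hsq l
    _ = ENNReal.ofReal K * ν * (∑ l, (W l) ^ (2 / p)) ^ (1 / 2 : ℝ) := by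
        rw [← Finset.mul_sum, ENNReal.mul_rpow_of_nonneg _ _ (by norm_num), ← ENNReal.rpow_natCast,
          ← ENNReal.rpow_mul]
        norm_num
    _ ≤ ENNReal.ofReal K * ν * ENNReal.ofReal (m ^ (1 / p)) := by gcongr
    _ = _ := by ring

/-! ### The coefficients of the error bound -/

/-- A bound for the `p`-th moment at time `t`: the bracket in the coefficient `coeffA`, with the
power of `d` in front of `L` reduced to the first one. -/
noncomputable def momentBound (d : ℕ) (Δ r L p t : ℝ) : ℝ :=
  Real.exp ((MarkovQuant.kappa L p + MarkovQuant.bigK d Δ L p) * t) * r ^ p +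
    (Real.exp (MarkovQuant.kappa L p * Δ) * L +
      MarkovQuant.bigK d Δ L p / (d : ℝ) ^ (p / 2 - 1)) /
        (MarkovQuant.kappa L p + MarkovQuant.bigK d Δ L p) *
      (Real.exp ((MarkovQuant.kappa L p + MarkovQuant.bigK d Δ L p) * t) - 1)

theorem momentBound_nonneg {d : ℕ} {Δ r L p t : ℝ} (hL : 0 < L) (hΔ : 0 < Δ) (hp : 2 < p)
    (hr : 0 ≤ r) (ht : 0 ≤ t) : 0 ≤ momentBound d Δ r L p t := by
  have h1 := kappa_pos hL hp
  have h2 := bigK_nonneg (d := d) hL hΔ hp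
  have h3 : 0 ≤ Real.exp ((MarkovQuant.kappa L p + MarkovQuant.bigK d Δ L p) * t) - 1 :=
    sub_nonneg.2 (Real.one_le_exp (by positivity))
  unfold momentBound
  positivity

/-- The exponential prefactor of `coeffA` is at least one, and so is every further power of `d`. -/
theorem momentBound_rpow_le_coeffA {d : ℕ} (hd : 0 < d) {k k' : ℕ} (hk' : 1 ≤ k') (hk : k' ≤ k)
    {C Δ r L p : ℝ} (hC : 0 ≤ C) (hL : 0 < L) (hΔ : 0 < Δ) (hp : 2 < p) (hr : 0 ≤ r) :
    momentBound d Δ r L p (k' * Δ) ^ (1 / p) ≤ MarkovQuant.coeffA d k k' C Δ r L p := by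
  have hp0 : 0 < p := by linarith
  have hd1 : (1 : ℝ) ≤ d := by exact_mod_cast hd
  have h1 := kappa_pos hL hp
  have h2 := bigK_nonneg (d := d) hL hΔ hp
  have hmb := momentBound_nonneg (d := d) (t := k' * Δ) hL hΔ hp hr (by positivity)
  have h3 : 0 ≤ Real.exp ((MarkovQuant.kappa L p + MarkovQuant.bigK d Δ L p) * (k' * Δ)) - 1 :=
    sub_nonneg.2 (Real.one_le_exp (by positivity))
  have hkk : (1 : ℝ) ≤ k := by exact_mod_cast hk'.trans hk
  have hkk' : (k' : ℝ) ≤ k := by exact_mod_cast hk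
  have hD : (d : ℝ) ^ (p / 2 - 1) ≤ (d : ℝ) ^ ((k : ℝ) * (p / 2 - 1)) :=
    Real.rpow_le_rpow_of_exponent_le hd1 (by nlinarith)
  have hD0 : 0 < (d : ℝ) ^ (p / 2 - 1) := by positivity
  unfold MarkovQuant.coeffA
  have hexp : 1 ≤ Real.exp (Δ * C * (((k : ℝ) - k') / p)) := by
    apply Real.one_le_exp
    have : 0 ≤ ((k : ℝ) - k') / p := div_nonneg (by linarith) hp0.le
    positivity
  refine le_trans ?_ (le_mul_of_one_le_left (by positivity) hexp)
  refine Real.rpow_le_rpow hmb ?_ (by positivity)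
  unfold momentBound
  refine add_le_add le_rfl (mul_le_mul_of_nonneg_right ?_ h3)
  rw [div_le_div_iff₀ (by positivity) (by positivity)]
  have e : (Real.exp (MarkovQuant.kappa L p * Δ) * L +
      MarkovQuant.bigK d Δ L p / (d : ℝ) ^ (p / 2 - 1)) *
      ((d : ℝ) ^ (p / 2 - 1) * (MarkovQuant.kappa L p + MarkovQuant.bigK d Δ L p)) =
      ((d : ℝ) ^ (p / 2 - 1) * Real.exp (MarkovQuant.kappa L p * Δ) * L +
        MarkovQuant.bigK d Δ L p) * (MarkovQuant.kappa L p + MarkovQuant.bigK d Δ L p) := by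
    field_simp
  rw [e]
  gcongr

/-- The centre used in the moment estimate: the starting point in dimension at least two, the origin
in dimension one. -/
noncomputable def centre {d : ℕ} (x₀ : EuclideanSpace ℝ (Fin d)) : EuclideanSpace ℝ (Fin d) :=
  if 2 ≤ d then x₀ else 0

/-- At the centre `x₀` the moment starts from zero and `|x₀| ^ p` enters through the recursion; at
the centre `0` it is the other way round. Either way the bound is `momentBound`. -/
theorem exp_phi_centre_add_le {d : ℕ} (hd : 0 < d) {Δ L p t : ℝ}
    (hp : 2 < p) (x₀ : EuclideanSpace ℝ (Fin d)) :
    Real.exp ((MarkovQuant.kappa L p + MarkovQuant.bigK d Δ L p) * t) * phi p (centre x₀) x₀ +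
      (Real.exp ((MarkovQuant.kappa L p + MarkovQuant.bigK d Δ L p) * t) - 1) *
        (‖centre x₀‖ ^ p + (Real.exp (MarkovQuant.kappa L p * Δ) * L +
          MarkovQuant.bigK d Δ L p / (d : ℝ) ^ (p / 2 - 1)) /
            (MarkovQuant.kappa L p + MarkovQuant.bigK d Δ L p)) ≤
      momentBound d Δ ‖x₀‖ L p t := by
  have hp0 : p ≠ 0 := by linarith
  by_cases h : 2 ≤ d
  · have hc : centre x₀ = x₀ := if_pos h
    have h0 : phi p x₀ x₀ = 0 := by simp [phi, Real.zero_rpow hp0]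
    rw [hc, h0, momentBound]
    have : 0 ≤ ‖x₀‖ ^ p := by positivity
    linarith
  · have hd1 : d = 1 := by omega
    subst hd1
    have hc : centre x₀ = 0 := if_neg h
    have h0 : phi p 0 x₀ = ‖x₀‖ ^ p := by
      simp [phi, EuclideanSpace.norm_eq, Real.sqrt_sq_eq_abs]
    rw [hc, h0, momentBound, norm_zero, Real.zero_rpow hp0]
    linarith

/-! ### The schemes and the error estimate -/

theorem abs_apply_le_frobNorm {d q : ℕ} (A : Matrix (Fin d) (Fin q) ℝ) (i : Fin d) (j : Fin q) :
    |A i j| ≤ MarkovQuant.frobNorm A := by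
  unfold MarkovQuant.frobNorm
  apply Real.abs_le_sqrt
  calc A i j ^ 2 ≤ ∑ j', A i j' ^ 2 :=
        Finset.single_le_sum (f := fun j' => A i j' ^ 2) (fun _ _ => sq_nonneg _) (Finset.mem_univ j)
    _ ≤ _ := Finset.single_le_sum (f := fun i' => ∑ j', A i' j' ^ 2)
        (fun _ _ => Finset.sum_nonneg fun _ _ => sq_nonneg _) (Finset.mem_univ i)

/-- Lipschitz maps are Borel. -/
theorem measurable_of_norm_sub_le {E F : Type*} [NormedAddCommGroup E] [MeasurableSpace E]
    [BorelSpace E] [NormedAddCommGroup F] [MeasurableSpace F] [BorelSpace F] {f : E → F} {C : ℝ}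
    (h : ∀ x y, ‖f x - f y‖ ≤ C * ‖x - y‖) : Measurable f :=
  (LipschitzWith.of_dist_le_mul (K := C.toNNReal) fun x y => by
    rw [dist_eq_norm, dist_eq_norm]
    exact (h x y).trans (by gcongr; exact Real.le_coe_toNNReal C)).continuous.measurable

/-- A Lipschitz bound forces a nonnegative constant once the domain has two points, i.e. `0 < d`. -/
theorem nonneg_of_norm_sub_le {d : ℕ} (hd : 0 < d) {F : Type*} [NormedAddCommGroup F]
    {f : EuclideanSpace ℝ (Fin d) → F} {C : ℝ} (h : ∀ x y, ‖f x - f y‖ ≤ C * ‖x - y‖) : 0 ≤ C := by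
  have h1 := (norm_nonneg _).trans (h (EuclideanSpace.single ⟨0, hd⟩ (1 : ℝ)) 0)
  simpa using h1

/-- Moments of `X̃_k`: the one-step bound `lintegral_phi_eulerOp_le` is iterated, quantization being
a contraction for `phi` by `lintegral_phi_prodProj_le`. -/
theorem lintegral_phi_tildeX_le {d q n : ℕ} (hd : 0 < d) {Ω : Type*} [MeasurableSpace Ω]
    {P : Measure Ω} [IsProbabilityMeasure P]
    {b : ℝ → EuclideanSpace ℝ (Fin d) → EuclideanSpace ℝ (Fin d)}
    {σ : ℝ → EuclideanSpace ℝ (Fin d) → Matrix (Fin d) (Fin q) ℝ} {Δ L p : ℝ} (hL : 0 < L)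
    (hΔ : 0 < Δ) (hp : 2 < p) (hp3 : p ≤ 3)
    (hbg : ∀ k < n, ∀ x, ‖b (k * Δ) x‖ ≤ L * (1 + ‖x‖))
    (hσg : ∀ k < n, ∀ x, MarkovQuant.frobNorm (σ (k * Δ) x) ≤ L * (1 + ‖x‖))
    (hbm : ∀ k < n, Measurable (b (k * Δ)))
    (hσm : ∀ k < n, ∀ i j, Measurable fun x => σ (k * Δ) x i j)
    (x₀ : EuclideanSpace ℝ (Fin d)) {Z : ℕ → Ω → EuclideanSpace ℝ (Fin q)}
    (hZm : ∀ k ∈ Finset.Icc 1 n, Measurable (Z k))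
    (hZlaw : ∀ k ∈ Finset.Icc 1 n, HasLaw (Z k) (stdGaussian (EuclideanSpace ℝ (Fin q))) P)
    (hZind : iIndepFun (fun k : Finset.Icc 1 n => Z k) P) {Ncomp : ℕ → Fin d → ℕ}
    {Γ : ℕ → Fin d → Finset ℝ} {proj : ℕ → Fin d → ℝ → ℝ}
    (hproj : ∀ k ≤ n, ∀ l, MarkovQuant.IsNearestProj (Γ k l) (proj k l))
    (hΓ : ∀ k ≤ n, ∀ l, MarkovQuant.IsOptimalQuantizer
      (P.map (fun ω => MarkovQuant.tildeX b σ Δ x₀ Z proj k ω l)) (Ncomp k l) (Γ k l))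
    (c : EuclideanSpace ℝ (Fin d)) (hcase : 2 ≤ d ∨ c = 0) {k : ℕ} (hk : k ≤ n) :
    ∫⁻ ω, ENNReal.ofReal (phi p c (MarkovQuant.tildeX b σ Δ x₀ Z proj k ω)) ∂P ≤
      ENNReal.ofReal (
        Real.exp ((MarkovQuant.kappa L p + MarkovQuant.bigK d Δ L p) * (k * Δ)) * phi p c x₀ +
        (Real.exp ((MarkovQuant.kappa L p + MarkovQuant.bigK d Δ L p) * (k * Δ)) - 1) *
        (‖c‖ ^ p + (Real.exp (MarkovQuant.kappa L p * Δ) * L +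
          MarkovQuant.bigK d Δ L p / (d : ℝ) ^ (p / 2 - 1)) /
            (MarkovQuant.kappa L p + MarkovQuant.bigK d Δ L p))) := by
  induction k with
  | zero => simp [MarkovQuant.tildeX]
  | succ k ih =>
    have hkn : k < n := by omega
    have ih := ih hkn.le
    have hκ := kappa_pos hL hp
    have hK := bigK_nonneg (d := d) hL hΔ hp
    have hS := stepConst_nonneg (d := d) hL hΔ hp (norm_nonneg c)
    set Λ := MarkovQuant.kappa L p + MarkovQuant.bigK d Δ L p with hΛ
    have hΛ0 : 0 < Λ := by linarith
    have hE0 : 0 ≤ Real.exp (Λ * (k * Δ)) - 1 := sub_nonneg.2 (Real.one_le_exp (by positivity))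
    have hT := measurable_tildeX hbm hσm x₀ Z (fun k hk l => (hproj k hk l).measurable) hkn.le
    have hTm := hT.mono (pastSigma_le hZm k) le_rfl
    have hpm := measurable_prodProj fun l => (hproj k hkn.le l).measurable
    have hk1 : k + 1 ∈ Finset.Icc 1 n := Finset.mem_Icc.2 ⟨by omega, hk⟩
    have hphi : Measurable fun y : EuclideanSpace ℝ (Fin d) => ENNReal.ofReal (phi p c y) := by
      unfold phi; fun_prop
    have hphi_hat : Measurable fun ω => ENNReal.ofReal (phi p c
        (MarkovQuant.prodProj (proj k) (MarkovQuant.tildeX b σ Δ x₀ Z proj k ω))) :=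
      hphi.comp (hpm.comp hTm)
    have hstep := lintegral_comp_pair (P := P) (hpm.comp hTm) (hZm _ hk1) (hZlaw _ hk1)
      (indepFun_of_measurable_pastSigma hZm hZind hkn (hpm.comp hT))
      (f := fun w => ENNReal.ofReal (phi p c (MarkovQuant.eulerOp b σ Δ k w.1 w.2)))
      (hphi.comp (measurable_eulerOp (hbm k hkn) (hσm k hkn)))
    have e0 : ∀ ω, MarkovQuant.tildeX b σ Δ x₀ Z proj (k + 1) ω = MarkovQuant.eulerOp b σ Δ k
        (MarkovQuant.prodProj (proj k) (MarkovQuant.tildeX b σ Δ x₀ Z proj k ω)) (Z (k + 1) ω) :=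
      fun _ => rfl
    simp only [e0]
    set S := ‖c‖ ^ p + (Real.exp (MarkovQuant.kappa L p * Δ) * L +
      MarkovQuant.bigK d Δ L p / (d : ℝ) ^ (p / 2 - 1)) / Λ with hSdef
    have hS0 : 0 ≤ S := by positivity
    -- `S` is the fixed offset for which the affine recursion is `u ↦ exp (Λ Δ) (u + S) - S`.
    have hstepS : stepConst d Δ L p ‖c‖ = (Real.exp (Λ * Δ) - 1) * S := rfl
    have hexp : Real.exp (Λ * ((k + 1 : ℕ) * Δ)) = Real.exp (Λ * Δ) * Real.exp (Λ * (k * Δ)) := by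
      rw [← Real.exp_add]; congr 1; push_cast; ring
    have hphi0 := phi_nonneg p c x₀
    calc _ = ∫⁻ ω, ∫⁻ z, ENNReal.ofReal (phi p c (MarkovQuant.eulerOp b σ Δ k
            (MarkovQuant.prodProj (proj k) (MarkovQuant.tildeX b σ Δ x₀ Z proj k ω)) z))
              ∂(stdGaussian (EuclideanSpace ℝ (Fin q))) ∂P := hstep
      _ ≤ ∫⁻ ω, (ENNReal.ofReal (Real.exp (Λ * Δ)) * ENNReal.ofReal (phi p c
            (MarkovQuant.prodProj (proj k) (MarkovQuant.tildeX b σ Δ x₀ Z proj k ω))) +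
              ENNReal.ofReal (stepConst d Δ L p ‖c‖)) ∂P := by
          refine lintegral_mono fun ω => ?_
          rw [← ENNReal.ofReal_mul (Real.exp_pos _).le, ← ENNReal.ofReal_add
            (mul_nonneg (Real.exp_pos _).le (phi_nonneg _ _ _)) hS]
          exact lintegral_phi_eulerOp_le hd b σ hL hΔ hp hp3 k c _ hcase (hbg k hkn _) (hσg k hkn _)
      _ = ENNReal.ofReal (Real.exp (Λ * Δ)) * ∫⁻ ω, ENNReal.ofReal (phi p c
            (MarkovQuant.prodProj (proj k) (MarkovQuant.tildeX b σ Δ x₀ Z proj k ω))) ∂P +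
              ENNReal.ofReal (stepConst d Δ L p ‖c‖) := by
          rw [lintegral_add_right _ measurable_const, lintegral_const_mul _ hphi_hat]
          simp
      _ ≤ ENNReal.ofReal (Real.exp (Λ * Δ)) * ENNReal.ofReal (Real.exp (Λ * (k * Δ)) * phi p c x₀ +
            (Real.exp (Λ * (k * Δ)) - 1) * S) + ENNReal.ofReal (stepConst d Δ L p ‖c‖) := by
          gcongr
          exact (lintegral_phi_prodProj_le hp c hTm (hproj k hkn.le) (hΓ k hkn.le)).trans ih
      _ = _ := by
          rw [← ENNReal.ofReal_mul (Real.exp_pos _).le, ← ENNReal.ofReal_add (by positivity) hS,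
            hstepS, hexp]
          congr 1
          ring

/-- There is no quantization error at time `0`, which is why the sum over `k'` starts at `1`. -/
theorem hatX_zero {d q : ℕ} {Ω : Type*} [MeasurableSpace Ω] {P : Measure Ω}
    [IsProbabilityMeasure P]
    {b : ℝ → EuclideanSpace ℝ (Fin d) → EuclideanSpace ℝ (Fin d)}
    {σ : ℝ → EuclideanSpace ℝ (Fin d) → Matrix (Fin d) (Fin q) ℝ} {Δ : ℝ}
    {x₀ : EuclideanSpace ℝ (Fin d)} {Z : ℕ → Ω → EuclideanSpace ℝ (Fin q)}
    {proj : ℕ → Fin d → ℝ → ℝ} {N : Fin d → ℕ} {Γ : Fin d → Finset ℝ}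
    (hproj : ∀ l, MarkovQuant.IsNearestProj (Γ l) (proj 0 l))
    (hΓ : ∀ l, MarkovQuant.IsOptimalQuantizer
      (P.map (fun ω => MarkovQuant.tildeX b σ Δ x₀ Z proj 0 ω l)) (N l) (Γ l)) (ω : Ω) :
    MarkovQuant.hatX b σ Δ x₀ Z proj 0 ω = x₀ := by
  ext l
  have h := hΓ l
  simp only [MarkovQuant.tildeX, Measure.map_const, measure_univ, one_smul] at h
  exact proj_eq_self_of_dirac h (hproj l)

/-- Propagation of the local quantization errors `‖X̃_j - X̂_j‖₂` through the `L²`-Lipschitz Euler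
steps. -/
theorem eLpNorm_euler_sub_hatX_le {d q n : ℕ} {Ω : Type*} [MeasurableSpace Ω]
    {P : Measure Ω} [IsProbabilityMeasure P]
    {b : ℝ → EuclideanSpace ℝ (Fin d) → EuclideanSpace ℝ (Fin d)}
    {σ : ℝ → EuclideanSpace ℝ (Fin d) → Matrix (Fin d) (Fin q) ℝ} {Δ B S : ℝ}
    (hΔ : 0 < Δ) (hB : 0 ≤ B)
    (hb : ∀ k < n, ∀ x y, ‖b (k * Δ) x - b (k * Δ) y‖ ≤ B * ‖x - y‖)
    (hσ : ∀ k < n, ∀ x y,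
      MarkovQuant.frobNorm (σ (k * Δ) x - σ (k * Δ) y) ≤ S * ‖x - y‖)
    (hbm : ∀ k < n, Measurable (b (k * Δ)))
    (hσm : ∀ k < n, ∀ i j, Measurable fun x => σ (k * Δ) x i j)
    (x₀ : EuclideanSpace ℝ (Fin d)) {Z : ℕ → Ω → EuclideanSpace ℝ (Fin q)}
    (hZm : ∀ k ∈ Finset.Icc 1 n, Measurable (Z k))
    (hZlaw : ∀ k ∈ Finset.Icc 1 n, HasLaw (Z k) (stdGaussian (EuclideanSpace ℝ (Fin q))) P)
    (hZind : iIndepFun (fun k : Finset.Icc 1 n => Z k) P) {proj : ℕ → Fin d → ℝ → ℝ}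
    (hproj : ∀ k ≤ n, ∀ l, Measurable (proj k l))
    (h0 : ∀ ω, MarkovQuant.hatX b σ Δ x₀ Z proj 0 ω = x₀) {k : ℕ} (hk : k ≤ n) :
    eLpNorm (fun ω => MarkovQuant.euler b σ Δ x₀ Z k ω - MarkovQuant.hatX b σ Δ x₀ Z proj k ω) 2 P ≤
      ∑ j ∈ Finset.Icc 1 k, ENNReal.ofReal (Real.exp (((k : ℝ) - j) * Δ * (B + S ^ 2 / 2))) *
        eLpNorm (fun ω => MarkovQuant.tildeX b σ Δ x₀ Z proj j ω -
          MarkovQuant.hatX b σ Δ x₀ Z proj j ω) 2 P := by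
  induction k with
  | zero => simp [MarkovQuant.euler, h0]
  | succ k ih =>
    have hkn : k < n := by omega
    have ih := ih hkn.le
    have hk1 : k + 1 ∈ Finset.Icc 1 n := Finset.mem_Icc.2 ⟨by omega, hk⟩
    have hX := measurable_euler hbm hσm x₀ Z hkn.le
    have hT := measurable_tildeX hbm hσm x₀ Z hproj hkn.le
    have hY := (measurable_prodProj (hproj k hkn.le)).comp hT
    have hX' := (measurable_euler hbm hσm x₀ Z hk).mono (pastSigma_le hZm (k + 1)) le_rfl
    have hT' := (measurable_tildeX hbm hσm x₀ Z hproj hk).mono (pastSigma_le hZm (k + 1)) le_rfl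
    have hY' := (measurable_prodProj (hproj (k + 1) hk)).comp hT'
    have hstep := eLpNorm_eulerOp_sub_le hΔ.le hB (hb k hkn) (hσ k hkn) (hbm k hkn) (hσm k hkn)
      (hX.mono (pastSigma_le hZm k) le_rfl) (hY.mono (pastSigma_le hZm k) le_rfl) (hZm _ hk1)
      (hZlaw _ hk1) (indepFun_of_measurable_pastSigma hZm hZind hkn (hX.prodMk hY))
    have e : (fun ω => MarkovQuant.euler b σ Δ x₀ Z (k + 1) ω -
        MarkovQuant.hatX b σ Δ x₀ Z proj (k + 1) ω) =
        (fun ω => MarkovQuant.euler b σ Δ x₀ Z (k + 1) ω -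
          MarkovQuant.tildeX b σ Δ x₀ Z proj (k + 1) ω) +
        fun ω => MarkovQuant.tildeX b σ Δ x₀ Z proj (k + 1) ω -
          MarkovQuant.hatX b σ Δ x₀ Z proj (k + 1) ω := by
      funext ω; simp
    rw [Finset.sum_Icc_succ_top (by omega), e]
    refine (eLpNorm_add_le (hX'.sub hT').aestronglyMeasurable (hT'.sub hY').aestronglyMeasurable
      (by norm_num)).trans (add_le_add ?_ (le_of_eq (by simp; rfl)))
    refine (hstep.trans (mul_le_mul' le_rfl ih)).trans (le_of_eq ?_)
    rw [Finset.mul_sum]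
    refine Finset.sum_congr rfl fun j _ => ?_
    rw [← mul_assoc, ← ENNReal.ofReal_mul (Real.exp_pos _).le, ← Real.exp_add]
    congr 3
    push_cast
    ring

theorem theorem3p1
    {d q : ℕ} (hd : 0 < d)
    -- coefficients: Lipschitz in space uniformly in time, with linear growth
    (b : ℝ → EuclideanSpace ℝ (Fin d) → EuclideanSpace ℝ (Fin d))
    (σ : ℝ → EuclideanSpace ℝ (Fin d) → Matrix (Fin d) (Fin q) ℝ)
    (T : ℝ) (hT : 0 < T) (bLip σLip L : ℝ) (hL : 0 < L)
    (hbLip : ∀ t ∈ Set.Icc 0 T, ∀ x y, ‖b t x - b t y‖ ≤ bLip * ‖x - y‖)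
    (hσLip : ∀ t ∈ Set.Icc 0 T, ∀ x y, MarkovQuant.frobNorm (σ t x - σ t y) ≤ σLip * ‖x - y‖)
    (hbgrowth : ∀ t ∈ Set.Icc 0 T, ∀ x, ‖b t x‖ ≤ L * (1 + ‖x‖))
    (hσgrowth : ∀ t ∈ Set.Icc 0 T, ∀ x, MarkovQuant.frobNorm (σ t x) ≤ L * (1 + ‖x‖))
    -- time discretization, starting point, Gaussian innovations
    (n : ℕ) (hn : 0 < n) (Δ : ℝ) (hΔ : Δ = T / n)
    (x₀ : EuclideanSpace ℝ (Fin d))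
    {Ω : Type*} [MeasurableSpace Ω] (P : Measure Ω) [IsProbabilityMeasure P]
    (Z : ℕ → Ω → EuclideanSpace ℝ (Fin q))
    (hZmeas : ∀ k ∈ Finset.Icc 1 n, Measurable (Z k))
    (hZlaw : ∀ k ∈ Finset.Icc 1 n, HasLaw (Z k) (stdGaussian (EuclideanSpace ℝ (Fin q))) P)
    (hZindep : iIndepFun (fun k : Finset.Icc 1 n => Z k) P)
    -- Markovian product quantizers: the component grid `Γ k l` has level `Ncomp k l`
    (N : ℕ → ℕ) (Ncomp : ℕ → Fin d → ℕ)
    (hN : ∀ k ≤ n, 1 ≤ N k) (hNcomp : ∀ k ≤ n, ∀ l, N k ≤ Ncomp k l ^ d)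
    (Γ : ℕ → Fin d → Finset ℝ) (proj : ℕ → Fin d → ℝ → ℝ)
    (hproj : ∀ k ≤ n, ∀ l, MarkovQuant.IsNearestProj (Γ k l) (proj k l))
    (hΓ : ∀ k ≤ n, ∀ l, MarkovQuant.IsOptimalQuantizer
      (P.map (fun ω => MarkovQuant.tildeX b σ Δ x₀ Z proj k ω l)) (Ncomp k l) (Γ k l))
    (η : ℝ) (hη : η ∈ Set.Ioc (0 : ℝ) 1) :
    (∃ K : ℝ, MarkovQuant.IsPierceConstant η K) ∧
    ∀ K : ℝ, MarkovQuant.IsPierceConstant η K → ∀ k ≤ n,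
      eLpNorm (fun ω => MarkovQuant.euler b σ Δ x₀ Z k ω - MarkovQuant.hatX b σ Δ x₀ Z proj k ω) 2 P
        ≤ ENNReal.ofReal (K * ∑ k' ∈ Finset.Icc 1 k,
            Real.exp (((k : ℝ) - k') * Δ * (bLip + σLip ^ 2 / 2)) *
              MarkovQuant.coeffA d k k' (bLip + σLip ^ 2 / 2) Δ ‖x₀‖ L (2 + η) *
              (N k' : ℝ) ^ (-(1 / (d : ℝ)))) := by
  obtain ⟨hη0, hη1⟩ := hη
  refine ⟨exists_isPierceConstant hη0 hη1, fun K hK k hk => ?_⟩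
  have hn0 : (0 : ℝ) < n := by exact_mod_cast hn
  have hΔ0 : 0 < Δ := by rw [hΔ]; positivity
  have ht : ∀ j < n, (j : ℝ) * Δ ∈ Set.Icc 0 T := by
    intro j hj
    have hjn : (j : ℝ) ≤ n := by exact_mod_cast hj.le
    refine ⟨by positivity, ?_⟩
    rw [hΔ, mul_div_assoc', div_le_iff₀ hn0]
    nlinarith
  have hp : 2 < 2 + η := by linarith
  have hp3 : 2 + η ≤ 3 := by linarith
  have hB : 0 ≤ bLip := nonneg_of_norm_sub_le hd (hbLip 0 ⟨le_rfl, hT.le⟩)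
  have hbm : ∀ j < n, Measurable (b (j * Δ)) :=
    fun j hj => measurable_of_norm_sub_le (hbLip _ (ht j hj))
  have hσm : ∀ j < n, ∀ i l, Measurable fun x => σ (j * Δ) x i l := by
    intro j hj i l
    refine measurable_of_norm_sub_le (C := σLip) fun x y => ?_
    rw [Real.norm_eq_abs]
    exact (abs_apply_le_frobNorm (σ (j * Δ) x - σ (j * Δ) y) i l).trans (hσLip _ (ht j hj) x y)
  have hcase : 2 ≤ d ∨ centre x₀ = 0 := by
    by_cases h : 2 ≤ d
    · exact Or.inl h
    · exact Or.inr (if_neg h)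
  refine (eLpNorm_euler_sub_hatX_le hΔ0 hB (fun j hj => hbLip _ (ht j hj))
    (fun j hj => hσLip _ (ht j hj)) hbm hσm x₀ hZmeas hZlaw hZindep
    (fun j hj l => (hproj j hj l).measurable)
    (hatX_zero (hproj 0 (Nat.zero_le n)) (hΓ 0 (Nat.zero_le n))) hk).trans ?_
  set C := bLip + σLip ^ 2 / 2 with hC
  have hC0 : 0 ≤ C := by positivity
  have hco : ∀ j ∈ Finset.Icc 1 k,
      momentBound d Δ ‖x₀‖ L (2 + η) (j * Δ) ^ (1 / (2 + η)) ≤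
        MarkovQuant.coeffA d k j C Δ ‖x₀‖ L (2 + η) := fun j hj =>
    momentBound_rpow_le_coeffA hd (Finset.mem_Icc.1 hj).1 (Finset.mem_Icc.1 hj).2 hC0 hL hΔ0 hp
      (norm_nonneg _)
  have hmb : ∀ j : ℕ, 0 ≤ momentBound d Δ ‖x₀‖ L (2 + η) (j * Δ) := fun j =>
    momentBound_nonneg hL hΔ0 hp (norm_nonneg _) (by positivity)
  have hterm : ∀ j ∈ Finset.Icc 1 k, 0 ≤ Real.exp (((k : ℝ) - j) * Δ * C) *
      MarkovQuant.coeffA d k j C Δ ‖x₀‖ L (2 + η) * (N j : ℝ) ^ (-(1 / (d : ℝ))) := fun j hj =>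
    mul_nonneg (mul_nonneg (Real.exp_pos _).le
      ((Real.rpow_nonneg (hmb j) _).trans (hco j hj))) (by positivity)
  rw [ENNReal.ofReal_mul' (Finset.sum_nonneg hterm), ENNReal.ofReal_sum_of_nonneg hterm,
    Finset.mul_sum]
  refine Finset.sum_le_sum fun j hj => ?_
  have hjn : j ≤ n := (Finset.mem_Icc.1 hj).2.trans hk
  have hTm := (measurable_tildeX hbm hσm x₀ Z (fun k hk l => (hproj k hk l).measurable) hjn).mono
    (pastSigma_le hZmeas j) le_rfl
  have hmom := (lintegral_phi_tildeX_le hd hL hΔ0 hp hp3 (fun j hj => hbgrowth _ (ht j hj))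
    (fun j hj => hσgrowth _ (ht j hj)) hbm hσm x₀ hZmeas hZlaw hZindep hproj hΓ (centre x₀) hcase
    hjn).trans (ENNReal.ofReal_le_ofReal (exp_phi_centre_add_le hd hp x₀))
  have hq := eLpNorm_sub_prodProj_le hd hη0 hK (centre x₀) hTm (hN j hjn) (hNcomp j hjn)
    (hproj j hjn) (hΓ j hjn) (hmb j) hmom
  have hcj := (Real.rpow_nonneg (hmb j) (1 / (2 + η))).trans (hco j hj)
  rw [ENNReal.ofReal_mul (mul_nonneg (Real.exp_pos _).le hcj),
    ENNReal.ofReal_mul (Real.exp_pos _).le]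
  calc _ ≤ ENNReal.ofReal (Real.exp (((k : ℝ) - j) * Δ * C)) * (ENNReal.ofReal K *
        (ENNReal.ofReal (momentBound d Δ ‖x₀‖ L (2 + η) (j * Δ) ^ (1 / (2 + η))) *
          ENNReal.ofReal ((N j : ℝ) ^ (-(1 / (d : ℝ)))))) := mul_le_mul' le_rfl hq
    _ ≤ ENNReal.ofReal (Real.exp (((k : ℝ) - j) * Δ * C)) * (ENNReal.ofReal K *
        (ENNReal.ofReal (MarkovQuant.coeffA d k j C Δ ‖x₀‖ L (2 + η)) *
          ENNReal.ofReal ((N j : ℝ) ^ (-(1 / (d : ℝ)))))) := by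
        gcongr
        exact hco j hj
    _ = _ := by ring
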